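/- There are absolute constants and two fixed query algorithms on a word RAM such that the following holds for every unweighted directed multigraph $G=(V,E)$ with $n$ vertices and $m$ edges (all edges have capacity one), every source $s\in V$ and every sink $t\in V$ with $s\neq t$. There exist an $(s,t)$-max-flow $f$ of $G$ with values in $\{0,1\}$, of value $\lambda$ say, and a data structure of size $O(\lambda n)$ (counted in words of $O(\log(n+m))$ bits) such that for every set $F\subseteq E$ of at most two edges there is an $(s,t)$-max-flow $f'$ of $G-F$, with values in $\{0,1\}$, for which: 1. given $F$, the data structure lists all edges $e$ of $G-F$ with $f'(e)\neq f(e)$ in $O(n)$ time; 2. if moreover $|F|=1$, then, given $F$ and any edge $e$ of $G-F$, the data structure determines in $O(1)$ time whether $f'(e)$ is $0$ or $1$. -/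

import Mathlib

/-! ### Directed multigraphs and unit-capacity flows -/

/-- A directed multigraph with vertex set `V` and edge set `E`; every edge has a tail `src` and a
head `tgt`. Parallel edges and self-loops are allowed. -/
structure MultiDigraph (V E : Type*) where
  src : E → V
  tgt : E → V

namespace MultiDigraph

variable {V E : Type*}

/-- The graph `G - F`, obtained by deleting the edges in `F`. -/
def deleteEdges (G : MultiDigraph V E) (F : Finset E) : MultiDigraph V {e : E // e ∉ F} where
  src e := G.src e.1
  tgt e := G.tgt e.1

variable [DecidableEq V] [Fintype E]

/-- Flow leaving `v` minus flow entering `v`. -/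
noncomputable def netOut (G : MultiDigraph V E) (f : E → ℝ) (v : V) : ℝ :=
  (∑ e, if G.src e = v then f e else 0) - ∑ e, if G.tgt e = v then f e else 0

/-- `f` is an `(s,t)`-flow of `G`, where every edge has capacity one. -/
structure IsFlow (G : MultiDigraph V E) (s t : V) (f : E → ℝ) : Prop where
  nonneg : ∀ e, 0 ≤ f e
  le_one : ∀ e, f e ≤ 1
  conserve : ∀ v, v ≠ s → v ≠ t → G.netOut f v = 0

/-- The value of a flow with source `s`. -/
noncomputable def flowValue (G : MultiDigraph V E) (s : V) (f : E → ℝ) : ℝ := G.netOut f s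

/-- `f` is an `(s,t)`-max-flow of `G`: its value is the largest among all (real) `(s,t)`-flows. -/
def IsMaxFlow (G : MultiDigraph V E) (s t : V) (f : E → ℝ) : Prop :=
  G.IsFlow s t f ∧ ∀ g : E → ℝ, G.IsFlow s t g → G.flowValue s g ≤ G.flowValue s f

end MultiDigraph

/-! ### Word RAM

A unit-cost word RAM with words of `w` bits, i.e. natural numbers below `2 ^ w`. A query has
read-only access to a data structure, which is an array of words, and has its own registers and
working memory, which are zero at the start except for the registers that hold the input. It writes
its answer, word by word, to an output list. -/

namespace WordRAM

/-- The arithmetic operations, each of unit cost. -/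
inductive Op
  | add | sub | mul | div | mod

/-- The result of an operation, reduced to a `w`-bit word (subtraction is truncated at zero,
division rounds down). -/
def Op.eval (w : ℕ) : Op → ℕ → ℕ → ℕ
  | .add, a, b => (a + b) % 2 ^ w
  | .sub, a, b => (a - b) % 2 ^ w
  | .mul, a, b => (a * b) % 2 ^ w
  | .div, a, b => (a / b) % 2 ^ w
  | .mod, a, b => (a % b) % 2 ^ w

/-- Instructions; `i j k` are indices of registers. -/
inductive Instr
  /-- `R i := a` -/
  | const (i a : ℕ)
  /-- `R i := o (R j) (R k)` -/
  | arith (o : Op) (i j k : ℕ)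
  /-- `R i :=` entry number `R j` of the data structure -/
  | read (i j : ℕ)
  /-- `R i := M (R j)`, from the working memory -/
  | load (i j : ℕ)
  /-- `M (R i) := R j`, to the working memory -/
  | store (i j : ℕ)
  /-- continue at instruction number `l` if `R i < R j` -/
  | jumpLt (i j l : ℕ)
  /-- append `R i` to the output -/
  | emit (i : ℕ)

/-- A program is a finite list of instructions. It halts when the program counter leaves the
list. -/
abbrev Program := List Instr

/-- A configuration of the machine. -/
structure Config where
  /-- program counter -/
  pc : ℕ
  /-- registers -/
  reg : ℕ → ℕ
  /-- working memory -/
  mem : ℕ → ℕ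
  /-- the output written so far -/
  out : List ℕ

/-- The effect of one instruction, with word size `w` and data structure `D` (entries outside of
`D` read as zero). -/
def exec (w : ℕ) (D : List ℕ) (σ : Config) : Instr → Config
  | .const i a => { σ with pc := σ.pc + 1, reg := Function.update σ.reg i (a % 2 ^ w) }
  | .arith o i j k =>
      { σ with pc := σ.pc + 1, reg := Function.update σ.reg i (o.eval w (σ.reg j) (σ.reg k)) }
  | .read i j =>
      { σ with pc := σ.pc + 1, reg := Function.update σ.reg i (D.getD (σ.reg j) 0) }
  | .load i j => { σ with pc := σ.pc + 1, reg := Function.update σ.reg i (σ.mem (σ.reg j)) }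
  | .store i j => { σ with pc := σ.pc + 1, mem := Function.update σ.mem (σ.reg i) (σ.reg j) }
  | .jumpLt i j l => { σ with pc := if σ.reg i < σ.reg j then l else σ.pc + 1 }
  | .emit i => { σ with pc := σ.pc + 1, out := σ.out ++ [σ.reg i] }

/-- One step of program `P`; a halted configuration stays as it is. -/
def step (P : Program) (w : ℕ) (D : List ℕ) (σ : Config) : Config :=
  match P[σ.pc]? with
  | none => σ
  | some c => exec w D σ c

/-- The initial configuration: the input stands in the registers `0, 1, 2, …`. -/
def init (w : ℕ) (input : List ℕ) : Config where
  pc := 0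
  reg i := input.getD i 0 % 2 ^ w
  mem _ := 0
  out := []

/-- Started on `input`, with word size `w` and data structure `D`, the program `P` halts after at
most `T` steps, and its output is `out`. -/
def HaltsWithin (P : Program) (w : ℕ) (D input : List ℕ) (T : ℕ) (out : List ℕ) : Prop :=
  ∃ k ≤ T, P.length ≤ ((step P w D)^[k] (init w input)).pc ∧
    ((step P w D)^[k] (init w input)).out = out

end WordRAM

/-- The word size, in bits, of the machine for graphs with `n` vertices and `m` edges:
`c` times the number of binary digits of `n + m`. -/
def wordSize (c n m : ℕ) : ℕ := c * (Nat.log 2 (n + m) + 1)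

/-! ### Reachability and cuts in finite digraphs -/

/-! Fix `k = λ` edge-disjoint simple paths from `s` to `t` whose edges form a max-flow `f`.
Everything that is stored belongs to one of these paths and takes `O(n)` words per path.

Two failures. Layer `i` is the residual graph of `f` together with the forward arcs of path `i`. For
each `i` a set `B i` of `O(n)` edges is kept that contains path `i` and preserves, under any three
faults, what is reachable from `s` and what reaches `t` in layer `i`. Such sets exist by
`exists_faultTolerant_reach`: the arcs into one vertex after another are thinned out to a constant
number, which `inArcBound_step` justifies by induction on the number of faults and on the size of a
minimum cut. If the failing flow edges lie on paths `i` and `j`, both paths are dropped and the flow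
is augmented at most twice, using surviving edges of `B i ∪ B j` only. This takes `O(n)` time.

A flow that gets stuck in this way is a max-flow of `G - F`. A cut `X` has in `G - F` the capacity
`k`, plus the number of residual arcs leaving `X` (without failing edges that carry no flow), minus
the number of failing flow edges leaving `X`. The stuck flow has the value of this expression for
some `X`, with only the residual arcs of `B i ∪ B j` counted. `PathSystem.exists_cut` finds another
cut `X'` for which the full expression is no larger. If at least as many backup arcs as failing flow
edges leave `X`, a minimum cut of `f` will do. Otherwise at most one backup arc leaves `X`, so each
of the two paths leaves `X` at most twice. Declaring the arcs that leave `X` faulty costs at most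
three faults per layer, so the vertices still reached from `s` lie in `X`, and those still reaching
`t` lie outside. These sets, their unions or the complements of unions serve as `X'`.

One failure on path `i`. Off the path, the flow is rerouted from a vertex before the failing edge to
the last path vertex that can be reached; if none lies behind the failing edge, the path is dropped
and a cut proves this optimal. The detours that are needed for one path are vertex-disjoint, so one
edge and one tag per vertex describe them all (`PathSystem.exists_detourTable`). Whether an edge has
changed is then a comparison of table entries, found through a two-level perfect hash table
(`exists_perfectHash`) in constant time.

The queries are written in a small structured language, whose compilation to the word RAM is proved
correct with exact step counts (`Big.run`), and are verified with a program logic that carries time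
bounds (`Trip`). -/

namespace FTFlow

set_option linter.unusedSectionVars false

section Reach

variable {V A : Type*} [Fintype V] [DecidableEq V] [DecidableEq A]

/-- No arc of `W` leaves `X`. -/
def Closed (tl hd : A → V) (W : Finset A) (X : Finset V) : Prop :=
  ∀ a ∈ W, tl a ∈ X → hd a ∈ X

open Classical in
/-- The vertices reachable from `S` along arcs in `W`: the least closed set containing `S`. -/
noncomputable def reach (tl hd : A → V) (W : Finset A) (S : Finset V) : Finset V :=
  Finset.univ.filter fun v => ∀ X, Closed tl hd W X → S ⊆ X → v ∈ X

/-- The arcs of `U` leaving `X`. -/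
def cutArcs (tl hd : A → V) (U : Finset A) (X : Finset V) : Finset A :=
  U.filter fun a => tl a ∈ X ∧ hd a ∉ X

variable {tl hd : A → V}

theorem mem_reach {W : Finset A} {S : Finset V} {v : V} :
    v ∈ reach tl hd W S ↔ ∀ X, Closed tl hd W X → S ⊆ X → v ∈ X := by
  simp [reach]

theorem subset_reach (W : Finset A) (S : Finset V) : S ⊆ reach tl hd W S := fun _ hv =>
  mem_reach.2 fun _ _ h => h hv

theorem closed_reach (W : Finset A) (S : Finset V) : Closed tl hd W (reach tl hd W S) :=
  fun a ha h => mem_reach.2 fun X hX hS => hX a ha (mem_reach.1 h X hX hS)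

theorem reach_subset {W : Finset A} {S X : Finset V} (hX : Closed tl hd W X) (hS : S ⊆ X) :
    reach tl hd W S ⊆ X := fun _ hv => mem_reach.1 hv X hX hS

theorem Closed.mono {W W' : Finset A} {X : Finset V} (h : Closed tl hd W X) (hW : W' ⊆ W) :
    Closed tl hd W' X := fun a ha => h a (hW ha)

theorem reach_mono {W W' : Finset A} {S S' : Finset V} (hW : W ⊆ W') (hS : S ⊆ S') :
    reach tl hd W S ⊆ reach tl hd W' S' :=
  reach_subset ((closed_reach W' S').mono hW) (hS.trans (subset_reach _ _))

theorem mem_cutArcs {U : Finset A} {X : Finset V} {a : A} :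
    a ∈ cutArcs tl hd U X ↔ a ∈ U ∧ tl a ∈ X ∧ hd a ∉ X := by simp [cutArcs]

/-- The inequality holds for each arc separately. It makes tight cuts closed under union. -/
theorem card_cutArcs_submodular (U : Finset A) (X Y : Finset V) :
    (cutArcs tl hd U (X ∪ Y)).card + (cutArcs tl hd U (X ∩ Y)).card ≤
      (cutArcs tl hd U X).card + (cutArcs tl hd U Y).card := by
  simp only [cutArcs, Finset.card_filter, ← Finset.sum_add_distrib]
  refine Finset.sum_le_sum fun a _ => ?_
  by_cases h1 : tl a ∈ X <;> by_cases h2 : tl a ∈ Y <;> by_cases h3 : hd a ∈ X <;>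
    by_cases h4 : hd a ∈ Y <;> simp [h1, h2, h3, h4]

/-- `U` without those arcs into `v` that are not in `E`. -/
def restrictIn (hd : A → V) (U : Finset A) (v : V) (E : Finset A) : Finset A :=
  U.filter fun a => hd a = v → a ∈ E

theorem mem_restrictIn {U E : Finset A} {v : V} {a : A} :
    a ∈ restrictIn hd U v E ↔ a ∈ U ∧ (hd a = v → a ∈ E) := by simp [restrictIn]

/-- A minimal set of arcs into `v` that keeps all cuts at `k + 1` is small: each of its arcs lies in
a tight cut, tight cuts are closed under union, and so the whole set lies in one maximal tight cut,
which has only `k + 1` arcs. -/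
theorem exists_inArcs_of_le_cut (k : ℕ) (U : Finset A) (S : Finset V) (v : V)
    (hcut : ∀ X : Finset V, S ⊆ X → v ∉ X → k + 1 ≤ (cutArcs tl hd U X).card) :
    ∃ E : Finset A, E.card ≤ k + 1 ∧ ∀ F : Finset A, F.card ≤ k →
      v ∈ reach tl hd (restrictIn hd U v E \ F) S := by
  classical
  let good : Finset A → Prop := fun E => (∀ a ∈ E, a ∈ U ∧ hd a = v) ∧
    ∀ X : Finset V, S ⊆ X → v ∉ X → k + 1 ≤ (cutArcs tl hd (restrictIn hd U v E) X).card
  have hex : ∃ E ∈ U.powerset, good E := by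
    refine ⟨U.filter fun a => hd a = v, by simp, by simp, fun X h1 h2 => ?_⟩
    have : restrictIn hd U v (U.filter fun a => hd a = v) = U := by
      ext a; simp +contextual [mem_restrictIn]
    rw [this]; exact hcut X h1 h2
  obtain ⟨E, hE⟩ : ∃ E, Minimal good E := by
    obtain ⟨E, -, h⟩ := hex
    obtain ⟨E', -, h'⟩ := exists_minimal_le_of_wellFoundedLT good E h
    exact ⟨E', h'⟩
  have hgood := hE.prop
  refine ⟨E, ?_, fun F hF => ?_⟩
  · rcases E.eq_empty_or_nonempty with rfl | ⟨e0, he0⟩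
    · simp
    -- If no tight cut had the tail of `e` on its side, `e` could be dropped without pushing any cut
    -- below `k + 1`, against minimality.
    have key : ∀ e ∈ E, ∃ X : Finset V, S ⊆ X ∧ v ∉ X ∧ tl e ∈ X ∧
        (cutArcs tl hd (restrictIn hd U v E) X).card = k + 1 := by
      intro e he
      by_contra hcon
      push Not at hcon
      have hg : good (E.erase e) := by
        refine ⟨fun a ha => hgood.1 a (Finset.mem_of_mem_erase ha), fun X h1 h2 => ?_⟩
        have h3 := hgood.2 X h1 h2
        by_cases h4 : tl e ∈ X
        · have h5 := hcon X h1 h2 h4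
          have h6 : (cutArcs tl hd (restrictIn hd U v E) X).erase e ⊆
              cutArcs tl hd (restrictIn hd U v (E.erase e)) X := by
            intro a ha
            simp only [Finset.mem_erase, mem_cutArcs, mem_restrictIn] at ha ⊢
            tauto
          have h7 := Finset.card_le_card h6
          have h8 := Finset.pred_card_le_card_erase (s := cutArcs tl hd (restrictIn hd U v E) X) (a := e)
          omega
        · refine h3.trans (Finset.card_le_card fun a ha => ?_)
          simp only [Finset.mem_erase, mem_cutArcs, mem_restrictIn] at ha ⊢
          refine ⟨⟨ha.1.1, fun h => ⟨?_, ha.1.2 h⟩⟩, ha.2⟩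
          rintro rfl
          exact h4 ha.2.1
      exact Finset.notMem_erase e E (hE.le_of_le hg (Finset.erase_subset _ _) he)
    let tight : Finset V → Prop := fun X => S ⊆ X ∧ v ∉ X ∧
        (cutArcs tl hd (restrictIn hd U v E) X).card = k + 1
    obtain ⟨X0, h1, h2, -, h4⟩ := key e0 he0
    obtain ⟨X, -, hX⟩ := exists_maximal_ge_of_wellFoundedGT tight X0 ⟨h1, h2, h4⟩
    obtain ⟨hX1, hX2, hX3⟩ := hX.prop
    rw [← hX3]
    refine Finset.card_le_card fun e he => ?_
    obtain ⟨Y, hY1, hY2, hY3, hY4⟩ := key e he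
    -- Union and intersection of the tight cuts `X` and `Y` have at least `k + 1` arcs each and at
    -- most `2 * (k + 1)` together, so the union is tight; by maximality `Y ⊆ X`.
    have hsub := card_cutArcs_submodular (tl := tl) (hd := hd) (restrictIn hd U v E) X Y
    have hun := hgood.2 (X ∪ Y) (hX1.trans Finset.subset_union_left) (by simp [hX2, hY2])
    have hin := hgood.2 (X ∩ Y) (Finset.subset_inter hX1 hY1) (by simp [hX2])
    have ht : tight (X ∪ Y) :=
      ⟨hX1.trans Finset.subset_union_left, by simp [hX2, hY2], by omega⟩
    have hle := hX.le_of_ge ht Finset.subset_union_left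
    obtain ⟨g1, g2⟩ := hgood.1 e he
    refine mem_cutArcs.2 ⟨mem_restrictIn.2 ⟨g1, fun _ => he⟩, ?_, g2 ▸ hX2⟩
    exact hle (Finset.mem_union_right _ hY3)
  · by_contra hv
    have h1 := hgood.2 _ (subset_reach (restrictIn hd U v E \ F) S) hv
    have h2 : cutArcs tl hd (restrictIn hd U v E)
        (reach tl hd (restrictIn hd U v E \ F) S) ⊆ F := by
      intro a ha
      obtain ⟨ha1, ha2, ha3⟩ := mem_cutArcs.1 ha
      by_contra haF
      exact ha3 (closed_reach _ _ a (Finset.mem_sdiff.2 ⟨ha1, haF⟩) ha2)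
    have h3 := Finset.card_le_card h2
    omega

/-- A bounded number of arcs into `v` keeps `v` reachable under `k` faults. -/
def InArcBound (V A : Type*) [Fintype V] [DecidableEq V] [DecidableEq A] (k c N : ℕ) : Prop :=
  ∀ (tl hd : A → V) (U : Finset A) (S : Finset V) (v : V), v ∉ S →
    (∀ X : Finset V, S ⊆ X → v ∉ X → c ≤ (cutArcs tl hd U X).card) →
    ∃ E : Finset A, E.card ≤ N ∧ ∀ F : Finset A, F.card ≤ k →
      v ∈ reach tl hd (U \ F) S → v ∈ reach tl hd (restrictIn hd U v E \ F) S

/-- Take the largest cut `B` with only `c` arcs. If some fault starts inside `B`, at most `k - 1`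
faults matter after the last exit from `B`, and the arcs kept for the head of each cut arc suffice.
If none does, all cut arcs survive, and their heads may be added to the sources, from which every
cut has at least `c + 1` arcs. The bound adds up the two kinds of kept arcs and the cut itself. -/
theorem inArcBound_step {k c N M : ℕ} (h1 : InArcBound V A k (c + 1) N)
    (h2 : k = 0 ∨ InArcBound V A (k - 1) 0 M) : InArcBound V A k c (N + c * M + c) := by
  classical
  intro tl hd U S v hvS hcut
  by_cases hall : ∀ X : Finset V, S ⊆ X → v ∉ X → c + 1 ≤ (cutArcs tl hd U X).card
  · obtain ⟨E, hE1, hE2⟩ := h1 tl hd U S v hvS hall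
    exact ⟨E, by omega, hE2⟩
  push Not at hall
  obtain ⟨X0, hX01, hX02, hX03⟩ := hall
  let tight : Finset V → Prop := fun X => S ⊆ X ∧ v ∉ X ∧ (cutArcs tl hd U X).card = c
  obtain ⟨B, -, hB⟩ := exists_maximal_ge_of_wellFoundedGT tight X0
    ⟨hX01, hX02, le_antisymm (by omega) (hcut X0 hX01 hX02)⟩
  obtain ⟨hB1, hB2, hB3⟩ := hB.prop
  set C := cutArcs tl hd U B with hC
  -- the heads of the cut other than `v`
  set Y := (C.image hd).erase v with hY
  have hE' : ∃ E' : Finset A, E'.card ≤ N ∧ (Y.Nonempty → ∀ F : Finset A, F.card ≤ k →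
      v ∈ reach tl hd (U \ F) (B ∪ Y) → v ∈ reach tl hd (restrictIn hd U v E' \ F) (B ∪ Y)) := by
    by_cases hYn : Y.Nonempty
    · obtain ⟨E, hE1, hE2⟩ := h1 tl hd U (B ∪ Y) v (by simp [hB2, hY]) (by
        intro X hX hvX
        have hBX : B ⊆ X := Finset.subset_union_left.trans hX
        have hle := hcut X (hB1.trans hBX) hvX
        by_contra hlt
        -- A cut of only `c` arcs beyond `B` would be contained in `B` by maximality, but the heads
        -- in `Y` lie outside.
        have ht : tight X := ⟨hB1.trans hBX, hvX, by omega⟩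
        obtain ⟨y, hy⟩ := hYn
        have hyB := hB.le_of_ge ht hBX (hX (Finset.mem_union_right _ hy))
        simp only [hY, Finset.mem_erase, Finset.mem_image] at hy
        obtain ⟨-, a, ha, rfl⟩ := hy
        exact (mem_cutArcs.1 ha).2.2 hyB)
      exact ⟨E, hE1, fun _ => hE2⟩
    · exact ⟨∅, by simp, fun h => absurd h hYn⟩
  obtain ⟨E', hE'1, hE'2⟩ := hE'
  -- For `k = 0` there is no fault at all, so these sets are never consulted.
  have hEa : ∃ Ea : A → Finset A, (∀ a, (Ea a).card ≤ M) ∧ (1 ≤ k → ∀ a, hd a ≠ v →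
      ∀ F : Finset A, F.card ≤ k - 1 → v ∈ reach tl hd (U.filter (fun a => tl a ∉ B) \ F) {hd a} →
        v ∈ reach tl hd (restrictIn hd (U.filter (fun a => tl a ∉ B)) v (Ea a) \ F) {hd a}) := by
    rcases h2 with rfl | h2
    · exact ⟨fun _ => ∅, by simp, by omega⟩
    · have : ∀ a, ∃ E : Finset A, E.card ≤ M ∧ (hd a ≠ v → ∀ F : Finset A, F.card ≤ k - 1 →
        v ∈ reach tl hd (U.filter (fun a => tl a ∉ B) \ F) {hd a} →
        v ∈ reach tl hd (restrictIn hd (U.filter (fun a => tl a ∉ B)) v E \ F) {hd a}) := by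
        intro a
        by_cases hav : hd a = v
        · exact ⟨∅, by simp, fun h => absurd hav h⟩
        · obtain ⟨E, hE1, hE2⟩ := h2 tl hd (U.filter (fun a => tl a ∉ B)) {hd a} v
            (by simpa using Ne.symm hav) (by simp)
          exact ⟨E, hE1, fun _ => hE2⟩
      choose Ea hEa1 hEa2 using this
      exact ⟨Ea, hEa1, fun _ => hEa2⟩
  obtain ⟨Ea, hEa1, hEa2⟩ := hEa
  refine ⟨E' ∪ C.biUnion Ea ∪ C, ?_, fun F hF hv => ?_⟩
  · have t1 := Finset.card_union_le (E' ∪ C.biUnion Ea) C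
    have t2 := Finset.card_union_le E' (C.biUnion Ea)
    have t3 : (C.biUnion Ea).card ≤ C.card * M := Finset.card_biUnion_le_card_mul _ _ _ fun a _ => hEa1 a
    rw [hB3] at t3 t1
    omega
  rw [mem_reach]
  -- `X` is closed in the thinned graph; supposing that it misses `v`, a set closed in the full
  -- surviving graph, or another contradiction, is derived.
  intro X hX hSX
  by_contra hvX
  set E := E' ∪ C.biUnion Ea ∪ C with hE
  have hstep : ∀ a ∈ U, a ∉ F → hd a ≠ v → tl a ∈ X → hd a ∈ X := fun a ha haF hav hat =>
    hX a (Finset.mem_sdiff.2 ⟨mem_restrictIn.2 ⟨ha, fun h => absurd h hav⟩, haF⟩) hat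
  have hCX : ∀ a ∈ C, a ∉ F → tl a ∈ X → hd a ∈ X := fun a ha haF hat => by
    refine hX a (Finset.mem_sdiff.2 ⟨mem_restrictIn.2 ⟨(mem_cutArcs.1 ha).1, fun _ => ?_⟩, haF⟩) hat
    exact Finset.mem_union_right _ ha
  by_cases hFB : ∃ a ∈ F, tl a ∈ B
  · -- some fault has its tail in `B`
    obtain ⟨a0, ha0, ha0B⟩ := hFB
    -- Faults with tails in `B` do not concern the arcs outside; since there is one, at most `k - 1`
    -- remain.
    set F' := F.filter fun a => tl a ∉ B with hF'
    have hF'c : F'.card + 1 ≤ F.card := by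
      have : F' ⊂ F := Finset.filter_ssubset.2 ⟨a0, ha0, by simpa using ha0B⟩
      exact Finset.card_lt_card this
    set UB := U.filter fun a => tl a ∉ B with hUB
    have hZ : ∀ a ∈ C, a ∉ F → tl a ∈ X →
        v ∉ reach tl hd (UB \ F') {hd a} ∧ reach tl hd (UB \ F') {hd a} ⊆ X := by
      intro a ha haF hat
      have hy := hCX a ha haF hat
      have hav : hd a ≠ v := fun h => hvX (h ▸ hy)
      have hnot : v ∉ reach tl hd (UB \ F') {hd a} := by
        intro hr
        have := hEa2 (by omega) a hav F' (by omega) hr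
        refine hvX (reach_subset (fun b hb hbt => ?_) (by simpa using hy) this)
        obtain ⟨hb1, hb2⟩ := Finset.mem_sdiff.1 hb
        obtain ⟨hb3, hb4⟩ := mem_restrictIn.1 hb1
        obtain ⟨hb5, hb6⟩ := Finset.mem_filter.1 hb3
        have hbF : b ∉ F := fun h => hb2 (Finset.mem_filter.2 ⟨h, hb6⟩)
        refine hX b (Finset.mem_sdiff.2 ⟨mem_restrictIn.2 ⟨hb5, fun h => ?_⟩, hbF⟩) hbt
        exact Finset.mem_union_left _ (Finset.mem_union_right _ (Finset.mem_biUnion.2 ⟨a, ha, hb4 h⟩))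
      refine ⟨hnot, ?_⟩
      have : reach tl hd (UB \ F') {hd a} ⊆ X ∩ reach tl hd (UB \ F') {hd a} := by
        refine reach_subset (fun b hb hbt => ?_) ?_
        · obtain ⟨hb1, hb2⟩ := Finset.mem_inter.1 hbt
          have hr := closed_reach _ _ b hb hb2
          obtain ⟨hb3, hb4⟩ := Finset.mem_sdiff.1 hb
          obtain ⟨hb5, hb6⟩ := Finset.mem_filter.1 hb3
          have hbF : b ∉ F := fun h => hb4 (Finset.mem_filter.2 ⟨h, hb6⟩)
          exact Finset.mem_inter.2 ⟨hstep b hb5 hbF (fun h => hnot (h ▸ hr)) hb1, hr⟩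
        · simpa using ⟨hy, subset_reach (tl := tl) (hd := hd) (UB \ F') {hd a} (by simp)⟩
      exact this.trans Finset.inter_subset_left
    -- Where walks in the full graph can get: the part of `X` in `B`, and everything behind a
    -- surviving exit from `B` with tail in `X`. It stays within `X`, so it misses `v`.
    let T := (X ∩ B) ∪ (C.filter fun a => a ∉ F ∧ tl a ∈ X).biUnion fun a =>
      reach tl hd (UB \ F') {hd a}
    have hTX : T ⊆ X := by
      intro x hx
      simp only [T, Finset.mem_union, Finset.mem_biUnion, Finset.mem_filter] at hx
      rcases hx with hx | ⟨a, ⟨ha1, ha2, ha3⟩, hx⟩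
      · exact (Finset.mem_inter.1 hx).1
      · exact (hZ a ha1 ha2 ha3).2 hx
    refine (hvX ∘ @hTX v) (reach_subset (fun b hb hbt => ?_) ?_ hv)
    · obtain ⟨hbU, hbF⟩ := Finset.mem_sdiff.1 hb
      by_cases hbB : tl b ∈ B
      · by_cases hbh : hd b ∈ B
        · refine Finset.mem_union_left _ (Finset.mem_inter.2 ⟨?_, hbh⟩)
          exact hstep b hbU hbF (fun h => hB2 (h ▸ hbh)) (hTX hbt)
        · refine Finset.mem_union_right _ (Finset.mem_biUnion.2 ⟨b, ?_, subset_reach _ _ (by simp)⟩)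
          exact Finset.mem_filter.2 ⟨mem_cutArcs.2 ⟨hbU, hbB, hbh⟩, hbF, hTX hbt⟩
      · simp only [T, Finset.mem_union, Finset.mem_biUnion, Finset.mem_inter] at hbt
        rcases hbt with hbt | ⟨a, ha, hbt⟩
        · exact absurd hbt.2 hbB
        · refine Finset.mem_union_right _ (Finset.mem_biUnion.2 ⟨a, ha, ?_⟩)
          refine closed_reach _ _ b (Finset.mem_sdiff.2 ⟨Finset.mem_filter.2 ⟨hbU, hbB⟩, ?_⟩) hbt
          exact fun h => hbF (Finset.mem_filter.1 h).1
    · exact fun x hx => Finset.mem_union_left _ (Finset.mem_inter.2 ⟨hSX hx, hB1 hx⟩)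
  · -- all faults have their tails outside of `B`
    push Not at hFB
    have hsub : cutArcs tl hd U (X ∩ B) ⊆ C := by
      intro a ha
      obtain ⟨ha1, ha2, ha3⟩ := mem_cutArcs.1 ha
      obtain ⟨ha4, ha5⟩ := Finset.mem_inter.1 ha2
      refine mem_cutArcs.2 ⟨ha1, ha5, fun h => ha3 (Finset.mem_inter.2 ⟨?_, h⟩)⟩
      exact hstep a ha1 (fun h' => hFB a h' ha5) (fun h' => hB2 (h' ▸ h)) ha4
    -- The arcs leaving `X ∩ B` are among the `c` arcs of `C`, but every cut has at least `c` arcs;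
    -- so all of `C` starts in `X`.
    have heq : cutArcs tl hd U (X ∩ B) = C := by
      refine Finset.eq_of_subset_of_card_le hsub ?_
      rw [hB3]
      exact hcut _ (Finset.subset_inter hSX hB1) (by simp [hvX])
    have hCF : ∀ a ∈ C, hd a ∈ X := fun a ha => by
      have h3 : tl a ∈ B := (mem_cutArcs.1 ha).2.1
      rw [← heq] at ha
      have h4 := (Finset.mem_inter.1 (mem_cutArcs.1 ha).2.1).1
      rw [heq] at ha
      exact hCX a ha (fun h => hFB a h h3) h4
    by_cases hYn : Y.Nonempty
    · have hv' := hE'2 hYn F hF (reach_mono subset_rfl (hB1.trans Finset.subset_union_left) hv)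
      -- Every exit from `B` ends in `X`, so `X ∪ B` is closed, although `v`, which lies in neither
      -- set, should be reached.
      have hcl : reach tl hd (restrictIn hd U v E' \ F) (B ∪ Y) ⊆ X ∪ B := by
        refine reach_subset (fun b hb hbt => ?_) ?_
        · obtain ⟨hb1, hbF⟩ := Finset.mem_sdiff.1 hb
          obtain ⟨hb2, hb3⟩ := mem_restrictIn.1 hb1
          by_cases hbX : tl b ∈ X
          · refine Finset.mem_union_left _ (hX b (Finset.mem_sdiff.2 ⟨mem_restrictIn.2 ⟨hb2, fun h => ?_⟩, hbF⟩) hbX)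
            exact Finset.mem_union_left _ (Finset.mem_union_left _ (hb3 h))
          · have hbB : tl b ∈ B := by simpa [hbX] using hbt
            by_cases hbh : hd b ∈ B
            · exact Finset.mem_union_right _ hbh
            · exact Finset.mem_union_left _ (hCF b (mem_cutArcs.2 ⟨hb2, hbB, hbh⟩))
        · refine Finset.union_subset Finset.subset_union_right fun y hy => ?_
          simp only [hY, Finset.mem_erase, Finset.mem_image] at hy
          obtain ⟨-, a, ha, rfl⟩ := hy
          exact Finset.mem_union_left _ (hCF a ha)
      have := hcl hv'
      simp [hvX, hB2] at this
    -- Here every arc of `C` would have head `v`, but its head is in `X`. So `C` is empty and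
    -- nothing leaves `X ∩ B`.
    · have hCv : ∀ a ∈ C, False := fun a ha => by
        refine hYn ⟨hd a, Finset.mem_erase.2 ⟨fun h => hvX (h ▸ hCF a ha), Finset.mem_image_of_mem _ ha⟩⟩
      refine (show v ∉ X ∩ B by simp [hvX]) (reach_subset (fun b hb hbt => ?_) (Finset.subset_inter hSX hB1) hv)
      by_contra hcon
      refine hCv b ?_
      rw [← heq]
      exact mem_cutArcs.2 ⟨(Finset.mem_sdiff.1 hb).1, hbt, hcon⟩

/-- For a fixed number of faults the size of a minimum cut is lowered step by step, starting where
`exists_inArcs_of_le_cut` applies; each step uses the unconditional bound for one fault fewer. -/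
theorem exists_inArcBound (k : ℕ) : ∃ N, ∀ (V A : Type) [Fintype V] [DecidableEq V] [DecidableEq A],
    InArcBound V A k 0 N := by
  induction k with
  | zero =>
    refine ⟨1 + 0 * 0 + 0, fun V A _ _ _ => inArcBound_step ?_ (.inl rfl)⟩
    intro tl hd U S v _ hcut
    obtain ⟨E, h1, h2⟩ := exists_inArcs_of_le_cut 0 U S v hcut
    exact ⟨E, h1, fun F hF _ => h2 F hF⟩
  | succ k ih =>
    obtain ⟨M, hM⟩ := ih
    -- The cut size is `k + 2 - d`, so `d` counts the steps down from `k + 2` to `0`.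
    suffices h : ∀ d, d ≤ k + 2 → ∃ N, ∀ (V A : Type) [Fintype V] [DecidableEq V] [DecidableEq A],
        InArcBound V A (k + 1) (k + 2 - d) N by
      simpa using h (k + 2) le_rfl
    intro d
    induction d with
    | zero =>
      intro _
      refine ⟨k + 2, fun V A _ _ _ tl hd U S v _ hcut => ?_⟩
      obtain ⟨E, h1, h2⟩ := exists_inArcs_of_le_cut (k + 1) U S v hcut
      exact ⟨E, h1, fun F hF _ => h2 F hF⟩
    | succ d ihd =>
      intro hd
      obtain ⟨N, hN⟩ := ihd (by omega)
      refine ⟨N + (k + 2 - (d + 1)) * M + (k + 2 - (d + 1)), fun V A _ _ _ => inArcBound_step ?_ (.inr (hM V A))⟩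
      have : k + 2 - (d + 1) + 1 = k + 2 - d := by omega
      rw [this]; exact hN V A

/-- Fault-tolerant reachability subgraphs of linear size. -/
theorem exists_faultTolerant_reach (k : ℕ) : ∃ N, ∀ (V A : Type) [Fintype V] [DecidableEq V]
    [DecidableEq A] (tl hd : A → V) (U : Finset A) (S : Finset V),
    ∃ W ⊆ U, W.card ≤ N * Fintype.card V ∧ ∀ F : Finset A, F.card ≤ k →
      reach tl hd (U \ F) S ⊆ reach tl hd (W \ F) S := by
  obtain ⟨N, hN⟩ := exists_inArcBound k
  refine ⟨N, fun V A _ _ _ tl hd U S => ?_⟩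
  classical
  -- The vertices of `T` have been thinned out. The arcs kept at the next vertex are chosen relative
  -- to the current subgraph, so the guarantees compose.
  have main : ∀ T : Finset V, ∃ W ⊆ U, (∀ v ∈ T, (W.filter fun a => hd a = v).card ≤ N) ∧
      ∀ F : Finset A, F.card ≤ k → reach tl hd (U \ F) S ⊆ reach tl hd (W \ F) S := by
    intro T
    induction T using Finset.induction_on with
    | empty => exact ⟨U, subset_rfl, by simp, fun F _ => subset_rfl⟩
    | insert v T hvT ih =>
      obtain ⟨W, hWU, hW1, hW2⟩ := ih
      have hE : ∃ E : Finset A, E.card ≤ N ∧ ∀ F : Finset A, F.card ≤ k → v ∉ S →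
          v ∈ reach tl hd (W \ F) S → v ∈ reach tl hd (restrictIn hd W v E \ F) S := by
        by_cases hvS : v ∈ S
        · exact ⟨∅, by simp, fun _ _ h => absurd hvS h⟩
        · obtain ⟨E, h1, h2⟩ := hN V A tl hd W S v hvS (by simp)
          exact ⟨E, h1, fun F hF _ => h2 F hF⟩
      obtain ⟨E, hE1, hE2⟩ := hE
      refine ⟨restrictIn hd W v E, (Finset.filter_subset _ _).trans hWU, fun u hu => ?_,
        fun F hF => (hW2 F hF).trans ?_⟩
      · by_cases huv : u = v
        · subst huv
          refine (Finset.card_le_card fun a ha => ?_).trans hE1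
          obtain ⟨h1, h2⟩ := Finset.mem_filter.1 ha
          exact (mem_restrictIn.1 h1).2 h2
        · refine (Finset.card_le_card ?_).trans (hW1 u ((Finset.mem_insert.1 hu).resolve_left huv))
          exact Finset.filter_subset_filter _ (Finset.filter_subset _ _)
      · intro x hx
        rw [mem_reach]
        intro X hX hSX
        by_cases hvX : v ∈ X
        · refine reach_subset (fun a ha hat => ?_) hSX hx
          by_cases hav : hd a = v
          · exact hav ▸ hvX
          · obtain ⟨h1, h2⟩ := Finset.mem_sdiff.1 ha
            exact hX a (Finset.mem_sdiff.2 ⟨mem_restrictIn.2 ⟨h1, fun h => absurd h hav⟩, h2⟩) hat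
        -- If `v` is not reached even before the thinning, the arcs into `v` are irrelevant to what
        -- is reached.
        · have hv : v ∉ reach tl hd (W \ F) S := fun h =>
            hvX (reach_subset hX hSX (hE2 F hF (fun h => hvX (hSX h)) h))
          have : reach tl hd (W \ F) S ⊆ X ∩ reach tl hd (W \ F) S := by
            refine reach_subset (fun a ha hat => ?_) (Finset.subset_inter hSX (subset_reach _ _))
            obtain ⟨h1, h2⟩ := Finset.mem_inter.1 hat
            have h3 := closed_reach _ _ a ha h2
            obtain ⟨h4, h5⟩ := Finset.mem_sdiff.1 ha
            refine Finset.mem_inter.2 ⟨hX a (Finset.mem_sdiff.2 ⟨mem_restrictIn.2 ⟨h4, fun h => ?_⟩, h5⟩) h1, h3⟩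
            exact absurd (h ▸ h3) hv
          exact (Finset.mem_inter.1 (this hx)).1
  obtain ⟨W, h1, h2, h3⟩ := main Finset.univ
  refine ⟨W, h1, ?_, h3⟩
  -- Count the arcs by their heads.
  have := Finset.card_eq_sum_card_fiberwise (f := hd) (s := W) (t := Finset.univ) (by simp)
  rw [this, mul_comm, ← smul_eq_mul]
  exact Finset.sum_le_card_nsmul _ _ _ fun v hv => h2 v hv

end Reach

end FTFlow

/-! ### Shortest walks are simple paths -/

namespace FTFlow

set_option linter.unusedSectionVars false

section Walk

variable {V A : Type*} [Fintype V] [DecidableEq V] [DecidableEq A] {tl hd : A → V}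

/-- There is a walk of length `l` from `S` to the given vertex along arcs in `W`. -/
def WalkTo (tl hd : A → V) (W : Finset A) (S : Finset V) : ℕ → V → Prop
  | 0, v => v ∈ S
  | l + 1, v => ∃ a ∈ W, hd a = v ∧ WalkTo tl hd W S l (tl a)

theorem exists_walkTo_of_mem_reach {W : Finset A} {S : Finset V} {v : V}
    (h : v ∈ reach tl hd W S) : ∃ l, WalkTo tl hd W S l v := by
  classical
  have := mem_reach.1 h (Finset.univ.filter fun v => ∃ l, WalkTo tl hd W S l v)
    (fun a ha hat => by
      obtain ⟨l, hl⟩ := (Finset.mem_filter.1 hat).2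
      exact Finset.mem_filter.2 ⟨Finset.mem_univ _, l + 1, a, ha, rfl, hl⟩)
    (fun x hx => Finset.mem_filter.2 ⟨Finset.mem_univ _, 0, hx⟩)
  exact (Finset.mem_filter.1 this).2

theorem WalkTo.exists_seq [Nonempty A] {W : Finset A} {S : Finset V} {l : ℕ} {v : V}
    (h : WalkTo tl hd W S l v) : ∃ (vert : ℕ → V) (arc : ℕ → A), vert 0 ∈ S ∧ vert l = v ∧
      ∀ x < l, arc x ∈ W ∧ tl (arc x) = vert x ∧ hd (arc x) = vert (x + 1) := by
  induction l generalizing v with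
  | zero => exact ⟨fun _ => v, fun _ => Classical.arbitrary A, h, rfl, by simp⟩
  | succ l ih =>
    obtain ⟨a, haW, hav, ha⟩ := h
    obtain ⟨vert, arc, h1, h2, h3⟩ := ih ha
    refine ⟨fun x => if x ≤ l then vert x else v, fun x => if x < l then arc x else a, by simpa,
      by simp, fun x hx => ?_⟩
    rcases Nat.lt_succ_iff_lt_or_eq.1 hx with hx | rfl
    · have := h3 x hx
      simp [hx, hx.le, Nat.succ_le_of_lt hx, this]
    · simp [h2, haW, hav]

/-- A simple path, given by the sequences of its vertices and arcs. -/
theorem exists_path_of_mem_reach [Nonempty A] {W : Finset A} {S : Finset V} {v : V}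
    (h : v ∈ reach tl hd W S) : ∃ (l : ℕ) (vert : ℕ → V) (arc : ℕ → A), vert 0 ∈ S ∧ vert l = v ∧
      (∀ x < l, arc x ∈ W ∧ tl (arc x) = vert x ∧ hd (arc x) = vert (x + 1)) ∧
      (∀ x ≤ l, ∀ y ≤ l, vert x = vert y → x = y) := by
  classical
  have hex := exists_walkTo_of_mem_reach h
  obtain ⟨vert, arc, h1, h2, h3⟩ := (Nat.find_spec hex).exists_seq
  set l := Nat.find hex
  have hw : ∀ x ≤ l, WalkTo tl hd W S x (vert x) := by
    intro x
    induction x with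
    | zero => exact fun _ => h1
    | succ x ih => exact fun hx => ⟨arc x, (h3 x hx).1, (h3 x hx).2.2, (h3 x hx).2.1 ▸ ih (by omega)⟩
  -- The tail of the shortest walk may be attached to any walk that ends at one of its vertices.
  have hext : ∀ x y j, WalkTo tl hd W S x (vert y) → y + j ≤ l →
      WalkTo tl hd W S (x + j) (vert (y + j)) := by
    intro x y j hx
    induction j with
    | zero => exact fun _ => hx
    | succ j ih => exact fun hj => ⟨arc (y + j), (h3 _ (by omega)).1, (h3 _ (by omega)).2.2,
        (h3 (y + j) (by omega)).2.1 ▸ ih (by omega)⟩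
  -- Cutting out the closed walk between two visits of a vertex would give a shorter walk.
  have hlt : ∀ x y, x < y → y ≤ l → vert x ≠ vert y := by
    intro x y hxy hy he
    have := hext x y (l - y) (he ▸ hw x (by omega)) (by omega)
    rw [show y + (l - y) = l by omega, h2] at this
    exact Nat.find_min hex (show x + (l - y) < l by omega) this
  refine ⟨l, vert, arc, h1, h2, h3, fun x hx y hy he => ?_⟩
  rcases lt_trichotomy x y with h | h | h
  · exact absurd he (hlt x y h hy)
  · exact h
  · exact absurd he.symm (hlt y x h hx)

end Walk

/-! ### Zero-one flows, residual graphs and path decompositions -/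

section Flow

variable {V E : Type*} [Fintype V] [DecidableEq V] [Fintype E] [DecidableEq E]

/-- The difference of the indicators of `a` and `b`. -/
def dif (a b v : V) : ℤ := (if a = v then 1 else 0) - if b = v then 1 else 0

theorem sum_dif (a b : V) (X : Finset V) :
    ∑ v ∈ X, dif a b v = (if a ∈ X then 1 else 0) - if b ∈ X then 1 else 0 := by
  simp [dif, Finset.sum_sub_distrib, Finset.sum_ite_eq]

theorem dif_add_dif (a b c v : V) : dif a b v + dif b c v = dif a c v := by
  simp only [dif]; ring

theorem dif_self (a v : V) : dif a a v = 0 := by simp [dif]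

variable (G : MultiDigraph V E)

/-- The net number of edges of `S` leaving `v`. -/
def znet (S : Finset E) (v : V) : ℤ := ∑ e ∈ S, dif (G.src e) (G.tgt e) v

/-- `S` is the support of a `0/1`-flow of value `k`. -/
def IsFlowSet (s t : V) (S : Finset E) (k : ℤ) : Prop := ∀ v, znet G S v = k * dif s t v

/-- Tail of the arc `(e, b)`, which is `e` if `b` is true and the reverse of `e` otherwise. -/
def atl (a : E × Bool) : V := if a.2 then G.src a.1 else G.tgt a.1

/-- Head of the arc `(e, b)`. -/
def ahd (a : E × Bool) : V := if a.2 then G.tgt a.1 else G.src a.1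

/-- The arcs of the residual graph of `S`. -/
def resArcs (S : Finset E) : Finset (E × Bool) :=
  Finset.univ.filter fun a => (a.2 = true ↔ a.1 ∉ S)

theorem mem_resArcs {S : Finset E} {a : E × Bool} : a ∈ resArcs S ↔ (a.2 = true ↔ a.1 ∉ S) := by
  simp [resArcs]

variable {G}

theorem IsFlowSet.sum_cut {s t : V} {S : Finset E} {k : ℤ} (h : IsFlowSet G s t S k)
    (X : Finset V) (hs : s ∈ X) (ht : t ∉ X) :
    k = ((S.filter fun e => G.src e ∈ X ∧ G.tgt e ∉ X).card : ℤ) -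
      (S.filter fun e => G.src e ∉ X ∧ G.tgt e ∈ X).card := by
  have h1 : ∑ v ∈ X, znet G S v = k := by
    rw [Finset.sum_congr rfl fun v _ => h v, ← Finset.mul_sum, sum_dif]; simp [hs, ht]
  have h2 : ∑ v ∈ X, znet G S v =
      ∑ e ∈ S, ((if G.src e ∈ X then 1 else 0) - if G.tgt e ∈ X then 1 else 0) := by
    simp only [znet]; rw [Finset.sum_comm]; exact Finset.sum_congr rfl fun e _ => sum_dif _ _ _
  rw [← h1, h2]
  simp only [Finset.card_filter]
  push_cast
  rw [← Finset.sum_sub_distrib]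
  refine Finset.sum_congr rfl fun e _ => ?_
  by_cases h3 : G.src e ∈ X <;> by_cases h4 : G.tgt e ∈ X <;> simp [h3, h4]

theorem sum_eq_sum_univ_ite {M : Type*} [AddCommMonoid M] (S : Finset E) (g : E → M) :
    ∑ e ∈ S, g e = ∑ e, if e ∈ S then g e else 0 := by
  simp [Finset.sum_ite_mem]

theorem netOut_indicator (S : Finset E) (v : V) :
    G.netOut (fun e => if e ∈ S then 1 else 0) v = (znet G S v : ℝ) := by
  simp only [MultiDigraph.netOut, znet, sum_eq_sum_univ_ite S, dif]
  push_cast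
  rw [← Finset.sum_sub_distrib]
  refine Finset.sum_congr rfl fun e _ => ?_
  by_cases h : e ∈ S <;> simp [h]

theorem sum_netOut (g : E → ℝ) (X : Finset V) :
    ∑ v ∈ X, G.netOut g v =
      ∑ e, ((if G.src e ∈ X then g e else 0) - if G.tgt e ∈ X then g e else 0) := by
  simp only [MultiDigraph.netOut]
  rw [Finset.sum_sub_distrib, Finset.sum_comm, Finset.sum_comm (s := X), ← Finset.sum_sub_distrib]
  simp

/-- Weak duality, by summing conservation over `X`. Together with a flow of equal value it certifies
optimality among all real flows. -/
theorem flowValue_le_card_cut {s t : V} {g : E → ℝ} (hg : G.IsFlow s t g) (X : Finset V)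
    (hs : s ∈ X) (ht : t ∉ X) :
    G.flowValue s g ≤ (Finset.univ.filter fun e => G.src e ∈ X ∧ G.tgt e ∉ X).card := by
  have h1 : ∑ v ∈ X, G.netOut g v = G.flowValue s g := by
    rw [Finset.sum_eq_single s]
    · rfl
    · intro v hv hvs
      exact hg.conserve v hvs fun h => ht (h ▸ hv)
    · exact fun h => absurd hs h
  rw [← h1, sum_netOut, Finset.card_filter]
  push_cast
  refine Finset.sum_le_sum fun e _ => ?_
  have h2 := hg.nonneg e
  have h3 := hg.le_one e
  by_cases h4 : G.src e ∈ X <;> by_cases h5 : G.tgt e ∈ X <;> simp [h4, h5, h2, h3]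

/-- A `0/1`-flow whose value is at least the capacity of some cut is a max-flow. -/
theorem isMaxFlow_indicator {s t : V} (hst : s ≠ t) {S : Finset E} {k : ℤ}
    (h : IsFlowSet G s t S k) (X : Finset V) (hs : s ∈ X) (ht : t ∉ X)
    (hcut : ((Finset.univ.filter fun e => G.src e ∈ X ∧ G.tgt e ∉ X).card : ℤ) ≤ k) :
    G.IsMaxFlow s t (fun e => if e ∈ S then 1 else 0) ∧
      G.flowValue s (fun e => if e ∈ S then 1 else 0) = k := by
  have hv : G.flowValue s (fun e => if e ∈ S then 1 else 0) = k := by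
    rw [MultiDigraph.flowValue, netOut_indicator, h s]; simp [dif, hst.symm]
  refine ⟨⟨⟨fun e => ?_, fun e => ?_, fun v h1 h2 => ?_⟩, fun g hg => ?_⟩, hv⟩
  · split_ifs <;> simp
  · split_ifs <;> simp
  · rw [netOut_indicator, h v]; simp [dif, h1.symm, h2.symm]
  · rw [hv]
    refine (flowValue_le_card_cut hg X hs ht).trans ?_
    exact_mod_cast hcut

theorem isMaxFlow_deleteEdges {s t : V} (hst : s ≠ t) {S F : Finset E} {k : ℤ}
    (h : IsFlowSet G s t S k) (hSF : Disjoint S F) (X : Finset V) (hs : s ∈ X) (ht : t ∉ X)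
    (hcut : ((Finset.univ.filter fun e => e ∉ F ∧ G.src e ∈ X ∧ G.tgt e ∉ X).card : ℤ) ≤ k) :
    (G.deleteEdges F).IsMaxFlow s t (fun e => if e.1 ∈ S then 1 else 0) := by
  have h' : IsFlowSet (G.deleteEdges F) s t (S.subtype fun e => e ∉ F) k := by
    intro v
    rw [← h v]
    simp only [znet, MultiDigraph.deleteEdges]
    refine Finset.sum_subtype_of_mem (fun e => dif (G.src e) (G.tgt e) v) fun e he => ?_
    exact Finset.disjoint_left.1 hSF he
  have := (isMaxFlow_indicator hst h' X hs ht ?_).1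
  · simpa using this
  · refine le_trans ?_ hcut
    norm_cast
    refine Finset.card_le_card_of_injOn Subtype.val (fun e he => ?_) Subtype.val_injective.injOn
    have he' := (Finset.mem_filter.1 he).2
    exact Finset.mem_coe.2 (Finset.mem_filter.2 ⟨Finset.mem_univ _, e.2, he'⟩)

/-- Flipping an edge outside of `S` adds it, and flipping one in `S` subtracts it, which is the
effect of its reversed arc. The residual graph contains only one orientation of each edge, so
distinct arcs flip distinct edges. -/
theorem znet_symmDiff {S : Finset E} {T : Finset (E × Bool)} (hT : T ⊆ resArcs S) (v : V) :
    znet G (symmDiff S (T.image Prod.fst)) v = znet G S v + ∑ a ∈ T, dif (atl G a) (ahd G a) v := by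
  have hinj : Set.InjOn (Prod.fst : E × Bool → E) T := by
    rintro ⟨e, b⟩ h1 ⟨e', b'⟩ h2 (rfl : e = e')
    have h3 := mem_resArcs.1 (hT h1)
    have h4 := mem_resArcs.1 (hT h2)
    simp only at h3 h4
    rw [Prod.mk.injEq]; exact ⟨rfl, Bool.eq_iff_iff.2 (h3.trans h4.symm)⟩
  have h1 : ∑ a ∈ T, dif (atl G a) (ahd G a) v =
      ∑ e ∈ T.image Prod.fst, (if e ∈ S then -1 else 1) * dif (G.src e) (G.tgt e) v := by
    rw [Finset.sum_image hinj]
    refine Finset.sum_congr rfl fun a ha => ?_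
    have h3 := mem_resArcs.1 (hT ha)
    by_cases h4 : a.1 ∈ S
    · have : a.2 = false := by simpa [h4] using h3
      simp only [atl, ahd, this, h4, dif]; simp
    · have : a.2 = true := h3.2 h4
      simp only [atl, ahd, this, h4, dif]; simp
  rw [h1]
  set I := T.image Prod.fst
  simp only [znet]
  rw [sum_eq_sum_univ_ite (symmDiff S I), sum_eq_sum_univ_ite S, sum_eq_sum_univ_ite I,
    ← Finset.sum_add_distrib]
  refine Finset.sum_congr rfl fun e _ => ?_
  by_cases h3 : e ∈ S <;> by_cases h4 : e ∈ I <;> simp [Finset.mem_symmDiff, h3, h4]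

section Path

variable {l : ℕ} {vert : ℕ → V} {arc : ℕ → E × Bool} {S : Finset E}

/-- Flipping the edges of a simple residual path. -/
theorem znet_flip_path (harc : ∀ x < l, arc x ∈ resArcs S ∧ atl G (arc x) = vert x ∧
      ahd G (arc x) = vert (x + 1)) (hinj : ∀ x ≤ l, ∀ y ≤ l, vert x = vert y → x = y) (v : V) :
    znet G (symmDiff S ((Finset.range l).image fun x => (arc x).1)) v =
      znet G S v + dif (vert 0) (vert l) v := by
  have h1 : ((Finset.range l).image fun x => (arc x).1) =
      ((Finset.range l).image arc).image Prod.fst := by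
    rw [Finset.image_image]; rfl
  have h2 : (Finset.range l).image arc ⊆ resArcs S := by
    intro a ha
    obtain ⟨x, hx, rfl⟩ := Finset.mem_image.1 ha
    exact (harc x (Finset.mem_range.1 hx)).1
  rw [h1, znet_symmDiff h2, Finset.sum_image]
  · congr 1
    have : ∀ k ≤ l, ∑ x ∈ Finset.range k, dif (atl G (arc x)) (ahd G (arc x)) v =
        dif (vert 0) (vert k) v := by
      intro k
      induction k with
      | zero => simp [dif_self]
      | succ k ih =>
        intro hk
        rw [Finset.sum_range_succ, ih (by omega), (harc k hk).2.1, (harc k hk).2.2, dif_add_dif]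
    exact this l le_rfl
  · intro x hx y hy hxy
    have hx' := Finset.mem_range.1 hx
    have hy' := Finset.mem_range.1 hy
    refine hinj x hx'.le y hy'.le ?_
    rw [← (harc x hx').2.1, ← (harc y hy').2.1]
    exact congrArg _ hxy

theorem exists_augment [Nonempty E] {s t : V} {k : ℤ} (h : IsFlowSet G s t S k)
    (hr : t ∈ reach (atl G) (ahd G) (resArcs S) {s}) : ∃ S', IsFlowSet G s t S' (k + 1) := by
  obtain ⟨l, vert, arc, h1, h2, h3, h4⟩ := exists_path_of_mem_reach hr
  refine ⟨_, fun v => (znet_flip_path h3 h4 v).trans ?_⟩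
  rw [h v, h2, Finset.mem_singleton.1 h1]; ring

end Path

variable (G) in
/-- `k` edge-disjoint simple paths from `s` to `t`. -/
structure PathSystem (s t : V) (k : ℕ) where
  len : ℕ → ℕ
  vert : ℕ → ℕ → V
  edge : ℕ → ℕ → E
  vert_zero : ∀ i < k, vert i 0 = s
  vert_len : ∀ i < k, vert i (len i) = t
  src_edge : ∀ i < k, ∀ x < len i, G.src (edge i x) = vert i x
  tgt_edge : ∀ i < k, ∀ x < len i, G.tgt (edge i x) = vert i (x + 1)
  vert_inj : ∀ i < k, ∀ x ≤ len i, ∀ y ≤ len i, vert i x = vert i y → x = y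
  edge_inj : ∀ i < k, ∀ j < k, ∀ x < len i, ∀ y < len j, edge i x = edge j y → i = j ∧ x = y

/-- The edges of path number `i`. -/
def PathSystem.edges {s t : V} {k : ℕ} (P : PathSystem G s t k) (i : ℕ) : Finset E :=
  (Finset.range (P.len i)).image (P.edge i)

/-- The edges of all paths. -/
def PathSystem.supp {s t : V} {k : ℕ} (P : PathSystem G s t k) : Finset E :=
  (Finset.range k).biUnion P.edges

theorem PathSystem.mem_edges {s t : V} {k : ℕ} {P : PathSystem G s t k} {i : ℕ} {e : E} :
    e ∈ P.edges i ↔ ∃ x < P.len i, P.edge i x = e := by simp [PathSystem.edges]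

theorem PathSystem.mem_supp {s t : V} {k : ℕ} {P : PathSystem G s t k} {e : E} :
    e ∈ P.supp ↔ ∃ i < k, e ∈ P.edges i := by simp [PathSystem.supp]

theorem PathSystem.len_lt {s t : V} {k : ℕ} (P : PathSystem G s t k) {i : ℕ} (hi : i < k) :
    P.len i < Fintype.card V := by
  have : (Finset.range (P.len i + 1)).card ≤ (Finset.univ : Finset V).card := by
    refine Finset.card_le_card_of_injOn (P.vert i) (fun _ _ => Finset.mem_coe.2 (Finset.mem_univ _))
      fun x hx y hy h => ?_
    simp only [Finset.coe_range, Set.mem_Iio] at hx hy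
    exact P.vert_inj i hi x (by omega) y (by omega) h
  simpa using this

theorem PathSystem.edges_disjoint {s t : V} {k : ℕ} (P : PathSystem G s t k) {i j : ℕ} (hi : i < k)
    (hj : j < k) {e : E} (h1 : e ∈ P.edges i) (h2 : e ∈ P.edges j) : i = j := by
  obtain ⟨x, hx, rfl⟩ := PathSystem.mem_edges.1 h1
  obtain ⟨y, hy, h⟩ := PathSystem.mem_edges.1 h2
  exact (P.edge_inj j hj i hi y hy x hx h).1.symm

theorem znet_edges {s t : V} {k : ℕ} (P : PathSystem G s t k) {i : ℕ} (hi : i < k) (v : V) :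
    znet G (P.edges i) v = dif s t v := by
  have := znet_flip_path (G := G) (S := ∅) (l := P.len i) (vert := P.vert i)
    (arc := fun x => (P.edge i x, true))
    (fun x hx => ⟨by simp [mem_resArcs], by simp [atl, P.src_edge i hi x hx],
      by simp [ahd, P.tgt_edge i hi x hx]⟩) (P.vert_inj i hi) v
  simpa [symmDiff_def, znet, P.vert_zero i hi, P.vert_len i hi, PathSystem.edges] using this

theorem znet_union {S T : Finset E} (h : Disjoint S T) (v : V) :
    znet G (S ∪ T) v = znet G S v + znet G T v := Finset.sum_union h

theorem PathSystem.isFlowSet {s t : V} {k : ℕ} (P : PathSystem G s t k) :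
    IsFlowSet G s t P.supp k := by
  intro v
  have : znet G P.supp v = ∑ i ∈ Finset.range k, znet G (P.edges i) v := by
    refine Finset.sum_biUnion fun i hi j hj hij => Finset.disjoint_left.2 fun e h1 h2 => hij ?_
    exact P.edges_disjoint (by simpa using hi) (by simpa using hj) h1 h2
  rw [this, Finset.sum_congr rfl fun i hi => znet_edges P (Finset.mem_range.1 hi) v]
  simp

/-- Remove simple paths inside `S` one at a time. What is left of `S` in the end, such as cycles, is
discarded. -/
theorem exists_pathSystem [Nonempty E] {s t : V} (k : ℕ) (S : Finset E)
    (h : IsFlowSet G s t S k) : ∃ P : PathSystem G s t k, P.supp ⊆ S := by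
  induction k generalizing S with
  | zero =>
    -- No path is required; the fields need arbitrary values, hence some edge.
    exact ⟨⟨fun _ => 0, fun _ _ => s, fun _ _ => Classical.arbitrary E, by simp, by simp, by simp,
      by simp, by simp, by simp⟩, by simp [PathSystem.supp]⟩
  | succ k ih =>
    set W := S.image fun e => (e, true) with hW
    -- Otherwise no edge of `S` leaves the set reached from `s`, and the value of the flow would not
    -- be positive.
    have hr : t ∈ reach (atl G) (ahd G) W {s} := by
      by_contra ht
      have hc := closed_reach (tl := atl G) (hd := ahd G) W {s}
      have := h.sum_cut _ (subset_reach _ _ (by simp : s ∈ _)) ht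
      have hz : (S.filter fun e => G.src e ∈ reach (atl G) (ahd G) W {s} ∧
          G.tgt e ∉ reach (atl G) (ahd G) W {s}) = ∅ := by
        refine Finset.filter_eq_empty_iff.2 ?_
        rintro e he ⟨h1, h2⟩
        exact h2 (hc (e, true) (Finset.mem_image_of_mem _ he) h1)
      rw [hz] at this
      simp only [Finset.card_empty] at this
      push_cast at this
      omega
    obtain ⟨l, vert, arc, h1, h2, h3, h4⟩ := exists_path_of_mem_reach hr
    have harc : ∀ x < l, (arc x).2 = true ∧ (arc x).1 ∈ S := by
      intro x hx
      obtain ⟨e, he, h'⟩ := Finset.mem_image.1 (h3 x hx).1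
      rw [← h']; exact ⟨rfl, he⟩
    have hsrc : ∀ x < l, G.src (arc x).1 = vert x := fun x hx => by
      rw [← (h3 x hx).2.1]; simp [atl, (harc x hx).1]
    have htgt : ∀ x < l, G.tgt (arc x).1 = vert (x + 1) := fun x hx => by
      rw [← (h3 x hx).2.2]; simp [ahd, (harc x hx).1]
    have hs := Finset.mem_singleton.1 h1
    set T := (Finset.range l).image fun x => (arc x).1 with hT
    have hTS : T ⊆ S := by
      intro e he
      obtain ⟨x, hx, rfl⟩ := Finset.mem_image.1 he
      exact (harc x (Finset.mem_range.1 hx)).2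
    have hTn : ∀ v, znet G T v = dif s t v := by
      intro v
      have := znet_flip_path (G := G) (S := ∅) (l := l) (vert := vert) (arc := arc)
        (fun x hx => ⟨by simp [mem_resArcs, harc x hx], (h3 x hx).2⟩) h4 v
      rw [← hT] at this
      simpa [symmDiff_def, znet, hs, h2] using this
    obtain ⟨P, hP⟩ := ih (S \ T) (fun v => by
      have h5 := znet_union (G := G) (Finset.sdiff_disjoint (s := T) (t := S)) v
      rw [Finset.sdiff_union_of_subset hTS, h v, hTn] at h5
      push_cast at h5
      linarith)
    have hdisj : ∀ i < k, ∀ x < P.len i, ∀ y < l, P.edge i x ≠ (arc y).1 := by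
      intro i hi x hx y hy he
      have h5 := hP (PathSystem.mem_supp.2 ⟨i, hi, PathSystem.mem_edges.2 ⟨x, hx, rfl⟩⟩)
      refine (Finset.mem_sdiff.1 h5).2 (he ▸ Finset.mem_image.2 ⟨y, Finset.mem_range.2 hy, rfl⟩)
    refine ⟨⟨fun i => if i < k then P.len i else l, fun i => if i < k then P.vert i else vert,
      fun i => if i < k then P.edge i else fun x => (arc x).1, ?_, ?_, ?_, ?_, ?_, ?_⟩, ?_⟩
    · intro i _; by_cases hik : i < k
      · simpa [hik] using P.vert_zero i hik
      · simpa [hik] using hs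
    · intro i _; by_cases hik : i < k
      · simpa [hik] using P.vert_len i hik
      · simpa [hik] using h2
    · intro i _; by_cases hik : i < k
      · simpa [hik] using P.src_edge i hik
      · simpa [hik] using hsrc
    · intro i _; by_cases hik : i < k
      · simpa [hik] using P.tgt_edge i hik
      · simpa [hik] using htgt
    · intro i _; by_cases hik : i < k
      · simpa [hik] using P.vert_inj i hik
      · simpa [hik] using h4
    · intro i hi j hj x hx y hy he
      by_cases hik : i < k <;> by_cases hjk : j < k <;> simp only [hik, hjk, if_true, if_false] at hx hy he
      · exact P.edge_inj i hik j hjk x hx y hy he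
      · exact absurd he (hdisj i hik x hx y hy)
      · exact absurd he.symm (hdisj j hjk y hy x hx)
      · refine ⟨by omega, h4 x hx.le y hy.le ?_⟩
        rw [← hsrc x hx, ← hsrc y hy, he]
    · intro e he
      obtain ⟨i, hi, he⟩ := PathSystem.mem_supp.1 he
      obtain ⟨x, hx, he⟩ := PathSystem.mem_edges.1 he
      by_cases hik : i < k
      · simp only [hik, if_true] at hx he
        exact Finset.sdiff_subset (hP (PathSystem.mem_supp.2 ⟨i, hik, PathSystem.mem_edges.2 ⟨x, hx, he⟩⟩))
      · simp only [hik, if_false] at hx he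
        exact he ▸ (harc x hx).2

/-- A system of as many edge-disjoint paths as possible; no residual path is left. -/
theorem exists_max_pathSystem [Nonempty E] (G : MultiDigraph V E) {s t : V} (hst : s ≠ t) :
    ∃ (k : ℕ) (P : PathSystem G s t k), t ∉ reach (atl G) (ahd G) (resArcs P.supp) {s} := by
  classical
  have hbound : ∀ (k : ℕ) (S : Finset E), IsFlowSet G s t S k → k ≤ Fintype.card E := by
    intro k S h
    have h1 := h.sum_cut {s} (by simp) (by simpa using hst.symm)
    have h2 := Finset.card_le_univ (S.filter fun e => G.src e ∈ ({s} : Finset V) ∧ G.tgt e ∉ ({s} : Finset V))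
    omega
  have h0 : ∃ S : Finset E, IsFlowSet G s t S (0 : ℕ) := ⟨∅, fun v => by simp [znet]⟩
  let p : ℕ → Prop := fun k => ∃ S : Finset E, IsFlowSet G s t S k
  obtain ⟨S, hS⟩ : p (Nat.findGreatest p (Fintype.card E)) :=
    Nat.findGreatest_spec (P := p) (Nat.zero_le _) h0
  set k := Nat.findGreatest p (Fintype.card E) with hk
  obtain ⟨P, -⟩ := exists_pathSystem k S hS
  refine ⟨k, P, fun hr => ?_⟩
  -- A residual path would produce a flow of value `k + 1`, against the choice of `k`.
  obtain ⟨S', hS'⟩ := exists_augment P.isFlowSet hr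
  have h1 : p (k + 1) := ⟨S', by exact_mod_cast hS'⟩
  have h2 := hbound (k + 1) S' (by exact_mod_cast hS')
  have := Nat.le_findGreatest h2 h1
  omega

end Flow

end FTFlow

/-! ### Backup graphs and the cut lemma -/

namespace FTFlow

set_option linter.unusedSectionVars false

section Cut

variable {V E : Type*} [Fintype V] [DecidableEq V] [Fintype E] [DecidableEq E]
variable {G : MultiDigraph V E} {s t : V} {k : ℕ}

variable (G) in
/-- The edges of `T` that leave `X`. -/
def outE (T : Finset E) (X : Finset V) : Finset E := T.filter fun e => G.src e ∈ X ∧ G.tgt e ∉ X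

variable (G) in
/-- The edges of `T` that enter `X`. -/
def inE (T : Finset E) (X : Finset V) : Finset E := T.filter fun e => G.src e ∉ X ∧ G.tgt e ∈ X

/-- The residual graph of all paths, together with the edges of path `i`. -/
def PathSystem.layer (P : PathSystem G s t k) (i : ℕ) : Finset (E × Bool) :=
  resArcs P.supp ∪ (P.edges i).image fun e => (e, true)

/-- `B i` contains path `i` and preserves reachability from `s` and to `t` in layer `i` under three
faults. -/
def PathSystem.IsBackup (P : PathSystem G s t k) (B : ℕ → Finset E) : Prop :=
  ∀ i < k, P.edges i ⊆ B i ∧ ∀ F : Finset (E × Bool), F.card ≤ 3 →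
    reach (atl G) (ahd G) (P.layer i \ F) {s} ⊆
      reach (atl G) (ahd G) ((P.layer i).filter (fun a => a.1 ∈ B i) \ F) {s} ∧
    reach (ahd G) (atl G) (P.layer i \ F) {t} ⊆
      reach (ahd G) (atl G) ((P.layer i).filter (fun a => a.1 ∈ B i) \ F) {t}

/-- Two fault-tolerant reachability subgraphs of the layer, one with all arcs reversed for
reachability to `t`, and the path itself, which has fewer than `n` edges: hence `2 * N + 1`. -/
theorem exists_isBackup : ∃ N, ∀ (V E : Type) [Fintype V] [DecidableEq V] [Fintype E]
    [DecidableEq E] (G : MultiDigraph V E) (s t : V) (k : ℕ) (P : PathSystem G s t k),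
    ∃ B, P.IsBackup B ∧ ∀ i < k, (B i).card ≤ N * Fintype.card V := by
  obtain ⟨N, hN⟩ := exists_faultTolerant_reach 3
  refine ⟨2 * N + 1, fun V E _ _ _ _ G s t k P => ?_⟩
  have : ∀ i, ∃ B : Finset E, i < k → (P.edges i ⊆ B ∧ ∀ F : Finset (E × Bool), F.card ≤ 3 →
    reach (atl G) (ahd G) (P.layer i \ F) {s} ⊆
      reach (atl G) (ahd G) ((P.layer i).filter (fun a => a.1 ∈ B) \ F) {s} ∧
    reach (ahd G) (atl G) (P.layer i \ F) {t} ⊆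
      reach (ahd G) (atl G) ((P.layer i).filter (fun a => a.1 ∈ B) \ F) {t}) ∧
      B.card ≤ (2 * N + 1) * Fintype.card V := by
    intro i
    obtain ⟨W1, h1, h2, h3⟩ := hN V (E × Bool) (atl G) (ahd G) (P.layer i) {s}
    obtain ⟨W2, g1, g2, g3⟩ := hN V (E × Bool) (ahd G) (atl G) (P.layer i) {t}
    refine ⟨P.edges i ∪ (W1.image Prod.fst ∪ W2.image Prod.fst), fun hi =>
      ⟨⟨Finset.subset_union_left, fun F hF => ⟨(h3 F hF).trans (reach_mono ?_ subset_rfl),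
        (g3 F hF).trans (reach_mono ?_ subset_rfl)⟩⟩, ?_⟩⟩
    · refine Finset.sdiff_subset_sdiff (fun a ha => Finset.mem_filter.2 ⟨h1 ha, ?_⟩) subset_rfl
      exact Finset.mem_union_right _ (Finset.mem_union_left _ (Finset.mem_image_of_mem _ ha))
    · refine Finset.sdiff_subset_sdiff (fun a ha => Finset.mem_filter.2 ⟨g1 ha, ?_⟩) subset_rfl
      exact Finset.mem_union_right _ (Finset.mem_union_right _ (Finset.mem_image_of_mem _ ha))
    · have a1 := Finset.card_union_le (P.edges i) (W1.image Prod.fst ∪ W2.image Prod.fst)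
      have a2 := Finset.card_union_le (W1.image Prod.fst) (W2.image Prod.fst)
      have a3 := Finset.card_image_le (s := W1) (f := Prod.fst)
      have a4 := Finset.card_image_le (s := W2) (f := Prod.fst)
      have a5 : (P.edges i).card ≤ P.len i := by
        simpa [PathSystem.edges] using Finset.card_image_le (s := Finset.range (P.len i)) (f := P.edge i)
      have a6 := P.len_lt hi
      nlinarith
  choose B hB using this
  exact ⟨B, fun i hi => (hB i hi).1, fun i hi => (hB i hi).2⟩

/-- A path carries one unit of flow from `s` to `t`. -/
theorem PathSystem.card_outE (P : PathSystem G s t k) {i : ℕ} (hi : i < k) {X : Finset V}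
    (hs : s ∈ X) (ht : t ∉ X) :
    (outE G (P.edges i) X).card = 1 + (inE G (P.edges i) X).card := by
  have h : IsFlowSet G s t (P.edges i) 1 := fun v => by rw [znet_edges P hi, one_mul]
  have := h.sum_cut X hs ht
  simp only [outE, inE]
  omega

/-- The arcs of layer `i` that are regarded as faulty for the cut `X`. -/
def PathSystem.faults (P : PathSystem G s t k) (X : Finset V) (D : Finset (E × Bool))
    (F₀ : Finset E) (i : ℕ) : Finset (E × Bool) :=
  (outE G (P.edges i) X ∪ F₀).image (fun e => (e, true)) ∪ D

/-- The vertices that `s` reaches in layer `i` in spite of the faults. -/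
noncomputable def PathSystem.fwd (P : PathSystem G s t k) (X : Finset V) (D : Finset (E × Bool))
    (F₀ : Finset E) (i : ℕ) : Finset V :=
  reach (atl G) (ahd G) (P.layer i \ P.faults X D F₀ i) {s}

/-- The vertices that reach `t` in layer `i` in spite of the faults. -/
noncomputable def PathSystem.bwd (P : PathSystem G s t k) (X : Finset V) (D : Finset (E × Bool))
    (F₀ : Finset E) (i : ℕ) : Finset V :=
  reach (ahd G) (atl G) (P.layer i \ P.faults X D F₀ i) {t}

section

variable {P : PathSystem G s t k} {X : Finset V} {D : Finset (E × Bool)} {F₀ : Finset E} {i : ℕ}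

theorem true_notMem_resArcs {S : Finset E} {e : E} (he : e ∈ S) : (e, true) ∉ resArcs S := by
  simp [mem_resArcs, he]

theorem PathSystem.edges_subset_supp (P : PathSystem G s t k) (hi : i < k) : P.edges i ⊆ P.supp :=
  fun _ he => PathSystem.mem_supp.2 ⟨i, hi, he⟩

/-- `D` contains only residual arcs and `F₀` only edges without flow, so the forward arc of a path
edge can be faulty for no other reason. -/
theorem PathSystem.mem_outE_of_mem_faults (hi : i < k) (hD : D ⊆ resArcs P.supp)
    (hF₀ : Disjoint F₀ P.supp) {e : E} (he : e ∈ P.edges i) (h : (e, true) ∈ P.faults X D F₀ i) :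
    e ∈ outE G (P.edges i) X := by
  have hes := P.edges_subset_supp hi he
  rcases Finset.mem_union.1 h with h | h
  · simp only [Finset.mem_image, Finset.mem_union, Prod.mk.injEq, and_true, exists_eq_right] at h
    exact h.resolve_right fun h' => Finset.disjoint_left.1 hF₀ h' hes
  · exact absurd (hD h) (true_notMem_resArcs hes)

/-- The other faults are forward arcs of flow edges, which are not residual, and edges of `F₀`. So
the residual arcs that bound `fwd` or `bwd` and avoid `F₀` all come from `D`. -/
theorem PathSystem.mem_of_mem_faults (hi : i < k) {a : E × Bool} (ha : a ∈ resArcs P.supp)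
    (haF : a.1 ∉ F₀) (h : a ∈ P.faults X D F₀ i) : a ∈ D := by
  rcases Finset.mem_union.1 h with h | h
  · obtain ⟨e, he, rfl⟩ := Finset.mem_image.1 h
    rcases Finset.mem_union.1 he with he | he
    · exact absurd ha (true_notMem_resArcs (P.edges_subset_supp hi (Finset.mem_filter.1 he).1))
    · exact absurd he haF
  · exact h

theorem PathSystem.mem_faults_of_fwd {a : E × Bool} (ha : a ∈ P.layer i)
    (h1 : atl G a ∈ P.fwd X D F₀ i) (h2 : ahd G a ∉ P.fwd X D F₀ i) : a ∈ P.faults X D F₀ i := by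
  by_contra h
  exact h2 (closed_reach _ _ a (Finset.mem_sdiff.2 ⟨ha, h⟩) h1)

theorem PathSystem.mem_faults_of_bwd {a : E × Bool} (ha : a ∈ P.layer i)
    (h1 : ahd G a ∈ P.bwd X D F₀ i) (h2 : atl G a ∉ P.bwd X D F₀ i) : a ∈ P.faults X D F₀ i := by
  by_contra h
  exact h2 (closed_reach _ _ a (Finset.mem_sdiff.2 ⟨ha, h⟩) h1)

theorem PathSystem.edge_mem_layer {e : E} (he : e ∈ P.edges i) : (e, true) ∈ P.layer i :=
  Finset.mem_union_right _ (Finset.mem_image_of_mem _ he)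

/-- Before a vertex of path `i` that is not reached, the path leaves `X`. -/
theorem PathSystem.exists_lt_of_notMem_fwd (hi : i < k) (hD : D ⊆ resArcs P.supp)
    (hF₀ : Disjoint F₀ P.supp) {x : ℕ} (hx : x ≤ P.len i) (h : P.vert i x ∉ P.fwd X D F₀ i) :
    ∃ y < x, P.edge i y ∈ outE G (P.edges i) X := by
  induction x with
  | zero =>
    rw [P.vert_zero i hi] at h
    exact absurd (subset_reach _ _ (by simp)) h
  | succ x ih =>
    by_cases hx' : P.vert i x ∈ P.fwd X D F₀ i
    · have he : P.edge i x ∈ P.edges i := PathSystem.mem_edges.2 ⟨x, hx, rfl⟩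
      refine ⟨x, by omega, P.mem_outE_of_mem_faults hi hD hF₀ he
        (PathSystem.mem_faults_of_fwd (PathSystem.edge_mem_layer he) ?_ ?_)⟩
      · simpa [atl, P.src_edge i hi x hx] using hx'
      · simpa [ahd, P.tgt_edge i hi x hx] using h
    · obtain ⟨y, hy, hy'⟩ := ih (by omega) hx'
      exact ⟨y, by omega, hy'⟩

theorem PathSystem.exists_le_of_notMem_bwd (hi : i < k) (hD : D ⊆ resArcs P.supp)
    (hF₀ : Disjoint F₀ P.supp) {x : ℕ} (hx : x ≤ P.len i) (h : P.vert i x ∉ P.bwd X D F₀ i) :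
    ∃ y, x ≤ y ∧ y < P.len i ∧ P.edge i y ∈ outE G (P.edges i) X := by
  obtain ⟨d, hd⟩ : ∃ d, x + d = P.len i := ⟨P.len i - x, by omega⟩
  induction d generalizing x with
  | zero =>
    rw [show x = P.len i by omega, P.vert_len i hi] at h
    exact absurd (subset_reach _ _ (by simp)) h
  | succ d ih =>
    by_cases hx' : P.vert i (x + 1) ∈ P.bwd X D F₀ i
    · have hxl : x < P.len i := by omega
      have he : P.edge i x ∈ P.edges i := PathSystem.mem_edges.2 ⟨x, hxl, rfl⟩
      refine ⟨x, le_rfl, hxl, P.mem_outE_of_mem_faults hi hD hF₀ he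
        (PathSystem.mem_faults_of_bwd (PathSystem.edge_mem_layer he) ?_ ?_)⟩
      · simpa [ahd, P.tgt_edge i hi x hxl] using hx'
      · simpa [atl, P.src_edge i hi x hxl] using h
    · obtain ⟨y, hy, hy'⟩ := ih (by omega) hx' (by omega)
      exact ⟨y, by omega, hy'⟩

/-- An edge of path `i` that leaves `X` is the first or the last one if there are at most two. -/
theorem PathSystem.fwd_or_bwd (hi : i < k) (hD : D ⊆ resArcs P.supp)
    (hF₀ : Disjoint F₀ P.supp) {e : E} (he : e ∈ outE G (P.edges i) X)
    (hc : (outE G (P.edges i) X).card ≤ 2) :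
    G.src e ∈ P.fwd X D F₀ i ∨ G.tgt e ∈ P.bwd X D F₀ i := by
  by_contra! hcon
  obtain ⟨x, hx, rfl⟩ := PathSystem.mem_edges.1 (Finset.mem_filter.1 he).1
  rw [P.src_edge i hi x hx, P.tgt_edge i hi x hx] at hcon
  -- If both ends are missed, the path leaves `X` once more before this edge and once more after it,
  -- three times in all.
  obtain ⟨y, hy, hy'⟩ := P.exists_lt_of_notMem_fwd hi hD hF₀ hx.le hcon.1
  obtain ⟨z, hz, hzl, hz'⟩ := P.exists_le_of_notMem_bwd hi hD hF₀ hx hcon.2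
  have hsub : ({P.edge i x, P.edge i y, P.edge i z} : Finset E) ⊆ outE G (P.edges i) X := by
    intro e; simp only [Finset.mem_insert, Finset.mem_singleton]
    rintro (rfl | rfl | rfl) <;> assumption
  have h1 : P.edge i x ≠ P.edge i y := fun h => by
    have := (P.edge_inj i hi i hi x hx y (by omega) h).2; omega
  have h2 : P.edge i x ≠ P.edge i z := fun h => by
    have := (P.edge_inj i hi i hi x hx z hzl h).2; omega
  have h3 : P.edge i y ≠ P.edge i z := fun h => by
    have := (P.edge_inj i hi i hi y (by omega) z hzl h).2; omega
  have := Finset.card_le_card hsub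
  rw [Finset.card_eq_three.2 ⟨_, _, _, h1, h2, h3, rfl⟩] at this
  omega

theorem PathSystem.fwd_and_bwd (hi : i < k) (hD : D ⊆ resArcs P.supp)
    (hF₀ : Disjoint F₀ P.supp) {e : E} (he : e ∈ outE G (P.edges i) X)
    (hc : (outE G (P.edges i) X).card ≤ 1) :
    G.src e ∈ P.fwd X D F₀ i ∧ G.tgt e ∈ P.bwd X D F₀ i := by
  obtain ⟨x, hx, rfl⟩ := PathSystem.mem_edges.1 (Finset.mem_filter.1 he).1
  have hone := Finset.card_le_one.1 hc
  rw [P.src_edge i hi x hx, P.tgt_edge i hi x hx]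
  constructor <;> by_contra hcon
  · obtain ⟨y, hy, hy'⟩ := P.exists_lt_of_notMem_fwd hi hD hF₀ hx.le hcon
    have := (P.edge_inj i hi i hi x hx y (by omega) (hone _ he _ hy')).2
    omega
  · obtain ⟨z, hz, hzl, hz'⟩ := P.exists_le_of_notMem_bwd hi hD hF₀ hx hcon
    have := (P.edge_inj i hi i hi x hx z hzl (hone _ he _ hz')).2
    omega

variable {B : ℕ → Finset E}

/-- The faults are chosen such that, within the backup graph, no other arc leaves `X`. -/
theorem PathSystem.closed_faults (hF₀ : Disjoint F₀ P.supp)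
    (hD : ∀ a ∈ resArcs P.supp, a.1 ∈ B i → a.1 ∉ F₀ → atl G a ∈ X → ahd G a ∉ X → a ∈ D)
    {a : E × Bool} (ha : a ∈ (P.layer i).filter (fun a => a.1 ∈ B i) \ P.faults X D F₀ i)
    (hat : atl G a ∈ X) : ahd G a ∈ X := by
  by_contra hah
  obtain ⟨ha1, ha2⟩ := Finset.mem_sdiff.1 ha
  obtain ⟨ha3, ha4⟩ := Finset.mem_filter.1 ha1
  refine ha2 ?_
  rcases Finset.mem_union.1 ha3 with h | h
  · by_cases haF : a.1 ∈ F₀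
    · refine Finset.mem_union_left _ (Finset.mem_image.2 ⟨a.1, Finset.mem_union_right _ haF, ?_⟩)
      have := (mem_resArcs.1 h).2 (Finset.disjoint_left.1 hF₀ haF)
      rw [← this]
    · exact Finset.mem_union_right _ (hD a h ha4 haF hat hah)
  · obtain ⟨e, he, rfl⟩ := Finset.mem_image.1 h
    refine Finset.mem_union_left _ (Finset.mem_image_of_mem _ (Finset.mem_union_left _ ?_))
    exact Finset.mem_filter.2 ⟨he, by simpa [atl] using hat, by simpa [ahd] using hah⟩

/-- This is where the backup graph is used: the bound `X` is known only there, but with at most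
three faults it carries over to the whole layer. -/
theorem PathSystem.fwd_subset (hB : P.IsBackup B) (hi : i < k) (hF₀ : Disjoint F₀ P.supp)
    (hD : ∀ a ∈ resArcs P.supp, a.1 ∈ B i → a.1 ∉ F₀ → atl G a ∈ X → ahd G a ∉ X → a ∈ D)
    (hc : (P.faults X D F₀ i).card ≤ 3) (hs : s ∈ X) : P.fwd X D F₀ i ⊆ X :=
  (((hB i hi).2 _ hc).1).trans
    (reach_subset (fun _ ha => PathSystem.closed_faults hF₀ hD ha) (by simpa using hs))

theorem PathSystem.bwd_subset (hB : P.IsBackup B) (hi : i < k) (hF₀ : Disjoint F₀ P.supp)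
    (hD : ∀ a ∈ resArcs P.supp, a.1 ∈ B i → a.1 ∉ F₀ → atl G a ∈ X → ahd G a ∉ X → a ∈ D)
    (hc : (P.faults X D F₀ i).card ≤ 3) (ht : t ∉ X) : P.bwd X D F₀ i ⊆ Xᶜ := by
  refine (((hB i hi).2 _ hc).2).trans (reach_subset (fun a ha hat => ?_) (by simpa using ht))
  rw [Finset.mem_compl] at hat ⊢
  exact fun h => hat (PathSystem.closed_faults hF₀ hD ha h)

end

/-- The cuts of the backup graphs do not underestimate the value of a max-flow. -/
theorem PathSystem.exists_cut (P : PathSystem G s t k)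
    (hmax : t ∉ reach (atl G) (ahd G) (resArcs P.supp) {s}) {B : ℕ → Finset E}
    (hB : P.IsBackup B) {F F₀ : Finset E} (hFF₀ : F₀ = F \ P.supp) (hF : F.card ≤ 2) {i j : ℕ}
    (hi : i < k) (hj : j < k) (hFij : F ∩ P.supp ⊆ P.edges i ∪ P.edges j) {X : Finset V}
    (hs : s ∈ X) (ht : t ∉ X) :
    ∃ X' : Finset V, s ∈ X' ∧ t ∉ X' ∧
      (cutArcs (atl G) (ahd G) ((resArcs P.supp).filter fun a => a.1 ∉ F₀) X').card +
        (outE G (F ∩ P.supp) X).card ≤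
      (cutArcs (atl G) (ahd G)
        ((resArcs P.supp).filter fun a => a.1 ∈ B i ∪ B j ∧ a.1 ∉ F₀) X).card +
        (outE G (F ∩ P.supp) X').card := by
  set K := resArcs P.supp with hK
  set D := cutArcs (atl G) (ahd G) (K.filter fun a => a.1 ∈ B i ∪ B j ∧ a.1 ∉ F₀) X with hDdef
  set R := outE G (F ∩ P.supp) X with hR
  -- Then a minimum cut of the original flow, which no residual arc leaves, is good enough.
  by_cases hdr : R.card ≤ D.card
  · refine ⟨reach (atl G) (ahd G) K {s}, subset_reach _ _ (by simp), hmax, ?_⟩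
    have : cutArcs (atl G) (ahd G) (K.filter fun a => a.1 ∉ F₀) (reach (atl G) (ahd G) K {s}) = ∅ := by
      refine Finset.eq_empty_of_forall_notMem fun a ha => ?_
      obtain ⟨h1, h2, h3⟩ := mem_cutArcs.1 ha
      exact h3 (closed_reach _ _ a (Finset.mem_filter.1 h1).1 h2)
    rw [this]; simp only [Finset.card_empty]; omega
  have hF₀ : Disjoint F₀ P.supp := hFF₀ ▸ Finset.sdiff_disjoint
  have hDK : D ⊆ K := (Finset.filter_subset _ _).trans (Finset.filter_subset _ _)
  have hcardF : F₀.card + R.card ≤ 2 := by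
    have h1 : R.card ≤ (F ∩ P.supp).card := Finset.card_filter_le _ _
    have h2 := Finset.card_inter_add_card_sdiff F P.supp
    rw [← hFF₀] at h2
    omega
  -- facts about the two paths
  have hDp : ∀ p, (p = i ∨ p = j) → ∀ a ∈ K, a.1 ∈ B p → a.1 ∉ F₀ → atl G a ∈ X → ahd G a ∉ X → a ∈ D := by
    intro p hp a ha haB haF h1 h2
    refine mem_cutArcs.2 ⟨Finset.mem_filter.2 ⟨ha, ?_, haF⟩, h1, h2⟩
    rcases hp with rfl | rfl <;> simp [haB]
  have hpk : ∀ p, (p = i ∨ p = j) → p < k := by rintro p (rfl | rfl) <;> assumption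
  -- A path edge entering `X` gives a reversed residual arc leaving `X`, and it belongs to the
  -- backup graph because the path does.
  have hinD : ∀ p, (p = i ∨ p = j) → (inE G (P.edges p) X).image (fun e => (e, false)) ⊆ D := by
    intro p hp a ha
    obtain ⟨e, he, rfl⟩ := Finset.mem_image.1 ha
    obtain ⟨h1, h2, h3⟩ := Finset.mem_filter.1 he
    have hes := P.edges_subset_supp (hpk p hp) h1
    exact hDp p hp _ (by simp [hK, mem_resArcs, hes]) ((hB p (hpk p hp)).1 h1)
      (fun h => Finset.disjoint_left.1 hF₀ h hes) (by simpa [atl] using h3) (by simpa [ahd] using h2)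
  have hinj : Function.Injective fun e : E => (e, false) := fun a b h => (Prod.mk.inj h).1
  have hin : ∀ p, (p = i ∨ p = j) → (inE G (P.edges p) X).card ≤ D.card := fun p hp => by
    have := Finset.card_le_card (hinD p hp)
    rwa [Finset.card_image_of_injective _ hinj] at this
  have hout : ∀ p, (p = i ∨ p = j) → (outE G (P.edges p) X).card ≤ 1 + D.card := fun p hp => by
    rw [P.card_outE (hpk p hp) hs ht]; have := hin p hp; omega
  -- With `d` arcs in `D`, `r` edges in `R` and `d < r`, there are at most `1 + d` path edges, `2 -
  -- r` edges of `F₀` and `d` further arcs. Since `d ≤ 1`, this is at most three.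
  have hcard : ∀ p, (p = i ∨ p = j) → (P.faults X D F₀ p).card ≤ 3 := by
    intro p hp
    have h1 := Finset.card_union_le ((outE G (P.edges p) X ∪ F₀).image (fun e => (e, true))) D
    have h2 := Finset.card_image_le (s := outE G (P.edges p) X ∪ F₀) (f := fun e => (e, true))
    have h3 := Finset.card_union_le (outE G (P.edges p) X) F₀
    have h4 := hout p hp
    change (_ ∪ D).card ≤ 3
    omega
  have hfs : ∀ p, (p = i ∨ p = j) → P.fwd X D F₀ p ⊆ X := fun p hp =>
    PathSystem.fwd_subset hB (hpk p hp) hF₀ (hDp p hp) (hcard p hp) hs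
  have hbs : ∀ p, (p = i ∨ p = j) → P.bwd X D F₀ p ⊆ Xᶜ := fun p hp =>
    PathSystem.bwd_subset hB (hpk p hp) hF₀ (hDp p hp) (hcard p hp) ht
  have hcutF : ∀ p, (p = i ∨ p = j) → ∀ a ∈ K, a.1 ∉ F₀ → atl G a ∈ P.fwd X D F₀ p →
      ahd G a ∉ P.fwd X D F₀ p → a ∈ D := fun p hp a ha haF h1 h2 =>
    PathSystem.mem_of_mem_faults (hpk p hp) ha haF
      (PathSystem.mem_faults_of_fwd (Finset.mem_union_left _ ha) h1 h2)
  have hcutB : ∀ p, (p = i ∨ p = j) → ∀ a ∈ K, a.1 ∉ F₀ → ahd G a ∈ P.bwd X D F₀ p →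
      atl G a ∉ P.bwd X D F₀ p → a ∈ D := fun p hp a ha haF h1 h2 =>
    PathSystem.mem_of_mem_faults (hpk p hp) ha haF
      (PathSystem.mem_faults_of_bwd (Finset.mem_union_left _ ha) h1 h2)
  -- If the tails of all edges in `R` are reached from `s`, the union of the reached sets is the cut
  -- sought: all of `R` still leaves it, and only arcs of `D` leave it in the residual graph.
  have viaFwd : ∀ p q, (p = i ∨ p = j) → (q = i ∨ q = j) →
      (∀ e ∈ R, G.src e ∈ P.fwd X D F₀ p ∪ P.fwd X D F₀ q) → ∃ X' : Finset V, s ∈ X' ∧ t ∉ X' ∧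
      (cutArcs (atl G) (ahd G) (K.filter fun a => a.1 ∉ F₀) X').card + R.card ≤
      D.card + (outE G (F ∩ P.supp) X').card := by
    intro p q hp hq h
    have hsub := Finset.union_subset (hfs p hp) (hfs q hq)
    refine ⟨_, Finset.mem_union_left _ (subset_reach _ _ (by simp)), fun h' => ht (hsub h'),
      add_le_add (Finset.card_le_card fun a ha => ?_) (Finset.card_le_card fun e he => ?_)⟩
    · obtain ⟨h1, h2, h3⟩ := mem_cutArcs.1 ha
      obtain ⟨h4, h5⟩ := Finset.mem_filter.1 h1
      rw [Finset.mem_union, not_or] at h3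
      rcases Finset.mem_union.1 h2 with h2 | h2
      · exact hcutF p hp a h4 h5 h2 h3.1
      · exact hcutF q hq a h4 h5 h2 h3.2
    · obtain ⟨h1, h2, h3⟩ := Finset.mem_filter.1 he
      exact Finset.mem_filter.2 ⟨h1, h e he, fun h' => h3 (hsub h')⟩
  have viaBwd : ∀ p q, (p = i ∨ p = j) → (q = i ∨ q = j) →
      (∀ e ∈ R, G.tgt e ∈ P.bwd X D F₀ p ∪ P.bwd X D F₀ q) → ∃ X' : Finset V, s ∈ X' ∧ t ∉ X' ∧
      (cutArcs (atl G) (ahd G) (K.filter fun a => a.1 ∉ F₀) X').card + R.card ≤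
      D.card + (outE G (F ∩ P.supp) X').card := by
    intro p q hp hq h
    have hsub := Finset.union_subset (hbs p hp) (hbs q hq)
    have hX : ∀ x ∈ X, x ∉ P.bwd X D F₀ p ∪ P.bwd X D F₀ q := fun x hx h' =>
      Finset.mem_compl.1 (hsub h') hx
    refine ⟨(P.bwd X D F₀ p ∪ P.bwd X D F₀ q)ᶜ, Finset.mem_compl.2 (hX s hs), fun h' =>
      Finset.mem_compl.1 h' (Finset.mem_union_left _ (subset_reach _ _ (by simp))),
      add_le_add (Finset.card_le_card fun a ha => ?_) (Finset.card_le_card fun e he => ?_)⟩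
    · obtain ⟨h1, h2, h3⟩ := mem_cutArcs.1 ha
      obtain ⟨h4, h5⟩ := Finset.mem_filter.1 h1
      rw [Finset.mem_compl, Finset.mem_union, not_or] at h2
      rw [Finset.mem_compl, not_not] at h3
      rcases Finset.mem_union.1 h3 with h3 | h3
      · exact hcutB p hp a h4 h5 h3 h2.1
      · exact hcutB q hq a h4 h5 h3 h2.2
    · obtain ⟨h1, h2, h3⟩ := Finset.mem_filter.1 he
      exact Finset.mem_filter.2 ⟨h1, Finset.mem_compl.2 (hX _ h2), fun h' => Finset.mem_compl.1 h' (h e he)⟩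
  have hRpath : ∀ e ∈ R, ∃ p, (p = i ∨ p = j) ∧ e ∈ outE G (P.edges p) X := by
    intro e he
    obtain ⟨h1, h2⟩ := Finset.mem_filter.1 he
    rcases Finset.mem_union.1 (hFij h1) with h | h
    · exact ⟨i, .inl rfl, Finset.mem_filter.2 ⟨h, h2⟩⟩
    · exact ⟨j, .inr rfl, Finset.mem_filter.2 ⟨h, h2⟩⟩
  rcases Nat.eq_zero_or_pos D.card with hd0 | hd0
  -- With `D` empty each path leaves `X` only once, so each failing flow edge is preceded by a
  -- fault-free part of its path.
  · refine viaFwd i j (.inl rfl) (.inr rfl) fun e he => ?_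
    obtain ⟨p, hp, hep⟩ := hRpath e he
    have := (PathSystem.fwd_and_bwd (D := D) (hpk p hp) hDK hF₀ hep (by have := hout p hp; omega)).1
    rcases hp with rfl | rfl
    · exact Finset.mem_union_left _ this
    · exact Finset.mem_union_right _ this
  have hd1 : D.card = 1 := by omega
  clear_value D
  -- The only case left is one arc against two failing flow edges; in particular `F₀` is empty.
  have hr2 : R.card = 2 := by omega
  obtain ⟨e₁, e₂, hne, hRe⟩ := Finset.card_eq_two.1 hr2
  obtain ⟨p, hp, hep⟩ := hRpath e₁ (by simp [hRe])
  obtain ⟨q, hq, heq⟩ := hRpath e₂ (by simp [hRe])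
  have hop := hout p hp
  have hoq := hout q hq
  by_cases hpq : p = q
  · -- both faults on the same path
    subst hpq
    have hop2 : outE G (P.edges p) X = {e₁, e₂} := by
      refine (Finset.eq_of_subset_of_card_le ?_ ?_).symm
      · intro e he
        simp only [Finset.mem_insert, Finset.mem_singleton] at he
        rcases he with rfl | rfl <;> assumption
      · rw [Finset.card_pair hne]; omega
    -- The path leaves `X` twice, so it enters `X` once, and the reversed entering edge is the only
    -- arc in `D`.
    have hDin : D = (inE G (P.edges p) X).image (fun e => (e, false)) := by
      refine (Finset.eq_of_subset_of_card_le (hinD p hp) ?_).symm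
      rw [Finset.card_image_of_injective _ hinj]
      have h1 := P.card_outE (hpk p hp) hs ht
      rw [hop2, Finset.card_pair hne] at h1
      omega
    have hsF : s ∈ P.fwd X D F₀ p := subset_reach _ _ (by simp)
    have htF : t ∉ P.fwd X D F₀ p := fun h => ht (hfs p hp h)
    have hce := P.card_outE (hpk p hp) hsF htF
    have hsub2 : outE G (P.edges p) (P.fwd X D F₀ p) ⊆ outE G (F ∩ P.supp) (P.fwd X D F₀ p) := by
      intro e he
      obtain ⟨h1, h2, h3⟩ := Finset.mem_filter.1 he
      have : e ∈ R := by
        rw [hRe, ← hop2]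
        exact P.mem_outE_of_mem_faults (hpk p hp) hDK hF₀ h1
          (PathSystem.mem_faults_of_fwd (PathSystem.edge_mem_layer h1) (by simpa [atl] using h2)
            (by simpa [ahd] using h3))
      exact Finset.mem_filter.2 ⟨(Finset.mem_filter.1 this).1, h2, h3⟩
    have hsub3 : cutArcs (atl G) (ahd G) (K.filter fun a => a.1 ∉ F₀) (P.fwd X D F₀ p) ⊆
        (inE G (P.edges p) (P.fwd X D F₀ p)).image (fun e => (e, false)) := by
      intro a ha
      obtain ⟨h1, h2, h3⟩ := mem_cutArcs.1 ha
      obtain ⟨h4, h5⟩ := Finset.mem_filter.1 h1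
      have h6 := hcutF p hp a h4 h5 h2 h3
      rw [hDin] at h6
      obtain ⟨e, he, rfl⟩ := Finset.mem_image.1 h6
      refine Finset.mem_image_of_mem _ (Finset.mem_filter.2 ⟨(Finset.mem_filter.1 he).1, ?_, ?_⟩)
      · simpa [ahd] using h3
      · simpa [atl] using h2
    -- Path edges leaving the reached set fail, and residual arcs leaving it reverse path edges
    -- entering it. The path leaves this set once more than it enters, which is the difference of
    -- one that is needed.
    refine ⟨_, hsF, htF, ?_⟩
    have h7 := Finset.card_le_card hsub2
    have h8 := Finset.card_le_card hsub3
    rw [Finset.card_image_of_injective _ hinj] at h8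
    omega
  · -- one of the two paths crosses the cut only once
    have hone : (outE G (P.edges p) X).card ≤ 1 ∨ (outE G (P.edges q) X).card ≤ 1 := by
      by_contra! hcon
      rw [P.card_outE (hpk p hp) hs ht, P.card_outE (hpk q hq) hs ht] at hcon
      obtain ⟨e, he⟩ : (inE G (P.edges p) X).Nonempty := Finset.card_pos.1 (by omega)
      obtain ⟨e', he'⟩ : (inE G (P.edges q) X).Nonempty := Finset.card_pos.1 (by omega)
      have h1 : (e, false) ∈ D := hinD p hp (Finset.mem_image.2 ⟨e, he, rfl⟩)
      have h1' : (e', false) ∈ D := hinD q hq (Finset.mem_image.2 ⟨e', he', rfl⟩)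
      -- Both reversed edges would be the single arc in `D`, but the paths are edge-disjoint.
      have h2 : e = e' := hinj (Finset.card_le_one.1 hd1.le _ h1 _ h1')
      subst h2
      exact hpq (P.edges_disjoint (hpk p hp) (hpk q hq) (Finset.mem_filter.1 he).1 (Finset.mem_filter.1 he').1)
    -- The path that crosses once admits either direction; the other one crosses at most twice, so
    -- its failing edge is its first or last crossing and dictates the direction.
    have aux : (G.src e₁ ∈ P.fwd X D F₀ p ∧ G.src e₂ ∈ P.fwd X D F₀ q) ∨
        (G.tgt e₁ ∈ P.bwd X D F₀ p ∧ G.tgt e₂ ∈ P.bwd X D F₀ q) := by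
      rcases hone with h | h
      · have h1 := PathSystem.fwd_and_bwd (D := D) (hpk p hp) hDK hF₀ hep h
        have h2 := PathSystem.fwd_or_bwd (D := D) (hpk q hq) hDK hF₀ heq (by omega)
        exact h2.imp (fun h => ⟨h1.1, h⟩) fun h => ⟨h1.2, h⟩
      · have h1 := PathSystem.fwd_and_bwd (D := D) (hpk q hq) hDK hF₀ heq h
        have h2 := PathSystem.fwd_or_bwd (D := D) (hpk p hp) hDK hF₀ hep (by omega)
        exact h2.imp (fun h => ⟨h, h1.1⟩) fun h => ⟨h, h1.2⟩
    rcases aux with ⟨h1, h2⟩ | ⟨h1, h2⟩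
    · refine viaFwd p q hp hq fun e he => ?_
      rw [hRe, Finset.mem_insert, Finset.mem_singleton] at he
      rcases he with rfl | rfl <;> simp [h1, h2]
    · refine viaBwd p q hp hq fun e he => ?_
      rw [hRe, Finset.mem_insert, Finset.mem_singleton] at he
      rcases he with rfl | rfl <;> simp [h1, h2]

end Cut

end FTFlow

/-! ### Optimality of a flow that is stuck in the backup graphs -/

namespace FTFlow

set_option linter.unusedSectionVars false

section Update

variable {V E : Type*} [Fintype V] [DecidableEq V] [Fintype E] [DecidableEq E]
variable {G : MultiDigraph V E} {s t : V} {k : ℕ}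

/-- No flow enters `X`, so the value of the flow is the number of its edges leaving `X`, and these
include all surviving ones. -/
theorem IsFlowSet.card_le_of_saturated {S F : Finset E} {c : ℤ} (h : IsFlowSet G s t S c)
    {X : Finset V} (hs : s ∈ X) (ht : t ∉ X)
    (hout : ∀ e ∉ F, G.src e ∈ X → G.tgt e ∉ X → e ∈ S)
    (hin : ∀ e, G.src e ∉ X → G.tgt e ∈ X → e ∉ S) :
    ((Finset.univ.filter fun e => e ∉ F ∧ G.src e ∈ X ∧ G.tgt e ∉ X).card : ℤ) ≤ c := by
  rw [h.sum_cut X hs ht]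
  have h1 : (S.filter fun e => G.src e ∉ X ∧ G.tgt e ∈ X) = ∅ :=
    Finset.filter_eq_empty_iff.2 fun e he h => hin e h.1 h.2 he
  rw [h1, Finset.card_empty, Nat.cast_zero, sub_zero]
  norm_cast
  refine Finset.card_le_card fun e he => ?_
  obtain ⟨-, h2, h3, h4⟩ := Finset.mem_filter.1 he
  exact Finset.mem_filter.2 ⟨hout e h2 h3 h4, h3, h4⟩

/-- The set reached in the residual graph is a minimum cut of `G`, and deleting edges does not
increase its capacity. It certifies every updated flow that keeps the value `k`. -/
theorem PathSystem.exists_min_cut (P : PathSystem G s t k)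
    (hmax : t ∉ reach (atl G) (ahd G) (resArcs P.supp) {s}) (F : Finset E) :
    ∃ X : Finset V, s ∈ X ∧ t ∉ X ∧
      ((Finset.univ.filter fun e => e ∉ F ∧ G.src e ∈ X ∧ G.tgt e ∉ X).card : ℤ) ≤ k := by
  have hc := closed_reach (tl := atl G) (hd := ahd G) (resArcs P.supp) {s}
  refine ⟨_, subset_reach _ _ (by simp), hmax,
    P.isFlowSet.card_le_of_saturated (subset_reach _ _ (by simp)) hmax ?_ ?_⟩
  · intro e _ h1 h2
    by_contra he
    exact h2 (hc (e, true) (by simp [mem_resArcs, he]) h1)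
  · intro e h1 h2 he
    exact h1 (hc (e, false) (by simp [mem_resArcs, he]) h2)

theorem card_cutArcs_eq_sum (U : Finset (E × Bool)) (X : Finset V) :
    ((cutArcs (atl G) (ahd G) U X).card : ℤ) =
      ∑ e, ((if (e, true) ∈ U ∧ G.src e ∈ X ∧ G.tgt e ∉ X then 1 else 0) +
        if (e, false) ∈ U ∧ G.tgt e ∈ X ∧ G.src e ∉ X then 1 else 0) := by
  have h1 : (cutArcs (atl G) (ahd G) U X).card =
      ∑ a : E × Bool, if a ∈ U ∧ atl G a ∈ X ∧ ahd G a ∉ X then 1 else 0 := by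
    rw [← Finset.card_filter]
    congr 1
    ext a; simp [mem_cutArcs]
  rw [h1, Fintype.sum_prod_type]
  push_cast
  refine Finset.sum_congr rfl fun e _ => ?_
  rw [Fintype.sum_bool]
  simp [atl, ahd]

theorem card_outE_eq_sum (S : Finset E) (X : Finset V) :
    ((outE G S X).card : ℤ) = ∑ e, if e ∈ S ∧ G.src e ∈ X ∧ G.tgt e ∉ X then 1 else 0 := by
  have : outE G S X = Finset.univ.filter fun e => e ∈ S ∧ G.src e ∈ X ∧ G.tgt e ∉ X := by
    ext e; simp [outE]
  rw [this, Finset.card_filter]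
  push_cast
  rfl

theorem IsFlowSet.eq_sum {S : Finset E} {c : ℤ} (h : IsFlowSet G s t S c)
    {X : Finset V} (hs : s ∈ X) (ht : t ∉ X) :
    c = ∑ e, ((if e ∈ S ∧ G.src e ∈ X ∧ G.tgt e ∉ X then 1 else 0) -
      if e ∈ S ∧ G.src e ∉ X ∧ G.tgt e ∈ X then 1 else 0) := by
  rw [h.sum_cut X hs ht, Finset.sum_sub_distrib, ← card_outE_eq_sum, outE]
  congr 1
  have : (S.filter fun e => G.src e ∉ X ∧ G.tgt e ∈ X) =
      Finset.univ.filter fun e => e ∈ S ∧ G.src e ∉ X ∧ G.tgt e ∈ X := by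
    ext e; simp
  rw [this, Finset.card_filter]
  push_cast
  rfl

/-- A flow that cannot be augmented in the backup graphs is a max-flow. -/
theorem PathSystem.exists_cut_of_saturated (P : PathSystem G s t k)
    (hmax : t ∉ reach (atl G) (ahd G) (resArcs P.supp) {s}) {B : ℕ → Finset E}
    (hB : P.IsBackup B) {F : Finset E} (hF : F.card ≤ 2) {i j : ℕ}
    (hi : i < k) (hj : j < k) (hFij : F ∩ P.supp ⊆ P.edges i ∪ P.edges j) {S : Finset E} {c : ℤ}
    (hS : IsFlowSet G s t S c) (hSF : Disjoint S F)
    (hSB : ∀ e ∉ B i ∪ B j, e ∉ F → (e ∈ S ↔ e ∈ P.supp)) {X : Finset V}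
    (hs : s ∈ X) (ht : t ∉ X)
    (hX : ∀ e ∈ B i ∪ B j, e ∉ F → (G.src e ∈ X → G.tgt e ∉ X → e ∈ S) ∧
      (G.src e ∉ X → G.tgt e ∈ X → e ∉ S)) :
    ∃ X' : Finset V, s ∈ X' ∧ t ∉ X' ∧
      ((Finset.univ.filter fun e => e ∉ F ∧ G.src e ∈ X' ∧ G.tgt e ∉ X').card : ℤ) ≤ c := by
  obtain ⟨X', hs', ht', hle⟩ := P.exists_cut hmax hB (F₀ := F \ P.supp) rfl hF hi hj hFij hs ht
  refine ⟨X', hs', ht', ?_⟩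
  have hFB : ∀ e ∈ F, e ∈ P.supp → e ∈ B i ∪ B j := fun e h1 h2 => by
    rcases Finset.mem_union.1 (hFij (Finset.mem_inter.2 ⟨h1, h2⟩)) with h | h
    · exact Finset.mem_union_left _ ((hB i hi).1 h)
    · exact Finset.mem_union_right _ ((hB j hj).1 h)
  have hnot : ∀ e ∈ F, e ∉ S := fun e h1 h2 => Finset.disjoint_left.1 hSF h2 h1
  -- Checked edge by edge: across `X` the new flow is saturated on surviving backup edges, zero on
  -- `F`, and equal to the old one elsewhere.
  have h1 : c = k + (cutArcs (atl G) (ahd G) ((resArcs P.supp).filter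
      fun a => a.1 ∈ B i ∪ B j ∧ a.1 ∉ F \ P.supp) X).card - (outE G (F ∩ P.supp) X).card := by
    rw [hS.eq_sum hs ht, P.isFlowSet.eq_sum hs ht, card_cutArcs_eq_sum, card_outE_eq_sum,
      ← Finset.sum_add_distrib, ← Finset.sum_sub_distrib]
    refine Finset.sum_congr rfl fun e _ => ?_
    simp only [Finset.mem_filter, mem_resArcs, Finset.mem_sdiff, Finset.mem_inter]
    have a1 := hFB e
    have a2 := hnot e
    have a3 := hSB e
    have a4 := hX e
    by_cases b4 : G.src e ∈ X <;> by_cases b5 : G.tgt e ∈ X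
    · simp [b4, b5]
    · have hS : e ∈ S ↔ e ∉ F ∧ (e ∈ B i ∪ B j ∨ e ∈ P.supp) := by
        by_cases b1 : e ∈ F
        · simp [a2 b1, b1]
        by_cases b3 : e ∈ B i ∪ B j
        · simp only [(a4 b3 b1).1 b4 b5, b1, b3, not_false_eq_true, true_or, and_self]
        · simp only [a3 b3 b1, b1, b3, not_false_eq_true, true_and, false_or]
      by_cases b1 : e ∈ F <;> by_cases b2 : e ∈ P.supp <;> by_cases b3 : e ∈ B i ∪ B j <;>
        simp only [hS, b1, b2, b3, b4, b5] <;> norm_num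
    · have hS : e ∈ S ↔ e ∉ F ∧ e ∉ B i ∪ B j ∧ e ∈ P.supp := by
        by_cases b1 : e ∈ F
        · simp [a2 b1, b1]
        by_cases b3 : e ∈ B i ∪ B j
        · simp only [(a4 b3 b1).2 b4 b5, b1, b3, not_true_eq_false, false_and, and_false]
        · simp only [a3 b3 b1, b1, b3, not_false_eq_true, true_and]
      by_cases b1 : e ∈ F <;> by_cases b2 : e ∈ P.supp
      · have b3 := a1 b1 b2
        simp only [hS, b1, b2, b3, b4, b5]; norm_num
      all_goals by_cases b3 : e ∈ B i ∪ B j <;> simp only [hS, b1, b2, b3, b4, b5] <;> norm_num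
    · simp [b4, b5]
  -- The capacity of `X'` in `G - F`, again edge by edge: `k` plus the residual arcs leaving `X'`
  -- minus the failing flow edges leaving it.
  have h2 : ((Finset.univ.filter fun e => e ∉ F ∧ G.src e ∈ X' ∧ G.tgt e ∉ X').card : ℤ) ≤
      k + (cutArcs (atl G) (ahd G) ((resArcs P.supp).filter
        fun a => a.1 ∉ F \ P.supp) X').card - (outE G (F ∩ P.supp) X').card := by
    rw [P.isFlowSet.eq_sum hs' ht', card_cutArcs_eq_sum, card_outE_eq_sum,
      ← Finset.sum_add_distrib, ← Finset.sum_sub_distrib, Finset.card_filter]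
    push_cast
    refine Finset.sum_le_sum fun e _ => ?_
    simp only [Finset.mem_filter, mem_resArcs, Finset.mem_sdiff, Finset.mem_inter]
    by_cases b1 : e ∈ F <;> by_cases b2 : e ∈ P.supp <;>
      by_cases b4 : G.src e ∈ X' <;> by_cases b5 : G.tgt e ∈ X' <;>
      simp [b1, b2, b4, b5]
  omega

end Update

/-! ### Detours for a single failure -/

section Detour

variable {V E : Type*} [Fintype V] [DecidableEq V] [Fintype E] [DecidableEq E]
variable {G : MultiDigraph V E} {s t : V} {k : ℕ}

/-- The residual graph without the reversed edges of path `i`. -/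
def PathSystem.offArcs (P : PathSystem G s t k) (i : ℕ) : Finset (E × Bool) :=
  (resArcs P.supp).filter fun a => a.1 ∉ P.edges i

/-- The vertices that the first `x + 1` vertices of path `i` reach off this path. -/
noncomputable def PathSystem.offReach (P : PathSystem G s t k) (i x : ℕ) : Finset V :=
  reach (atl G) (ahd G) (P.offArcs i) ((Finset.range (x + 1)).image (P.vert i))

/-- The position on path `i` of the last vertex in `offReach`. -/
noncomputable def PathSystem.far (P : PathSystem G s t k) (i x : ℕ) : ℕ :=
  Nat.findGreatest (fun b => P.vert i b ∈ P.offReach i x) (P.len i)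

variable (P : PathSystem G s t k)

theorem PathSystem.vert_mem_offReach {i x y : ℕ} (h : y ≤ x) : P.vert i y ∈ P.offReach i x :=
  subset_reach _ _ (Finset.mem_image_of_mem _ (Finset.mem_range.2 (by omega)))

theorem PathSystem.offReach_mono {i x y : ℕ} (h : x ≤ y) : P.offReach i x ⊆ P.offReach i y :=
  reach_mono subset_rfl (Finset.image_subset_image (Finset.range_mono (by omega)))

theorem PathSystem.far_le_len (i x : ℕ) : P.far i x ≤ P.len i := Nat.findGreatest_le _

theorem PathSystem.le_far {i x b : ℕ} (hb : b ≤ P.len i) (h : P.vert i b ∈ P.offReach i x) :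
    b ≤ P.far i x := Nat.le_findGreatest hb h

theorem PathSystem.vert_far {i x : ℕ} (hx : x ≤ P.len i) :
    P.vert i (P.far i x) ∈ P.offReach i x :=
  Nat.findGreatest_spec (P := fun b => P.vert i b ∈ P.offReach i x) hx (P.vert_mem_offReach le_rfl)

theorem PathSystem.far_mono {i x y : ℕ} (h : x ≤ y) (hx : x ≤ P.len i) :
    P.far i x ≤ P.far i y :=
  P.le_far (P.far_le_len _ _) (P.offReach_mono h (P.vert_far hx))

/-- Position `a` of path `i` is where a detour starts. -/
def PathSystem.IsStart (i a : ℕ) : Prop :=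
  i < k ∧ a < P.far i a ∧ ∀ a' < a, P.far i a' < P.far i a

/-- The first position that gets as far as `x` does is a strict record of the monotone function
`far`. Hence detours are needed only from records. -/
theorem PathSystem.exists_isStart {i x : ℕ} (hi : i < k) (hx : x < P.far i x) :
    ∃ a ≤ x, P.IsStart i a ∧ P.far i a = P.far i x := by
  classical
  have hex : ∃ a, P.far i a = P.far i x := ⟨x, rfl⟩
  have hle : Nat.find hex ≤ x := Nat.find_min' hex rfl
  have hlen := P.far_le_len i x
  refine ⟨Nat.find hex, hle, ⟨hi, ?_, fun a' ha' => ?_⟩, Nat.find_spec hex⟩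
  · rw [Nat.find_spec hex]; omega
  · exact lt_of_le_of_ne (P.far_mono ha'.le (by omega))
      (by rw [Nat.find_spec hex]; exact Nat.find_min hex ha')

/-- The path found starts at one of the first `a + 1` positions; an earlier one than `a` is
impossible, since it would get as far as `a` does. -/
theorem PathSystem.exists_detour [Nonempty E] {i a : ℕ} (ha : P.IsStart i a) :
    ∃ (l : ℕ) (vert : ℕ → V) (arc : ℕ → E × Bool), vert 0 = P.vert i a ∧
      vert l = P.vert i (P.far i a) ∧
      (∀ x < l, arc x ∈ P.offArcs i ∧ atl G (arc x) = vert x ∧ ahd G (arc x) = vert (x + 1)) ∧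
      ∀ x ≤ l, ∀ y ≤ l, vert x = vert y → x = y := by
  obtain ⟨hi, h1, h2⟩ := ha
  have hlen := P.far_le_len i a
  obtain ⟨l, vert, arc, g1, g2, g3, g4⟩ := exists_path_of_mem_reach (P.vert_far (i := i) (x := a) (by omega))
  refine ⟨l, vert, arc, ?_, g2, g3, g4⟩
  obtain ⟨a', ha', he⟩ := Finset.mem_image.1 g1
  have ha'' := Finset.mem_range.1 ha'
  rcases Nat.lt_succ_iff_lt_or_eq.1 ha'' with h | rfl
  · exfalso
    have h3 := h2 a' h
    have : ∀ x ≤ l, vert x ∈ P.offReach i a' := by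
      intro x
      induction x with
      | zero => exact fun _ => he ▸ P.vert_mem_offReach le_rfl
      | succ x ih =>
        intro hx
        obtain ⟨c1, c2, c3⟩ := g3 x hx
        rw [← c3]; exact closed_reach _ _ _ c1 (c2 ▸ ih (by omega))
    have := P.le_far hlen (g2 ▸ this l le_rfl)
    omega
  · exact he.symm

/-- The detours of all paths, stored at the vertices that they enter. -/
theorem PathSystem.exists_detourTable [Nonempty E] : ∃ (tag : ℕ → V → ℕ) (dedge : ℕ → V → Option E),
    (∀ i w e, dedge i w = some e → i < k ∧ 1 ≤ tag i w ∧ tag i w ≤ P.len i ∧ e ∉ P.edges i ∧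
      w = if e ∈ P.supp then G.src e else G.tgt e) ∧
    ∀ i a, P.IsStart i a → ∃ (l : ℕ) (vert : ℕ → V) (arc : ℕ → E × Bool), vert 0 = P.vert i a ∧
      vert l = P.vert i (P.far i a) ∧
      (∀ x < l, arc x ∈ P.offArcs i ∧ atl G (arc x) = vert x ∧ ahd G (arc x) = vert (x + 1)) ∧
      (∀ x ≤ l, ∀ y ≤ l, vert x = vert y → x = y) ∧
      ∀ e, (∃ w, dedge i w = some e ∧ tag i w = a + 1) ↔ ∃ x < l, (arc x).1 = e := by
  classical
  have hdet : ∀ i a, ∃ (l : ℕ) (vert : ℕ → V) (arc : ℕ → E × Bool), P.IsStart i a → vert 0 = P.vert i a ∧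
      vert l = P.vert i (P.far i a) ∧
      (∀ x < l, arc x ∈ P.offArcs i ∧ atl G (arc x) = vert x ∧ ahd G (arc x) = vert (x + 1)) ∧
      ∀ x ≤ l, ∀ y ≤ l, vert x = vert y → x = y := by
    intro i a
    by_cases h : P.IsStart i a
    · obtain ⟨l, vert, arc, h'⟩ := P.exists_detour h
      exact ⟨l, vert, arc, fun _ => h'⟩
    · exact ⟨0, fun _ => s, fun _ => (Classical.arbitrary E, true), fun h' => absurd h' h⟩
  choose l vert arc hd using hdet
  -- `w` is entered by arc number `p.2` of the detour of path `i` that starts at position `p.1`.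
  let on : ℕ → V → ℕ × ℕ → Prop := fun i w p => P.IsStart i p.1 ∧ p.2 < l i p.1 ∧ vert i p.1 (p.2 + 1) = w
  have hmem : ∀ i a, P.IsStart i a → ∀ x ≤ l i a, vert i a x ∈ P.offReach i a := by
    intro i a ha x
    obtain ⟨g1, g2, g3, g4⟩ := hd i a ha
    induction x with
    | zero => exact fun _ => g1 ▸ P.vert_mem_offReach le_rfl
    | succ x ih =>
      intro hx
      obtain ⟨c1, c2, c3⟩ := g3 x hx
      rw [← c3]; exact closed_reach _ _ _ c1 (c2 ▸ ih (by omega))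
  -- Detours from different records are vertex-disjoint: from a common vertex, the earlier start
  -- could follow the other detour and get as far as the later start.
  have hlt : ∀ i a a', P.IsStart i a → P.IsStart i a' → a < a' → ∀ x ≤ l i a, ∀ y ≤ l i a',
      vert i a x ≠ vert i a' y := by
    intro i a a' ha ha' haa x hx y hy he
    obtain ⟨g1, g2, g3, g4⟩ := hd i a' ha'
    have : ∀ d, y + d ≤ l i a' → vert i a' (y + d) ∈ P.offReach i a := by
      intro d
      induction d with
      | zero => exact fun _ => he ▸ hmem i a ha x hx
      | succ d ih =>
        intro hd'
        obtain ⟨c1, c2, c3⟩ := g3 (y + d) (by omega)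
        rw [show y + (d + 1) = y + d + 1 by ring, ← c3]
        exact closed_reach _ _ _ c1 (c2 ▸ ih (by omega))
    have := this (l i a' - y) (by omega)
    rw [show y + (l i a' - y) = l i a' by omega, g2] at this
    have h1 := P.le_far (P.far_le_len _ _) this
    have h2 := ha'.2.2 a haa
    omega
  have huniq : ∀ i w p q, on i w p → on i w q → p = q := by
    rintro i w ⟨a, x⟩ ⟨a', y⟩ ⟨p1, p2, p3⟩ ⟨q1, q2, q3⟩
    simp only at p1 p2 p3 q1 q2 q3
    rcases lt_trichotomy a a' with h | rfl | h
    · exact absurd (p3.trans q3.symm) (hlt i a a' p1 q1 h _ p2 _ q2)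
    · have := (hd i a p1).2.2.2 _ p2 _ q2 (p3.trans q3.symm)
      simp only [Prod.mk.injEq, true_and]; omega
    · exact absurd (q3.trans p3.symm) (hlt i a' a q1 p1 h _ q2 _ p2)
  -- Tags are start positions plus one, so that the tag `0` selects no detour.
  let tag : ℕ → V → ℕ := fun i w => if h : ∃ p, on i w p then h.choose.1 + 1 else 0
  let dedge : ℕ → V → Option E := fun i w =>
    if h : ∃ p, on i w p then some (arc i h.choose.1 h.choose.2).1 else none
  have hval : ∀ i w p, on i w p → tag i w = p.1 + 1 ∧ dedge i w = some (arc i p.1 p.2).1 := by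
    intro i w p hp
    have hex : ∃ p, on i w p := ⟨p, hp⟩
    have : hex.choose = p := huniq i w _ _ hex.choose_spec hp
    simp only [tag, dedge, dif_pos hex, this, and_self]
  have hback : ∀ i w e, dedge i w = some e → ∃ p, on i w p ∧ e = (arc i p.1 p.2).1 := by
    intro i w e he
    by_cases hex : ∃ p, on i w p
    · obtain ⟨p, hp⟩ := hex
      have := (hval i w p hp).2
      rw [he] at this
      exact ⟨p, hp, Option.some.inj this⟩
    · simp only [dedge, dif_neg hex] at he; exact absurd he (by simp)
  refine ⟨tag, dedge, fun i w e he => ?_, fun i a ha => ?_⟩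
  · obtain ⟨⟨a, x⟩, hp, rfl⟩ := hback i w e he
    have h1 := (hval i w _ hp).1
    obtain ⟨p1, p2, p3⟩ := hp
    simp only at p1 p2 p3 h1
    obtain ⟨c1, c2, c3⟩ := (hd i a p1).2.2.1 x p2
    obtain ⟨c4, c5⟩ := Finset.mem_filter.1 c1
    have h2 := P.far_le_len i a
    have h3 := p1.2.1
    refine ⟨p1.1, by omega, by omega, c5, ?_⟩
    rw [← p3, ← c3, ahd]
    -- The arc is reversed exactly if its edge carries flow, so the edge alone determines the vertex
    -- at which it is stored.
    have h4 := mem_resArcs.1 c4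
    by_cases h5 : (arc i a x).1 ∈ P.supp <;> simp_all
  · obtain ⟨g1, g2, g3, g4⟩ := hd i a ha
    refine ⟨l i a, vert i a, arc i a, g1, g2, g3, g4, fun e => ⟨?_, ?_⟩⟩
    · rintro ⟨w, hw, htag⟩
      obtain ⟨⟨a', x⟩, hp, rfl⟩ := hback i w e hw
      have h1 := (hval i w _ hp).1
      have h2 : a' = a := by simp only at h1; omega
      subst h2
      exact ⟨x, hp.2.1, rfl⟩
    · rintro ⟨x, hx, rfl⟩
      have := hval i (vert i a (x + 1)) (a, x) ⟨ha, hx, rfl⟩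
      exact ⟨_, this.2, this.1⟩

/-- The edges at positions `lo ≤ x < hi` of path `i`. -/
def PathSystem.segment (i lo hi : ℕ) : Finset E := (Finset.Ico lo hi).image (P.edge i)

theorem PathSystem.segment_subset {i lo hi : ℕ} (h : hi ≤ P.len i) :
    P.segment i lo hi ⊆ P.edges i := by
  intro e he
  obtain ⟨x, hx, rfl⟩ := Finset.mem_image.1 he
  exact PathSystem.mem_edges.2 ⟨x, by have := (Finset.mem_Ico.1 hx).2; omega, rfl⟩

theorem PathSystem.znet_segment {i lo hi : ℕ} (hi' : i < k) (hlo : lo ≤ hi) (hhi : hi ≤ P.len i) (v : V) :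
    znet G (P.segment i lo hi) v = dif (P.vert i lo) (P.vert i hi) v := by
  have := znet_flip_path (G := G) (S := ∅) (l := hi - lo) (vert := fun x => P.vert i (lo + x))
    (arc := fun x => (P.edge i (lo + x), true))
    (fun x hx => ⟨by simp [mem_resArcs], by simp [atl, P.src_edge i hi' (lo + x) (by omega)],
      by simp [ahd, P.tgt_edge i hi' (lo + x) (by omega), add_assoc]⟩)
      (fun x hx y hy h => by have := P.vert_inj i hi' _ (by omega) _ (by omega) h; omega) v
  have h2 : (Finset.range (hi - lo)).image (fun x => P.edge i (lo + x)) = P.segment i lo hi := by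
    ext e
    simp only [Finset.mem_image, Finset.mem_range, PathSystem.segment, Finset.mem_Ico]
    constructor
    · rintro ⟨x, hx, rfl⟩; exact ⟨lo + x, by omega, rfl⟩
    · rintro ⟨x, hx, rfl⟩; exact ⟨x - lo, by omega, by congr 1; omega⟩
  simp only [h2] at this
  simpa [symmDiff_def, znet, Nat.add_sub_cancel' hlo] using this

theorem znet_sdiff {S T : Finset E} (h : T ⊆ S) (v : V) :
    znet G (S \ T) v = znet G S v - znet G T v := by
  have := znet_union (G := G) (Finset.sdiff_disjoint (s := T) (t := S)) v
  rw [Finset.sdiff_union_of_subset h] at this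
  linarith

/-- The flow set after the failure of one edge at which `lo`, `hi` and `tg` are stored. -/
noncomputable def PathSystem.updated (tag : ℕ → V → ℕ) (dedge : ℕ → V → Option E) (i lo hi tg : ℕ) :
    Finset E := by
  classical
  exact symmDiff (P.supp \ P.segment i lo hi)
    (Finset.univ.filter fun e => ∃ w, dedge i w = some e ∧ tag i w = tg)

/-- After one failure, the flow is rerouted along a detour, or its path is dropped. -/
theorem PathSystem.exists_singleFailure [Nonempty E]
    (hmax : t ∉ reach (atl G) (ahd G) (resArcs P.supp) {s}) :
    ∃ (tag : ℕ → V → ℕ) (dedge : ℕ → V → Option E) (lo hi tg : ℕ → ℕ → ℕ),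
    (∀ i w e, dedge i w = some e → i < k ∧ 1 ≤ tag i w ∧ tag i w ≤ P.len i ∧ e ∉ P.edges i ∧
      w = if e ∈ P.supp then G.src e else G.tgt e) ∧
    ∀ i < k, ∀ x < P.len i, lo i x ≤ x ∧ x < hi i x ∧ hi i x ≤ P.len i ∧ tg i x ≤ P.len i ∧
      P.edge i x ∉ P.updated tag dedge i (lo i x) (hi i x) (tg i x) ∧
      ∃ c : ℤ, IsFlowSet G s t (P.updated tag dedge i (lo i x) (hi i x) (tg i x)) c ∧
        ∃ X : Finset V, s ∈ X ∧ t ∉ X ∧ ((Finset.univ.filter fun e => e ∉ ({P.edge i x} : Finset E) ∧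
          G.src e ∈ X ∧ G.tgt e ∉ X).card : ℤ) ≤ c := by
  classical
  obtain ⟨tag, dedge, h1, h2⟩ := P.exists_detourTable
  have h3 : ∀ i x, ∃ lo hi tg, i < k → x < P.len i → lo ≤ x ∧ x < hi ∧ hi ≤ P.len i ∧
      tg ≤ P.len i ∧ P.edge i x ∉ P.updated tag dedge i lo hi tg ∧
      ∃ c : ℤ, IsFlowSet G s t (P.updated tag dedge i lo hi tg) c ∧
        ∃ X : Finset V, s ∈ X ∧ t ∉ X ∧ ((Finset.univ.filter fun e => e ∉ ({P.edge i x} : Finset E) ∧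
          G.src e ∈ X ∧ G.tgt e ∉ X).card : ℤ) ≤ c := by
    intro i x
    by_cases hfar : x < P.far i x
    · by_cases hi : i < k
      swap
      · exact ⟨0, 0, 0, fun h => absurd h hi⟩
      obtain ⟨a, hax, hst, hfa⟩ := P.exists_isStart hi hfar
      -- The segment bypassed by the detour contains the failing edge, since `a ≤ x < far i x`; the
      -- value stays `k`.
      refine ⟨a, P.far i x, a + 1, fun _ hx => ?_⟩
      have hlen := P.far_le_len i x
      obtain ⟨l, vert, arc, g1, g2, g3, g4, g5⟩ := h2 i a hst
      have hDE : (Finset.univ.filter fun e => ∃ w, dedge i w = some e ∧ tag i w = a + 1) =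
          (Finset.range l).image fun x => (arc x).1 := by
        ext e; simp [g5 e]
      refine ⟨hax, hfar, hlen, by omega, ?_, k, ?_, P.exists_min_cut hmax _⟩
      · rw [PathSystem.updated, hDE, Finset.mem_symmDiff]
        rintro (⟨h, -⟩ | ⟨h, -⟩)
        · refine (Finset.mem_sdiff.1 h).2 (Finset.mem_image_of_mem _ (Finset.mem_Ico.2 ⟨hax, hfar⟩))
        · obtain ⟨y, hy, he⟩ := Finset.mem_image.1 h
          have := (Finset.mem_filter.1 (g3 y (Finset.mem_range.1 hy)).1).2
          exact this (he ▸ PathSystem.mem_edges.2 ⟨x, hx, rfl⟩)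
      · intro v
        rw [PathSystem.updated, hDE, znet_flip_path (fun y hy => ⟨?_, (g3 y hy).2⟩) g4 v,
          znet_sdiff ((P.segment_subset hlen).trans (P.edges_subset_supp hi)),
          P.znet_segment hi (by omega) hlen, P.isFlowSet v, g1, g2, hfa]
        · ring
        · obtain ⟨c1, c2⟩ := Finset.mem_filter.1 (g3 y hy).1
          -- The detour avoids path `i`, so its arcs remain residual when the segment is removed.
          have c3 : (arc y).1 ∉ P.segment i a (P.far i x) := fun h => c2 (P.segment_subset hlen h)
          rw [mem_resArcs] at c1 ⊢
          rw [c1, Finset.mem_sdiff, and_iff_left c3]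
    -- Nothing behind the failing edge can be reached, so the whole path is dropped, without any
    -- detour.
    · refine ⟨0, P.len i, 0, fun hi hx => ⟨by omega, hx, le_rfl, by omega, ?_⟩⟩
      have hDE : (Finset.univ.filter fun e => ∃ w, dedge i w = some e ∧ tag i w = 0) = ∅ := by
        refine Finset.filter_eq_empty_iff.2 ?_
        rintro e - ⟨w, hw, h0⟩
        have := (h1 i w e hw).2.1
        omega
      have hseg : P.segment i 0 (P.len i) = P.edges i := by
        rw [PathSystem.segment, PathSystem.edges, Finset.range_eq_Ico]
      have hup : P.updated tag dedge i 0 (P.len i) 0 = P.supp \ P.edges i := by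
        rw [PathSystem.updated, hDE, hseg]
        ext e; simp [Finset.mem_symmDiff]
      rw [hup]
      have hfl : IsFlowSet G s t (P.supp \ P.edges i) (k - 1) := fun v => by
        rw [znet_sdiff (P.edges_subset_supp hi), P.isFlowSet v, znet_edges P hi]; ring
      -- The set reached off the path meets the path exactly in front of the failing edge; it will
      -- be the cut of capacity `k - 1`.
      have hpos : ∀ y ≤ P.len i, (P.vert i y ∈ P.offReach i x ↔ y ≤ x) := fun y hy =>
        ⟨fun h => by have := P.le_far hy h; omega, P.vert_mem_offReach⟩
      have hsX : s ∈ P.offReach i x := by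
        have := (hpos 0 (by omega)).2 (by omega)
        rwa [P.vert_zero i hi] at this
      have htX : t ∉ P.offReach i x := by
        intro h
        have := (hpos _ le_rfl).1 (by rwa [P.vert_len i hi])
        omega
      have hcl := closed_reach (tl := atl G) (hd := ahd G) (P.offArcs i) ((Finset.range (x + 1)).image (P.vert i))
      refine ⟨fun h => (Finset.mem_sdiff.1 h).2 (PathSystem.mem_edges.2 ⟨x, hx, rfl⟩), _, hfl, _,
        hsX, htX, hfl.card_le_of_saturated hsX htX ?_ ?_⟩
      · intro e heF hs ht
        by_contra he
        by_cases heP : e ∈ P.edges i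
        -- The only edge of the path that leaves this set is the failing one.
        · obtain ⟨y, hy, rfl⟩ := PathSystem.mem_edges.1 heP
          rw [P.src_edge i hi y hy, hpos y hy.le] at hs
          rw [P.tgt_edge i hi y hy, hpos _ hy] at ht
          exact heF (by rw [show y = x by omega]; simp)
        · refine ht (hcl (e, true) (Finset.mem_filter.2 ⟨?_, heP⟩) hs)
          simp only [Finset.mem_sdiff, heP, not_false_eq_true, and_true] at he
          simp [mem_resArcs, he]
      · intro e hs ht he
        obtain ⟨he1, he2⟩ := Finset.mem_sdiff.1 he
        exact hs (hcl (e, false) (Finset.mem_filter.2 ⟨by simp [mem_resArcs, he1], he2⟩) ht)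
  choose lo hi tg h4 using h3
  exact ⟨tag, dedge, lo, hi, tg, h1, fun i hi' x hx => h4 i x hi' hx⟩

end Detour

end FTFlow

/-! ### Perfect hashing -/

namespace FTFlow

/-- The hash function with multiplier `a`, modulus `p` and range `r`. -/
def hashFn (p r a x : ℕ) : ℕ := a * x % p % r

/-- The difference of the two residues is a positive multiple of `r` below `p`, and it determines
`a` because `x - y` is invertible modulo `p`. -/
theorem card_hash_collision_lt {p r x y : ℕ} (hp : p.Prime) (hx : x < p) (hy : y < p)
    (hxy : x ≠ y) :
    ((Finset.Ico 1 p).filter fun a => hashFn p r a x = hashFn p r a y ∧ a * y % p < a * x % p).card ≤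
      (p - 1) / r := by
  have hmem : ∀ a ∈ (Finset.Ico 1 p).filter (fun a => hashFn p r a x = hashFn p r a y ∧
      a * y % p < a * x % p), r * ((a * x % p - a * y % p) / r) = a * x % p - a * y % p := by
    intro a ha
    obtain ⟨-, h1, h2⟩ := Finset.mem_filter.1 ha
    exact Nat.mul_div_cancel' ((Nat.modEq_iff_dvd' h2.le).1 (Eq.symm h1))
  have : (p - 1) / r = (Finset.Icc 1 ((p - 1) / r)).card := by simp
  rw [this]
  refine Finset.card_le_card_of_injOn (fun a => (a * x % p - a * y % p) / r) (fun a ha => ?_)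
    fun a ha a' ha' h => ?_
  · have h0 := hmem a ha
    obtain ⟨-, h1, h2⟩ := Finset.mem_filter.1 ha
    have h3 : a * x % p < p := Nat.mod_lt _ hp.pos
    refine Finset.mem_coe.2 (Finset.mem_Icc.2 ⟨?_, Nat.div_le_div_right (by omega)⟩)
    rcases Nat.eq_zero_or_pos ((a * x % p - a * y % p) / r) with h | h
    · rw [h] at h0; omega
    · exact h
  · have h0 := hmem a ha
    have h0' := hmem a' ha'
    simp only at h
    rw [h, h0'] at h0
    obtain ⟨hI, -, h2⟩ := Finset.mem_filter.1 ha
    obtain ⟨hI', -, h2'⟩ := Finset.mem_filter.1 ha'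
    have h5 : a' * x % p + a * y % p = a * x % p + a' * y % p := by omega
    have : Fact p.Prime := ⟨hp⟩
    have h6 : ((a' * x + a * y : ℕ) : ZMod p) = ((a * x + a' * y : ℕ) : ZMod p) := by
      rw [ZMod.natCast_eq_natCast_iff', Nat.add_mod, h5, ← Nat.add_mod]
    push_cast at h6
    have h7 : ((a' : ZMod p) - a) * ((x : ZMod p) - y) = 0 := by linear_combination h6
    rw [Finset.mem_Ico] at hI hI'
    have hcast : ∀ u v : ℕ, u < p → v < p → (u : ZMod p) - v = 0 → u = v := by
      intro u v hu hv h
      have := (ZMod.natCast_eq_natCast_iff' u v p).1 (sub_eq_zero.1 h)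
      rwa [Nat.mod_eq_of_lt hu, Nat.mod_eq_of_lt hv] at this
    rcases mul_eq_zero.1 h7 with h8 | h8
    · exact (hcast a' a hI'.2 hI.2 h8).symm
    · exact absurd (hcast x y hx hy h8) hxy

/-- The residues of a colliding pair differ, since `a` is invertible modulo `p`; each of the two
orders is counted separately, hence the factor two. -/
theorem card_hash_collision {p r x y : ℕ} (hp : p.Prime) (hx : x < p) (hy : y < p)
    (hxy : x ≠ y) :
    ((Finset.Ico 1 p).filter fun a => hashFn p r a x = hashFn p r a y).card * r ≤ 2 * (p - 1) := by
  have hsub : ((Finset.Ico 1 p).filter fun a => hashFn p r a x = hashFn p r a y) ⊆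
      ((Finset.Ico 1 p).filter fun a => hashFn p r a x = hashFn p r a y ∧ a * y % p < a * x % p) ∪
      ((Finset.Ico 1 p).filter fun a => hashFn p r a y = hashFn p r a x ∧ a * x % p < a * y % p) := by
    intro a ha
    obtain ⟨h1, h2⟩ := Finset.mem_filter.1 ha
    rw [Finset.mem_Ico] at h1
    have hne : a * x % p ≠ a * y % p := by
      intro h
      have h' : a * x ≡ a * y [MOD p] := h
      have hc : p.gcd a = 1 := by
        rw [Nat.gcd_comm]
        exact Nat.Coprime.symm ((Nat.Prime.coprime_iff_not_dvd hp).2 fun hd =>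
          absurd (Nat.le_of_dvd (by omega) hd) (by omega))
      have := Nat.ModEq.cancel_left_of_coprime hc h'
      exact hxy (by rwa [Nat.ModEq, Nat.mod_eq_of_lt hx, Nat.mod_eq_of_lt hy] at this)
    rcases lt_or_gt_of_ne hne with h | h
    · exact Finset.mem_union_right _ (Finset.mem_filter.2 ⟨Finset.mem_Ico.2 h1, h2.symm, h⟩)
    · exact Finset.mem_union_left _ (Finset.mem_filter.2 ⟨Finset.mem_Ico.2 h1, h2, h⟩)
  have h1 := (Finset.card_le_card hsub).trans (Finset.card_union_le _ _)
  have h2 := card_hash_collision_lt (r := r) hp hx hy hxy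
  have h3 := card_hash_collision_lt (r := r) hp hy hx hxy.symm
  have h4 := Nat.div_mul_le_self (p - 1) r
  nlinarith

/-- Some multiplier causes few collisions. -/
theorem exists_hash_few_collisions {p r : ℕ} (hp : p.Prime) (K : Finset ℕ)
    (hK : ∀ x ∈ K, x < p) : ∃ a < p,
      (K.offDiag.filter fun q => hashFn p r a q.1 = hashFn p r a q.2).card * r ≤ 2 * K.offDiag.card := by
  have hp2 := hp.two_le
  by_contra! hcon
  have h1 : ∑ a ∈ Finset.Ico 1 p,
      (K.offDiag.filter fun q => hashFn p r a q.1 = hashFn p r a q.2).card * r ≤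
      K.offDiag.card * (2 * (p - 1)) := by
    rw [← Finset.sum_mul]
    simp only [Finset.card_filter]
    rw [Finset.sum_comm]
    simp only [← Finset.card_filter]
    rw [Finset.sum_mul, ← smul_eq_mul]
    refine Finset.sum_le_card_nsmul _ _ _ fun q hq => ?_
    obtain ⟨g1, g2, g3⟩ := Finset.mem_offDiag.1 hq
    exact card_hash_collision hp (hK _ g1) (hK _ g2) g3
  -- Averaging: if every multiplier were bad, the total would exceed the bound summed over pairs.
  have h2 : (Finset.Ico 1 p).card * (2 * K.offDiag.card + 1) ≤ ∑ a ∈ Finset.Ico 1 p,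
      (K.offDiag.filter fun q => hashFn p r a q.1 = hashFn p r a q.2).card * r := by
    rw [← smul_eq_mul]
    refine Finset.card_nsmul_le_sum _ _ _ fun a ha => hcon a (Finset.mem_Ico.1 ha).2
  rw [Nat.card_Ico] at h2
  have h3 : 0 < p - 1 := by omega
  nlinarith

/-- The cell of `x` in the two-level hash table. -/
def hashCell (p N a : ℕ) (a' r o : ℕ → ℕ) (x : ℕ) : ℕ :=
  o (hashFn p N a x) + hashFn p (r (hashFn p N a x)) (a' (hashFn p N a x)) x

/-- Two-level hashing. The first level is chosen with a linear number of collisions, so the squares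
of the bucket sizes sum up to a linear amount. A table of twice the square then lets each bucket be
hashed injectively. -/
theorem exists_perfectHash {m : ℕ} (K : Finset ℕ) (hK : ∀ x ∈ K, x < m) (hne : K.Nonempty) :
    ∃ (p a : ℕ) (a' r o : ℕ → ℕ), p ≤ 2 * m ∧ 0 < p ∧ a < p ∧ (∀ j, a' j < p) ∧
      (∀ j, j < K.card → o j + r j ≤ 6 * K.card) ∧
      (∀ x ∈ K, hashCell p K.card a a' r o x < 6 * K.card) ∧
      Set.InjOn (hashCell p K.card a a' r o) K := by
  classical
  obtain ⟨x0, hx0⟩ := hne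
  have hm : m ≠ 0 := by have := hK x0 hx0; omega
  obtain ⟨p, hp, hmp, hpm⟩ := Nat.exists_prime_lt_and_le_two_mul m hm
  have hKp : ∀ x ∈ K, x < p := fun x hx => (hK x hx).trans hmp
  have hN : 0 < K.card := Finset.card_pos.2 ⟨x0, hx0⟩
  obtain ⟨a, ha, hcoll⟩ := exists_hash_few_collisions (r := K.card) hp K hKp
  set N := K.card with hNdef
  let b : ℕ → Finset ℕ := fun j => K.filter fun x => hashFn p N a x = j
  let r : ℕ → ℕ := fun j => 2 * ((b j).card * (b j).card)
  have h2 : ∀ j, ∃ a' < p, Set.InjOn (hashFn p (r j) a') (b j) := by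
    intro j
    rcases (b j).eq_empty_or_nonempty with h | h
    · exact ⟨0, hp.pos, by simp [h]⟩
    · have hb := Finset.card_pos.2 h
      obtain ⟨a', ha', hc⟩ := exists_hash_few_collisions (r := r j) hp (b j)
        fun x hx => hKp x (Finset.mem_filter.1 hx).1
      refine ⟨a', ha', fun x hx y hy hxy => ?_⟩
      -- One collision counted `r j` times would already exceed the bound, which is less than `r j`.
      by_contra hne'
      have h3 : 1 ≤ ((b j).offDiag.filter fun q => hashFn p (r j) a' q.1 = hashFn p (r j) a' q.2).card :=
        Finset.card_pos.2 ⟨(x, y), Finset.mem_filter.2 ⟨Finset.mem_offDiag.2 ⟨hx, hy, hne'⟩, hxy⟩⟩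
      rw [Finset.offDiag_card] at hc
      have h4 : r j ≤ 2 * ((b j).card * (b j).card - (b j).card) :=
        (Nat.le_mul_of_pos_left _ h3).trans hc
      have h5 : (b j).card ≤ (b j).card * (b j).card := Nat.le_mul_self _
      simp only [r] at h4
      omega
  choose a' ha' hinj using h2
  let o : ℕ → ℕ := fun j => ∑ i ∈ Finset.range j, r i
  -- Pairs in a common bucket: at most `2 * N` off the diagonal and `N` on it, doubled by the table
  -- size.
  have hsum : ∑ j ∈ Finset.range N, r j ≤ 6 * N := by
    have h3 : ∑ j ∈ Finset.range N, (b j).card * (b j).card =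
        ((K ×ˢ K).filter fun q => hashFn p N a q.1 = hashFn p N a q.2).card := by
      rw [Finset.card_eq_sum_card_fiberwise (f := fun q : ℕ × ℕ => hashFn p N a q.1) (t := Finset.range N)
        (fun q _ => Finset.mem_coe.2 (Finset.mem_range.2 (Nat.mod_lt _ hN)))]
      refine Finset.sum_congr rfl fun j _ => ?_
      rw [← Finset.card_product]
      congr 1
      ext ⟨x, y⟩
      simp only [b, Finset.mem_product, Finset.mem_filter]
      constructor
      · rintro ⟨⟨h1, h2⟩, h3, h4⟩
        exact ⟨⟨⟨h1, h3⟩, h2.trans h4.symm⟩, h2⟩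
      · rintro ⟨⟨⟨h1, h3⟩, h4⟩, h2⟩
        exact ⟨⟨h1, h2⟩, h3, h4 ▸ h2⟩
    have h4 : ((K ×ˢ K).filter fun q => hashFn p N a q.1 = hashFn p N a q.2).card ≤
        (K.offDiag.filter fun q => hashFn p N a q.1 = hashFn p N a q.2).card + K.card := by
      have : ((K ×ˢ K).filter fun q => hashFn p N a q.1 = hashFn p N a q.2) ⊆
          (K.offDiag.filter fun q => hashFn p N a q.1 = hashFn p N a q.2) ∪ K.diag := by
        rintro ⟨x, y⟩ h
        simp only [Finset.mem_filter, Finset.mem_product, Finset.mem_union, Finset.mem_offDiag,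
          Finset.mem_diag] at h ⊢
        by_cases hxy : x = y
        · exact .inr ⟨h.1.1, hxy⟩
        · exact .inl ⟨⟨h.1.1, h.1.2, hxy⟩, h.2⟩
      have h5 := (Finset.card_le_card this).trans (Finset.card_union_le _ _)
      rwa [Finset.diag_card] at h5
    rw [Finset.offDiag_card] at hcoll
    have h5 : (K.offDiag.filter fun q => hashFn p N a q.1 = hashFn p N a q.2).card ≤ 2 * N := by
      have : N * N - N ≤ N * N := Nat.sub_le _ _
      have h6 : (K.offDiag.filter fun q => hashFn p N a q.1 = hashFn p N a q.2).card * N ≤ 2 * N * N := by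
        calc _ ≤ 2 * (N * N - N) := hcoll
          _ ≤ 2 * N * N := by rw [mul_assoc]; exact Nat.mul_le_mul_left 2 this
      exact Nat.le_of_mul_le_mul_right h6 hN
    simp only [r]
    rw [← Finset.mul_sum, h3]
    omega
  have hor : ∀ j i, j < i → o j + r j ≤ o i := by
    intro j i hji
    have : o j + r j = o (j + 1) := (Finset.sum_range_succ _ _).symm
    rw [this]
    exact Finset.sum_le_sum_of_subset (Finset.range_mono hji)
  have hcell : ∀ x ∈ K, o (hashFn p N a x) ≤ hashCell p N a a' r o x ∧
      hashCell p N a a' r o x < o (hashFn p N a x) + r (hashFn p N a x) := by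
    intro x hx
    refine ⟨Nat.le_add_right _ _, Nat.add_lt_add_left (Nat.mod_lt _ ?_) _⟩
    have : 0 < (b (hashFn p N a x)).card := Finset.card_pos.2 ⟨x, Finset.mem_filter.2 ⟨hx, rfl⟩⟩
    positivity
  refine ⟨p, a, a', r, o, hpm, hp.pos, ha, ha', fun j hj => (hor j N hj).trans hsum, fun x hx => ?_,
    fun x hx y hy hxy => ?_⟩
  · exact (hcell x hx).2.trans_le ((hor _ N (Nat.mod_lt _ hN)).trans hsum)
  · have h3 := hcell x hx
    have h4 := hcell y hy
    rcases lt_trichotomy (hashFn p N a x) (hashFn p N a y) with h | h | h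
    · have := hor _ _ h; omega
    · refine hinj (hashFn p N a x) (Finset.mem_coe.2 (Finset.mem_filter.2 ⟨hx, rfl⟩))
        (Finset.mem_coe.2 (Finset.mem_filter.2 ⟨hy, h.symm⟩)) ?_
      simp only [hashCell, ← h] at hxy
      exact Nat.add_left_cancel hxy
    · have := hor _ _ h; omega

end FTFlow

/-! ### A structured language for the word RAM -/

namespace FTFlow

open WordRAM

/-- Expressions. The variables are the registers below 32; the data structure is read as a table with
32 columns, and the working memory as one with 4 columns. -/
inductive Exp
  | var (i : Fin 32)
  | const (a : ℕ)
  | bin (o : Op) (a b : Exp)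
  | dat (c : ℕ) (e : Exp)
  | mem (c : Fin 4) (e : Exp)

instance : Add Exp := ⟨.bin .add⟩
instance : Sub Exp := ⟨.bin .sub⟩
instance : Mul Exp := ⟨.bin .mul⟩
instance : Mod Exp := ⟨.bin .mod⟩

/-- The variables, the columns of the working memory, and the output. -/
@[ext]
structure St where
  v : Fin 32 → ℕ
  m : Fin 4 → ℕ → ℕ
  out : List ℕ

/-- The result of an operation on unbounded numbers. -/
def opIdeal : Op → ℕ → ℕ → ℕ
  | .add, a, b => a + b
  | .sub, a, b => a - b
  | .mul, a, b => a * b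
  | .div, a, b => a / b
  | .mod, a, b => a % b

/-- Entry `q` of column `c` of the data structure. -/
def datCol (L : List ℕ) (c q : ℕ) : ℕ := L.getD (32 * q + c) 0

/-- The value of an expression without overflow. -/
def Exp.ev (L : List ℕ) (σ : St) : Exp → ℕ
  | .var i => σ.v i
  | .const a => a
  | .bin o a b => opIdeal o (a.ev L σ) (b.ev L σ)
  | .dat c e => datCol L c (e.ev L σ)
  | .mem c e => σ.m c (e.ev L σ)

/-- No overflow occurs. -/
def Exp.ok (w : ℕ) (L : List ℕ) (σ : St) : Exp → Prop
  | .var _ => True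
  | .const a => a < 2 ^ w
  | .bin o a b => a.ok w L σ ∧ b.ok w L σ ∧ opIdeal o (a.ev L σ) (b.ev L σ) < 2 ^ w
  | .dat c e => e.ok w L σ ∧ 32 * e.ev L σ + c < 2 ^ w
  | .mem c e => e.ok w L σ ∧ 4 * e.ev L σ + c.val < 2 ^ w

/-- The number of instructions of an expression. -/
def Exp.size : Exp → ℕ
  | .var _ => 2
  | .const _ => 1
  | .bin _ a b => a.size + b.size + 1
  | .dat _ e => e.size + 5
  | .mem _ e => e.size + 5

/-- Compilation; the value ends up in register `32 + d`. -/
def Exp.comp : Exp → ℕ → List Instr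
  -- There is no instruction that copies a register, so zero is added.
  | .var i, d => [.const (33 + d) 0, .arith .add (32 + d) i (33 + d)]
  | .const a, d => [.const (32 + d) a]
  | .bin o a b, d => a.comp d ++ (b.comp (d + 1) ++ [.arith o (32 + d) (32 + d) (33 + d)])
  | .dat c e, d => e.comp d ++ [.const (33 + d) 32, .arith .mul (32 + d) (33 + d) (32 + d),
      .const (33 + d) c, .arith .add (32 + d) (32 + d) (33 + d), .read (32 + d) (32 + d)]
  | .mem c e, d => e.comp d ++ [.const (33 + d) 4, .arith .mul (32 + d) (33 + d) (32 + d),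
      .const (33 + d) c, .arith .add (32 + d) (32 + d) (33 + d), .load (32 + d) (32 + d)]

theorem Exp.length_comp (e : Exp) (d : ℕ) : (e.comp d).length = e.size := by
  induction e generalizing d with
  | var i => rfl
  | const a => rfl
  | bin o a b iha ihb => simp [Exp.comp, Exp.size, iha, ihb, add_assoc]
  | dat c e ih => simp [Exp.comp, Exp.size, ih]
  | mem c e ih => simp [Exp.comp, Exp.size, ih]

/-- Commands. -/
inductive Cmd
  | skip
  | assign (i : Fin 32) (e : Exp)
  | store (c : Fin 4) (a e : Exp)
  | emit (e : Exp)
  | seq (c₁ c₂ : Cmd)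
  | ite (a b : Exp) (c₁ c₂ : Cmd)
  | loop (a b : Exp) (c : Cmd)

/-- The number of instructions of a command. -/
def Cmd.size : Cmd → ℕ
  | .skip => 0
  | .assign _ e => e.size + 2
  | .store _ a e => a.size + e.size + 5
  | .emit e => e.size + 1
  | .seq c₁ c₂ => c₁.size + c₂.size
  | .ite a b c₁ c₂ => a.size + b.size + c₁.size + c₂.size + 4
  | .loop a b c => a.size + b.size + c.size + 7

/-- An unconditional jump. -/
def jumpTo (l : ℕ) : List Instr := [.const 32 0, .const 33 1, .jumpLt 32 33 l]

/-- Compilation of a command that is placed at instruction number `p`. -/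
def Cmd.comp : Cmd → ℕ → List Instr
  | .skip, _ => []
  | .assign i e, _ => e.comp 0 ++ [.const 33 0, .arith .add i 32 33]
  | .store c a e, _ => a.comp 0 ++ ([.const 33 4, .arith .mul 32 33 32, .const 33 c,
      .arith .add 32 32 33] ++ (e.comp 1 ++ [.store 32 33]))
  | .emit e, _ => e.comp 0 ++ [.emit 32]
  | .seq c₁ c₂, p => c₁.comp p ++ c₂.comp (p + c₁.size)
  -- The second branch comes first: the comparison jumps over it if it succeeds.
  | .ite a b c₁ c₂, p => a.comp 0 ++ (b.comp 1 ++
      ([.jumpLt 32 33 (p + a.size + b.size + c₂.size + 4)] ++ (c₂.comp (p + a.size + b.size + 1) ++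
        (jumpTo (p + a.size + b.size + c₁.size + c₂.size + 4) ++
          c₁.comp (p + a.size + b.size + c₂.size + 4)))))
  | .loop a b c, p => a.comp 0 ++ (b.comp 1 ++
      ([.jumpLt 32 33 (p + a.size + b.size + 4)] ++ (jumpTo (p + a.size + b.size + c.size + 7) ++
        (c.comp (p + a.size + b.size + 4) ++ jumpTo p))))

theorem Cmd.length_comp (c : Cmd) (p : ℕ) : (c.comp p).length = c.size := by
  induction c generalizing p with
  | skip => rfl
  | assign i e => simp [Cmd.comp, Cmd.size, Exp.length_comp]
  | store c a e => simp [Cmd.comp, Cmd.size, Exp.length_comp]; omega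
  | emit e => simp [Cmd.comp, Cmd.size, Exp.length_comp]
  | seq c₁ c₂ h₁ h₂ => simp [Cmd.comp, Cmd.size, h₁, h₂]
  | ite a b c₁ c₂ h₁ h₂ => simp [Cmd.comp, Cmd.size, Exp.length_comp, h₁, h₂, jumpTo]; omega
  | loop a b c h => simp [Cmd.comp, Cmd.size, Exp.length_comp, h, jumpTo]; omega

/-- Set a variable. -/
def St.set (σ : St) (i : Fin 32) (x : ℕ) : St := { σ with v := fun j => if j = i then x else σ.v j }

/-- Write to the working memory. -/
def St.put (σ : St) (c : Fin 4) (a x : ℕ) : St :=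
  { σ with m := fun c' a' => if c' = c ∧ a' = a then x else σ.m c' a' }

/-- Append to the output. -/
def St.app (σ : St) (x : ℕ) : St := { σ with out := σ.out ++ [x] }

/-- Command `c` takes the state `σ` to `σ'` in exactly `k` machine steps, without overflow. -/
inductive Big (w : ℕ) (L : List ℕ) : Cmd → St → St → ℕ → Prop
  | skip (σ) : Big w L .skip σ σ 0
  | assign (σ i) (e : Exp) : e.ok w L σ → Big w L (.assign i e) σ (σ.set i (e.ev L σ)) (e.size + 2)
  | store (σ c) (a e : Exp) : a.ok w L σ → e.ok w L σ → 4 * a.ev L σ + c.val < 2 ^ w →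
      Big w L (.store c a e) σ (σ.put c (a.ev L σ) (e.ev L σ)) (a.size + e.size + 5)
  | emit (σ) (e : Exp) : e.ok w L σ → Big w L (.emit e) σ (σ.app (e.ev L σ)) (e.size + 1)
  | seq {c₁ c₂ σ σ₁ σ₂ k₁ k₂} : Big w L c₁ σ σ₁ k₁ → Big w L c₂ σ₁ σ₂ k₂ →
      Big w L (.seq c₁ c₂) σ σ₂ (k₁ + k₂)
  | ite_true {a b : Exp} {c₁ c₂ σ σ' k} : a.ok w L σ → b.ok w L σ → a.ev L σ < b.ev L σ →
      Big w L c₁ σ σ' k → Big w L (.ite a b c₁ c₂) σ σ' (a.size + b.size + 1 + k)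
  | ite_false {a b : Exp} {c₁ c₂ σ σ' k} : a.ok w L σ → b.ok w L σ → ¬ a.ev L σ < b.ev L σ →
      Big w L c₂ σ σ' k → Big w L (.ite a b c₁ c₂) σ σ' (a.size + b.size + 4 + k)
  | loop_true {a b : Exp} {c σ σ₁ σ₂ k₁ k₂} : a.ok w L σ → b.ok w L σ → a.ev L σ < b.ev L σ →
      Big w L c σ σ₁ k₁ → Big w L (.loop a b c) σ₁ σ₂ k₂ →
      Big w L (.loop a b c) σ σ₂ (a.size + b.size + 4 + k₁ + k₂)
  | loop_false {a b : Exp} {c σ} : a.ok w L σ → b.ok w L σ → ¬ a.ev L σ < b.ev L σ →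
      Big w L (.loop a b c) σ σ (a.size + b.size + 4)

/-- The list of instructions `l` stands in the program at position `p`. -/
def At (P : Program) (p : ℕ) (l : List Instr) : Prop := ∀ j < l.length, P[p + j]? = l[j]?

theorem At.append {P : Program} {p : ℕ} {l₁ l₂ : List Instr} (h : At P p (l₁ ++ l₂)) :
    At P p l₁ ∧ At P (p + l₁.length) l₂ := by
  constructor
  · intro j hj
    rw [h j (by simp; omega), List.getElem?_append_left hj]
  · intro j hj
    have := h (l₁.length + j) (by simp; omega)
    rw [add_assoc, this, List.getElem?_append_right (by omega)]
    simp

theorem At.head {P : Program} {p : ℕ} {c : Instr} {l : List Instr} (h : At P p (c :: l)) :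
    P[p]? = some c ∧ At P (p + 1) l := by
  constructor
  · simpa using h 0 (by simp)
  · intro j hj
    have := h (j + 1) (by simp; omega)
    rw [show p + 1 + j = p + (j + 1) by ring, this]
    simp

theorem At.cast {P : Program} {p p' : ℕ} {l l' : List Instr} (h : At P p l) (hp : p = p') (hl : l = l') :
    At P p' l' := by
  subst hp hl; exact h

section Machine

variable {P : Program} {w : ℕ} {L : List ℕ}

theorem step_of_at {κ : Config} {c : Instr} {p : ℕ} (hp : κ.pc = p) (h : P[p]? = some c) :
    step P w L κ = exec w L κ c := by
  subst hp; simp [step, h]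

theorem iterate_step {κ : Config} {c : Instr} {p N : ℕ} (hp : κ.pc = p) (h : P[p]? = some c) :
    (step P w L)^[N + 1] κ = (step P w L)^[N] (exec w L κ c) := by
  rw [Function.iterate_succ_apply, step_of_at hp h]

/-- The bounds on the contents of a state that the machine maintains. -/
def St.Bd (w : ℕ) (σ : St) : Prop := (∀ i, σ.v i < 2 ^ w) ∧ ∀ c a, σ.m c a < 2 ^ w

/-- The machine configuration `κ` represents the state `σ`. -/
def Rep (σ : St) (κ : Config) : Prop :=
  (∀ i : Fin 32, κ.reg i = σ.v i) ∧ (∀ (c : Fin 4) (a : ℕ), κ.mem (4 * a + c) = σ.m c a) ∧ κ.out = σ.out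

theorem Exp.ev_lt {σ : St} (hσ : σ.Bd w) (hL : ∀ x ∈ L, x < 2 ^ w) {e : Exp} (he : e.ok w L σ) :
    e.ev L σ < 2 ^ w := by
  cases e with
  | var i => exact hσ.1 i
  | const a => exact he
  | bin o a b => exact he.2.2
  | dat c e =>
    simp only [Exp.ev, datCol]
    rw [List.getD_eq_getElem?_getD]
    by_cases h : 32 * e.ev L σ + c < L.length
    · simpa [h] using hL _ (List.getElem_mem h)
    · simp [h]
  | mem c e => exact hσ.2 _ _

theorem opEval_eq {o : Op} {a b : ℕ} (h : opIdeal o a b < 2 ^ w) : o.eval w a b = opIdeal o a b := by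
  cases o <;> exact Nat.mod_eq_of_lt h

/-- The registers from `32 + d` on serve as an evaluation stack. Those below keep their contents, in
particular all variables and pending intermediate results. -/
theorem Exp.run_comp (hw : 6 ≤ w) {σ : St} (hσ : σ.Bd w) (e : Exp) :
    ∀ (d : ℕ) (κ : Config), Rep σ κ → e.ok w L σ → At P κ.pc (e.comp d) →
      ∃ reg : ℕ → ℕ, (step P w L)^[e.size] κ = { κ with pc := κ.pc + e.size, reg := reg } ∧
        reg (32 + d) = e.ev L σ ∧ ∀ r < 32 + d, reg r = κ.reg r := by
  have h64 : 64 ≤ 2 ^ w := by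
    calc 64 = 2 ^ 6 := by norm_num
      _ ≤ 2 ^ w := Nat.pow_le_pow_right (by norm_num) hw
  induction e with
  | var i =>
    intro d κ hκ _ hat
    obtain ⟨h1, h2⟩ := hat.head
    obtain ⟨h3, -⟩ := h2.head
    refine ⟨Function.update (Function.update κ.reg (33 + d) (0 % 2 ^ w)) (32 + d) (Op.add.eval w
      (Function.update κ.reg (33 + d) (0 % 2 ^ w) i)
      (Function.update κ.reg (33 + d) (0 % 2 ^ w) (33 + d))), ?_, ?_, ?_⟩
    · rw [show Exp.size (.var i) = 0 + 1 + 1 from rfl, iterate_step rfl h1, iterate_step (by rfl) h3]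
      rfl
    · have := hκ.1 i
      have h4 := hσ.1 i
      have h5 : (i : ℕ) ≠ 33 + d := by omega
      simp [Exp.ev, Op.eval, h5, this, Nat.mod_eq_of_lt h4]
    · intro r hr
      simp [show r ≠ 32 + d by omega, show r ≠ 33 + d by omega]
  | const a =>
    intro d κ hκ hok hat
    obtain ⟨h1, -⟩ := hat.head
    refine ⟨Function.update κ.reg (32 + d) (a % 2 ^ w), ?_, ?_, ?_⟩
    · rw [show Exp.size (.const a) = 0 + 1 from rfl, iterate_step rfl h1]
      rfl
    · simpa [Exp.ev] using Nat.mod_eq_of_lt hok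
    · intro r hr
      simp [show r ≠ 32 + d by omega]
  | bin o a b iha ihb =>
    intro d κ hκ hok hat
    obtain ⟨ha, hb, hlt⟩ := hok
    obtain ⟨h1, h2⟩ := hat.append
    rw [Exp.length_comp] at h2
    obtain ⟨h3, h4⟩ := h2.append
    rw [Exp.length_comp] at h4
    obtain ⟨h5, -⟩ := h4.head
    obtain ⟨ra, ra1, ra2, ra3⟩ := iha d κ hκ ha h1
    obtain ⟨rb, rb1, rb2, rb3⟩ := ihb (d + 1) { κ with pc := κ.pc + a.size, reg := ra }
      ⟨fun i => by rw [← hκ.1 i]; exact ra3 i (by omega), hκ.2⟩ hb h3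
    refine ⟨Function.update rb (32 + d) (opIdeal o (a.ev L σ) (b.ev L σ)), ?_, ?_, ?_⟩
    · rw [show Exp.size (.bin o a b) = 1 + (b.size + a.size) by simp [Exp.size]; omega,
        Function.iterate_add_apply, Function.iterate_add_apply, ra1, rb1, Function.iterate_one,
        step_of_at rfl h5]
      have h6 : rb (32 + d) = a.ev L σ := by rw [rb3 _ (by omega)]; exact ra2
      have h7 : rb (33 + d) = b.ev L σ := by rw [← rb2]; congr 1; omega
      simp only [exec, h6, h7, opEval_eq hlt, Config.mk.injEq, and_self, and_true]
      omega
    · simp [Exp.ev]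
    · intro r hr
      simp only [Function.update_apply, show r ≠ 32 + d by omega, if_false]
      rw [rb3 r (by omega), ← ra3 r hr]
  | dat c e ih =>
    intro d κ hκ hok hat
    obtain ⟨he, hlt⟩ := hok
    obtain ⟨h1, h2⟩ := hat.append
    rw [Exp.length_comp] at h2
    obtain ⟨g1, h2⟩ := h2.head
    obtain ⟨g2, h2⟩ := h2.head
    obtain ⟨g3, h2⟩ := h2.head
    obtain ⟨g4, h2⟩ := h2.head
    obtain ⟨g5, -⟩ := h2.head
    obtain ⟨ra, ra1, ra2, ra3⟩ := ih d κ hκ he h1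
    refine ⟨(exec w L (exec w L (exec w L (exec w L (exec w L { κ with pc := κ.pc + e.size, reg := ra }
      (.const (33 + d) 32)) (.arith .mul (32 + d) (33 + d) (32 + d))) (.const (33 + d) c))
      (.arith .add (32 + d) (32 + d) (33 + d))) (.read (32 + d) (32 + d))).reg, ?_, ?_, ?_⟩
    · rw [show Exp.size (.dat c e) = 5 + e.size by simp [Exp.size]; omega,
        Function.iterate_add_apply, ra1]
      rw [show 5 = 0 + 1 + 1 + 1 + 1 + 1 from rfl, iterate_step (by rfl) g1, iterate_step (by rfl) g2,
        iterate_step (by rfl) g3, iterate_step (by rfl) g4, iterate_step (by rfl) g5,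
        Function.iterate_zero_apply]
      simp only [exec, Config.mk.injEq, and_true]
      omega
    · have h6 : (32 * e.ev L σ) % 2 ^ w = 32 * e.ev L σ := Nat.mod_eq_of_lt (by omega)
      simp [exec, Exp.ev, Op.eval, ra2, datCol, Nat.mod_eq_of_lt (show 32 < 2 ^ w by omega),
        h6, Nat.mod_eq_of_lt hlt]
    · intro r hr
      simp [exec, show r ≠ 32 + d by omega, show r ≠ 33 + d by omega, ra3 r hr]
  | mem c e ih =>
    intro d κ hκ hok hat
    obtain ⟨he, hlt⟩ := hok
    obtain ⟨h1, h2⟩ := hat.append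
    rw [Exp.length_comp] at h2
    obtain ⟨g1, h2⟩ := h2.head
    obtain ⟨g2, h2⟩ := h2.head
    obtain ⟨g3, h2⟩ := h2.head
    obtain ⟨g4, h2⟩ := h2.head
    obtain ⟨g5, -⟩ := h2.head
    obtain ⟨ra, ra1, ra2, ra3⟩ := ih d κ hκ he h1
    refine ⟨(exec w L (exec w L (exec w L (exec w L (exec w L { κ with pc := κ.pc + e.size, reg := ra }
      (.const (33 + d) 4)) (.arith .mul (32 + d) (33 + d) (32 + d))) (.const (33 + d) c))
      (.arith .add (32 + d) (32 + d) (33 + d))) (.load (32 + d) (32 + d))).reg, ?_, ?_, ?_⟩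
    · rw [show Exp.size (.mem c e) = 5 + e.size by simp [Exp.size]; omega,
        Function.iterate_add_apply, ra1]
      rw [show 5 = 0 + 1 + 1 + 1 + 1 + 1 from rfl, iterate_step (by rfl) g1, iterate_step (by rfl) g2,
        iterate_step (by rfl) g3, iterate_step (by rfl) g4, iterate_step (by rfl) g5,
        Function.iterate_zero_apply]
      simp only [exec, Config.mk.injEq, and_true]
      omega
    · have h6 : (4 * e.ev L σ) % 2 ^ w = 4 * e.ev L σ := Nat.mod_eq_of_lt (by omega)
      have h7 := hκ.2.1 c (e.ev L σ)
      simp [exec, Exp.ev, Op.eval, ra2, Nat.mod_eq_of_lt (show 4 < 2 ^ w by omega),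
        h6, Nat.mod_eq_of_lt hlt, h7]
    · intro r hr
      simp [exec, show r ≠ 32 + d by omega, show r ≠ 33 + d by omega, ra3 r hr]

theorem run_jumpTo (hw : 6 ≤ w) {κ : Config} {l : ℕ} (hat : At P κ.pc (jumpTo l)) :
    ∃ reg : ℕ → ℕ, (step P w L)^[3] κ = { κ with pc := l, reg := reg } ∧ ∀ r < 32, reg r = κ.reg r := by
  have h64 : 64 ≤ 2 ^ w := by
    calc 64 = 2 ^ 6 := by norm_num
      _ ≤ 2 ^ w := Nat.pow_le_pow_right (by norm_num) hw
  obtain ⟨g1, h2⟩ := hat.head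
  obtain ⟨g2, h2⟩ := h2.head
  obtain ⟨g3, -⟩ := h2.head
  refine ⟨Function.update (Function.update κ.reg 32 0) 33 1, ?_, ?_⟩
  · rw [show 3 = 0 + 1 + 1 + 1 from rfl, iterate_step rfl g1, iterate_step (by rfl) g2,
      iterate_step (by rfl) g3, Function.iterate_zero_apply]
    simp [exec, Nat.mod_eq_of_lt (show 1 < 2 ^ w by omega)]
  · intro r hr
    simp [show r ≠ 32 by omega, show r ≠ 33 by omega]

theorem Rep.of_reg {σ : St} {κ : Config} (h : Rep σ κ) {pc : ℕ} {reg : ℕ → ℕ}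
    (hr : ∀ r < 32, reg r = κ.reg r) : Rep σ { κ with pc := pc, reg := reg } :=
  ⟨fun i => (hr i i.2).trans (h.1 i), h.2⟩

/-- The evaluation of the two sides of a comparison. -/
theorem run_cond (hw : 6 ≤ w) {σ : St} (hσ : σ.Bd w) {a b : Exp}
    {κ : Config} (hκ : Rep σ κ) (ha : a.ok w L σ) (hb : b.ok w L σ) {l : ℕ} {rest : List Instr}
    (hat : At P κ.pc (a.comp 0 ++ (b.comp 1 ++ ([.jumpLt 32 33 l] ++ rest)))) :
    ∃ reg : ℕ → ℕ, (step P w L)^[a.size + b.size + 1] κ = { κ with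
        pc := if a.ev L σ < b.ev L σ then l else κ.pc + (a.size + b.size + 1), reg := reg } ∧
      ∀ r < 32, reg r = κ.reg r := by
  obtain ⟨h1, h2⟩ := hat.append
  rw [Exp.length_comp] at h2
  obtain ⟨h3, h4⟩ := h2.append
  rw [Exp.length_comp] at h4
  obtain ⟨h5, -⟩ := h4.head
  obtain ⟨ra, ra1, ra2, ra3⟩ := a.run_comp hw hσ 0 κ hκ ha h1
  obtain ⟨rb, rb1, rb2, rb3⟩ := b.run_comp hw hσ 1 { κ with pc := κ.pc + a.size, reg := ra }
    (hκ.of_reg fun r hr => ra3 r hr) hb h3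
  refine ⟨rb, ?_, fun r hr => by rw [rb3 r (by omega), ← ra3 r hr]⟩
  rw [show a.size + b.size + 1 = 1 + (b.size + a.size) by omega, Function.iterate_add_apply,
    Function.iterate_add_apply, ra1, rb1, Function.iterate_one, step_of_at rfl h5]
  have h6 : rb 32 = a.ev L σ := by rw [rb3 _ (by omega)]; exact ra2
  have h7 : rb 33 = b.ev L σ := rb2
  simp only [exec, h6, h7, Config.mk.injEq, and_self, and_true]
  split_ifs <;> omega

/-- Induction on the derivation. All contents of the state stay below `2 ^ w`, so copying through
the arithmetic of the machine, which reduces modulo `2 ^ w`, is exact. -/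
theorem Big.run (hw : 6 ≤ w) (hL : ∀ x ∈ L, x < 2 ^ w) {c : Cmd} {σ σ' : St} {k : ℕ}
    (h : Big w L c σ σ' k) : σ.Bd w → ∀ κ : Config, Rep σ κ → At P κ.pc (c.comp κ.pc) →
      σ'.Bd w ∧ ∃ κ' : Config, (step P w L)^[k] κ = κ' ∧ Rep σ' κ' ∧ κ'.pc = κ.pc + c.size := by
  have h64 : 64 ≤ 2 ^ w := by
    calc 64 = 2 ^ 6 := by norm_num
      _ ≤ 2 ^ w := Nat.pow_le_pow_right (by norm_num) hw
  induction h with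
  | skip σ => exact fun hσ κ hκ _ => ⟨hσ, κ, rfl, hκ, rfl⟩
  | assign σ i e he =>
    intro hσ κ hκ hat
    obtain ⟨h1, h2⟩ := At.append hat
    rw [Exp.length_comp] at h2
    obtain ⟨h3, h4⟩ := h2.head
    obtain ⟨h5, -⟩ := h4.head
    obtain ⟨ra, ra1, ra2, ra3⟩ := e.run_comp hw hσ 0 κ hκ he h1
    have hlt := Exp.ev_lt hσ hL he
    refine ⟨⟨fun j => ?_, hσ.2⟩, _, rfl, ?_⟩
    · simp only [St.set]; split_ifs
      · exact hlt
      · exact hσ.1 j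
    rw [add_comm e.size, Function.iterate_add_apply, ra1]
    rw [show 2 = 0 + 1 + 1 from rfl, iterate_step (by rfl) h3, iterate_step (by rfl) h5,
      Function.iterate_zero_apply]
    refine ⟨⟨fun j => ?_, hκ.2⟩, by simp [exec, Cmd.size]; omega⟩
    have ra2' : ra 32 = e.ev L σ := ra2
    by_cases hj : j = i
    · subst hj
      simp [exec, St.set, Op.eval, ra2', Nat.mod_eq_of_lt hlt]
    · have hj' : (j : ℕ) ≠ i := fun h => hj (Fin.ext h)
      simp [exec, St.set, hj, hj', show (j : ℕ) ≠ 33 by omega, ra3 j (by omega), hκ.1 j]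
  | store σ c a e ha he hlt =>
    intro hσ κ hκ hat
    obtain ⟨h1, h2⟩ := At.append hat
    rw [Exp.length_comp] at h2
    obtain ⟨h3, h4⟩ := h2.append
    obtain ⟨g1, h3⟩ := h3.head
    obtain ⟨g2, h3⟩ := h3.head
    obtain ⟨g3, h3⟩ := h3.head
    obtain ⟨g4, -⟩ := h3.head
    obtain ⟨h5, h6⟩ := h4.append
    rw [Exp.length_comp] at h6
    obtain ⟨g5, -⟩ := h6.head
    obtain ⟨ra, ra1, ra2, ra3⟩ := a.run_comp hw hσ 0 κ hκ ha h1
    have ra2' : ra 32 = a.ev L σ := ra2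
    have hmul : (4 * a.ev L σ) % 2 ^ w = 4 * a.ev L σ := Nat.mod_eq_of_lt (by omega)
    have hmid : ∃ reg : ℕ → ℕ, (step P w L)^[4] { κ with pc := κ.pc + a.size, reg := ra } =
        { κ with pc := κ.pc + a.size + 4, reg := reg } ∧ reg 32 = 4 * a.ev L σ + c ∧
        ∀ r < 32, reg r = ra r := by
      refine ⟨(exec w L (exec w L (exec w L (exec w L { κ with pc := κ.pc + a.size, reg := ra }
        (.const 33 4)) (.arith .mul 32 33 32)) (.const 33 c)) (.arith .add 32 32 33)).reg, ?_, ?_, ?_⟩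
      · rw [iterate_step (N := 3) (by rfl) g1, iterate_step (N := 2) (by rfl) g2,
          iterate_step (N := 1) (by rfl) g3, iterate_step (N := 0) (by rfl) g4,
          Function.iterate_zero_apply]
        rfl
      · simp [exec, Op.eval, ra2', Nat.mod_eq_of_lt (show 4 < 2 ^ w by omega), hmul, Nat.mod_eq_of_lt hlt]
      · intro r hr
        simp [exec, show r ≠ 32 by omega, show r ≠ 33 by omega]
    obtain ⟨rm, rm1, rm2, rm3⟩ := hmid
    obtain ⟨rb, rb1, rb2, rb3⟩ := e.run_comp hw hσ 1 { κ with pc := κ.pc + a.size + 4, reg := rm }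
      (hκ.of_reg fun r hr => by rw [rm3 r hr, ra3 r hr]) he h5
    have hev := Exp.ev_lt hσ hL he
    refine ⟨⟨hσ.1, fun c' a' => ?_⟩, _, rfl, ?_⟩
    · simp only [St.put]; split_ifs
      · exact hev
      · exact hσ.2 _ _
    rw [show a.size + e.size + 5 = 1 + (e.size + (4 + a.size)) by omega, Function.iterate_add_apply,
      Function.iterate_add_apply, Function.iterate_add_apply, ra1, rm1, rb1, Function.iterate_one,
      step_of_at rfl g5]
    have q1 : rb 32 = 4 * a.ev L σ + c := by rw [rb3 _ (by omega)]; exact rm2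
    have q2 : rb 33 = e.ev L σ := rb2
    refine ⟨⟨fun j => ?_, fun c' a' => ?_, hκ.2.2⟩, by simp [exec, Cmd.size]; omega⟩
    · simp only [exec]
      rw [rb3 _ (by omega)]
      simp only
      rw [rm3 _ (by omega), ra3 _ (by omega)]
      exact hκ.1 j
    · simp only [exec, q1, q2, St.put, Function.update_apply]
      have := hκ.2.1 c' a'
      have hc := c.2
      have hc' := c'.2
      by_cases hca : c' = c ∧ a' = a.ev L σ
      · rw [if_pos hca, if_pos (by rw [hca.1, hca.2])]
      · rw [if_neg hca, if_neg (fun h => hca ?_), this]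
        exact ⟨Fin.ext (by omega), by omega⟩
  | emit σ e he =>
    intro hσ κ hκ hat
    obtain ⟨h1, h2⟩ := At.append hat
    rw [Exp.length_comp] at h2
    obtain ⟨h3, -⟩ := h2.head
    obtain ⟨ra, ra1, ra2, ra3⟩ := e.run_comp hw hσ 0 κ hκ he h1
    have ra2' : ra 32 = e.ev L σ := ra2
    refine ⟨hσ, _, rfl, ?_⟩
    rw [add_comm e.size, Function.iterate_add_apply, ra1, Function.iterate_one, step_of_at rfl h3]
    refine ⟨⟨fun j => ?_, hκ.2.1, ?_⟩, by simp [exec, Cmd.size]; omega⟩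
    · simp only [exec]
      rw [ra3 _ (by omega)]
      exact hκ.1 j
    · simp [exec, ra2', St.app, hκ.2.2]
  | seq _ _ ih₁ ih₂ =>
    intro hσ κ hκ hat
    obtain ⟨h1, h2⟩ := At.append hat
    rw [Cmd.length_comp] at h2
    obtain ⟨hσ₁, κ₁, e₁, r₁, p₁⟩ := ih₁ hσ κ hκ h1
    obtain ⟨hσ₂, κ₂, e₂, r₂, p₂⟩ := ih₂ hσ₁ κ₁ r₁ (by rw [p₁]; exact h2)
    refine ⟨hσ₂, κ₂, ?_, r₂, by rw [p₂, p₁]; simp [Cmd.size]; omega⟩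
    rw [add_comm, Function.iterate_add_apply, e₁, e₂]
  | @ite_true a b c₁ c₂ σ σ' k ha hb hlt _ ih =>
    intro hσ κ hκ hat
    obtain ⟨reg, e₁, hr⟩ := run_cond hw hσ hκ ha hb hat
    rw [if_pos hlt] at e₁
    obtain ⟨hσ', κ', e₂, r₂, p₂⟩ := ih hσ
      { κ with pc := κ.pc + a.size + b.size + c₂.size + 4, reg := reg } (hκ.of_reg hr) (by
      obtain ⟨-, h2⟩ := At.append hat
      obtain ⟨-, h2⟩ := h2.append
      obtain ⟨-, h2⟩ := h2.append
      obtain ⟨-, h2⟩ := h2.append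
      obtain ⟨-, h2⟩ := h2.append
      simp only [Exp.length_comp, Cmd.length_comp, jumpTo, List.length_cons,
        List.length_nil] at h2
      exact h2.cast (by simp only; omega) (by congr 1))
    refine ⟨hσ', κ', ?_, r₂, by rw [p₂]; simp [Cmd.size]; omega⟩
    rw [add_comm, Function.iterate_add_apply, e₁, e₂]
  | @ite_false a b c₁ c₂ σ σ' k ha hb hlt _ ih =>
    intro hσ κ hκ hat
    obtain ⟨reg, e₁, hr⟩ := run_cond hw hσ hκ ha hb hat
    rw [if_neg hlt] at e₁
    obtain ⟨-, h2⟩ := At.append hat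
    obtain ⟨-, h2⟩ := h2.append
    obtain ⟨-, h2⟩ := h2.append
    obtain ⟨h3, h2⟩ := h2.append
    obtain ⟨h4, -⟩ := h2.append
    simp only [Exp.length_comp, Cmd.length_comp, List.length_singleton] at h3 h4
    obtain ⟨hσ', κ', e₂, r₂, p₂⟩ := ih hσ
      { κ with pc := κ.pc + (a.size + b.size + 1), reg := reg } (hκ.of_reg hr) (by
        exact h3.cast (by simp only; omega) (by congr 1; simp only; omega))
    obtain ⟨reg₃, e₃, hr₃⟩ := run_jumpTo (P := P) (L := L) hw (κ := κ') (by rw [p₂]; exact h4.cast (by simp only; omega) rfl)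
    refine ⟨hσ', { κ' with pc := κ.pc + a.size + b.size + c₁.size + c₂.size + 4, reg := reg₃ }, ?_,
      r₂.of_reg hr₃, ?_⟩
    · rw [show a.size + b.size + 4 + k = 3 + (k + (a.size + b.size + 1)) by omega,
        Function.iterate_add_apply, Function.iterate_add_apply, e₁, e₂, e₃]
    · simp [Cmd.size]; omega
  | @loop_true a b c σ σ₁ σ₂ k₁ k₂ ha hb hlt _ _ ih₁ ih₂ =>
    intro hσ κ hκ hat
    obtain ⟨reg, e₁, hr⟩ := run_cond hw hσ hκ ha hb hat
    rw [if_pos hlt] at e₁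
    obtain ⟨-, h2⟩ := At.append hat
    obtain ⟨-, h2⟩ := h2.append
    obtain ⟨-, h2⟩ := h2.append
    obtain ⟨-, h2⟩ := h2.append
    obtain ⟨h3, h4⟩ := h2.append
    simp only [Exp.length_comp, Cmd.length_comp, jumpTo, List.length_cons,
        List.length_nil] at h3 h4
    obtain ⟨hσ', κ', e₂, r₂, p₂⟩ := ih₁ hσ
      { κ with pc := κ.pc + a.size + b.size + 4, reg := reg } (hκ.of_reg hr) (by
        exact h3.cast (by simp only) (by congr 1))
    obtain ⟨reg₃, e₃, hr₃⟩ := run_jumpTo (P := P) (L := L) hw (κ := κ') (l := κ.pc)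
      (by rw [p₂]; exact h4.cast (by simp only) rfl)
    obtain ⟨hσ₂, κ₂, e₄, r₄, p₄⟩ := ih₂ hσ' { κ' with pc := κ.pc, reg := reg₃ } (r₂.of_reg hr₃) hat
    refine ⟨hσ₂, κ₂, ?_, r₄, p₄⟩
    rw [show a.size + b.size + 4 + k₁ + k₂ = k₂ + (3 + (k₁ + (a.size + b.size + 1))) by omega,
      Function.iterate_add_apply, Function.iterate_add_apply, Function.iterate_add_apply, e₁, e₂, e₃, e₄]
  | @loop_false a b c σ ha hb hlt =>
    intro hσ κ hκ hat
    obtain ⟨reg, e₁, hr⟩ := run_cond hw hσ hκ ha hb hat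
    rw [if_neg hlt] at e₁
    obtain ⟨-, h2⟩ := At.append hat
    obtain ⟨-, h2⟩ := h2.append
    obtain ⟨-, h2⟩ := h2.append
    obtain ⟨h3, -⟩ := h2.append
    simp only [Exp.length_comp, List.length_singleton] at h3
    obtain ⟨reg₃, e₃, hr₃⟩ := run_jumpTo (P := P) (L := L) hw 
      (κ := { κ with pc := κ.pc + (a.size + b.size + 1), reg := reg })
      (by exact h3.cast (by simp only; omega) rfl)
    refine ⟨hσ, { κ with pc := κ.pc + a.size + b.size + c.size + 7, reg := reg₃ }, ?_,
      (hκ.of_reg hr).of_reg hr₃, ?_⟩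
    · rw [show a.size + b.size + 4 = 3 + (a.size + b.size + 1) by omega,
        Function.iterate_add_apply, e₁, e₃]
    · simp [Cmd.size]; omega

/-- The initial state on a given input. -/
def St.init (w : ℕ) (input : List ℕ) : St where
  v i := input.getD i 0 % 2 ^ w
  m _ _ := 0
  out := []

theorem Big.haltsWithin (hw : 6 ≤ w) (hL : ∀ x ∈ L, x < 2 ^ w) {c : Cmd} {σ' : St} {k T : ℕ}
    {input : List ℕ} (h : Big w L c (St.init w input) σ' k) (hT : k ≤ T) :
    HaltsWithin (c.comp 0) w L input T σ'.out := by
  have hpos : 0 < 2 ^ w := by positivity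
  obtain ⟨-, κ', e, r, p⟩ := h.run (P := c.comp 0) hw hL
    ⟨fun i => Nat.mod_lt _ hpos, fun _ _ => hpos⟩ (WordRAM.init w input) ⟨fun i => rfl, fun c a => rfl, rfl⟩
    (fun j hj => by simp [WordRAM.init])
  refine ⟨k, hT, ?_, by rw [e]; exact r.2.2⟩
  rw [e, p, Cmd.length_comp]
  simp [WordRAM.init]

end Machine

end FTFlow

/-! ### A program logic with time bounds -/

namespace FTFlow

open WordRAM

variable {w : ℕ} {L : List ℕ}

/-- From the state `σ`, command `c` terminates within `T` steps, in a state that satisfies `Q`. -/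
def Trip (w : ℕ) (L : List ℕ) (c : Cmd) (σ : St) (T : ℕ) (Q : St → Prop) : Prop :=
  ∃ σ' k, Big w L c σ σ' k ∧ k ≤ T ∧ Q σ'

theorem Trip.mono {c : Cmd} {σ : St} {T T' : ℕ} {Q Q' : St → Prop} (h : Trip w L c σ T Q) (hT : T ≤ T')
    (hQ : ∀ σ', Q σ' → Q' σ') : Trip w L c σ T' Q' := by
  obtain ⟨σ', k, h1, h2, h3⟩ := h
  exact ⟨σ', k, h1, h2.trans hT, hQ _ h3⟩

theorem Trip.seq {c₁ c₂ : Cmd} {σ : St} {T₁ T₂ : ℕ} {Q R : St → Prop} (h : Trip w L c₁ σ T₁ R)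
    (h₂ : ∀ σ₁, R σ₁ → Trip w L c₂ σ₁ T₂ Q) : Trip w L (.seq c₁ c₂) σ (T₁ + T₂) Q := by
  obtain ⟨σ₁, k₁, a₁, b₁, r⟩ := h
  obtain ⟨σ₂, k₂, a₂, b₂, q⟩ := h₂ _ r
  exact ⟨σ₂, k₁ + k₂, a₁.seq a₂, by omega, q⟩

theorem Trip.ite {a b : Exp} {c₁ c₂ : Cmd} {σ : St} {T : ℕ} {Q : St → Prop} (ha : a.ok w L σ)
    (hb : b.ok w L σ) (h₁ : a.ev L σ < b.ev L σ → Trip w L c₁ σ T Q)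
    (h₂ : ¬ a.ev L σ < b.ev L σ → Trip w L c₂ σ T Q) :
    Trip w L (.ite a b c₁ c₂) σ (a.size + b.size + 4 + T) Q := by
  by_cases h : a.ev L σ < b.ev L σ
  · obtain ⟨σ', k, h3, h4, h5⟩ := h₁ h
    exact ⟨σ', _, .ite_true ha hb h h3, by omega, h5⟩
  · obtain ⟨σ', k, h3, h4, h5⟩ := h₂ h
    exact ⟨σ', _, .ite_false ha hb h h3, by omega, h5⟩

/-- The rule for loops: `I φ σ` says that the invariant holds in the state `σ` and that the time `φ` is
available for the remaining iterations. -/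
theorem Trip.loop {a b : Exp} {c : Cmd} (I : ℕ → St → Prop)
    (hok : ∀ φ σ, I φ σ → a.ok w L σ ∧ b.ok w L σ)
    (hbody : ∀ φ σ, I φ σ → a.ev L σ < b.ev L σ → ∃ T, a.size + b.size + 4 + T ≤ φ ∧
      Trip w L c σ T fun σ' => ∃ φ', φ' + (a.size + b.size + 4 + T) ≤ φ ∧ I φ' σ') :
    ∀ {φ : ℕ} {σ : St}, I φ σ → Trip w L (.loop a b c) σ (φ + (a.size + b.size + 4)) fun σ' =>
      ¬ a.ev L σ' < b.ev L σ' ∧ ∃ φ', I φ' σ' := by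
  intro φ
  -- Each iteration uses up a positive amount of the available time.
  induction φ using Nat.strong_induction_on with
  | _ φ ih =>
    intro σ hI
    by_cases h : a.ev L σ < b.ev L σ
    · obtain ⟨T, hT, σ₁, k₁, h1, h2, φ', h3, h4⟩ := hbody φ σ hI h
      obtain ⟨σ₂, k₂, h5, h6, h7⟩ := ih φ' (by omega) h4
      exact ⟨σ₂, _, .loop_true (hok _ _ hI).1 (hok _ _ hI).2 h h1 h5, by omega, h7⟩
    · exact ⟨σ, _, .loop_false (hok _ _ hI).1 (hok _ _ hI).2 h, by omega, h, φ, hI⟩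

/-- A bound on the running time of a command without loops. -/
def Cmd.cost : Cmd → ℕ
  | .skip => 0
  | .assign _ e => e.size + 2
  | .store _ a e => a.size + e.size + 5
  | .emit e => e.size + 1
  | .seq c₁ c₂ => c₁.cost + c₂.cost
  | .ite a b c₁ c₂ => a.size + b.size + 4 + (c₁.cost + c₂.cost)
  -- This value is irrelevant, because the weakest precondition of a loop is `False`.
  | .loop _ _ _ => 0

/-- The weakest precondition of a command without loops. -/
def Cmd.wp (w : ℕ) (L : List ℕ) : Cmd → (St → Prop) → St → Prop
  | .skip, Q, σ => Q σ
  | .assign i e, Q, σ => e.ok w L σ ∧ Q (σ.set i (e.ev L σ))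
  | .store c a e, Q, σ => a.ok w L σ ∧ e.ok w L σ ∧ 4 * a.ev L σ + c.val < 2 ^ w ∧
      Q (σ.put c (a.ev L σ) (e.ev L σ))
  | .emit e, Q, σ => e.ok w L σ ∧ Q (σ.app (e.ev L σ))
  | .seq c₁ c₂, Q, σ => c₁.wp w L (c₂.wp w L Q) σ
  | .ite a b c₁ c₂, Q, σ => a.ok w L σ ∧ b.ok w L σ ∧ (a.ev L σ < b.ev L σ → c₁.wp w L Q σ) ∧
      (¬ a.ev L σ < b.ev L σ → c₂.wp w L Q σ)
  | .loop _ _ _, _, _ => False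

theorem Cmd.wp.trip {c : Cmd} {Q : St → Prop} {σ : St} (h : c.wp w L Q σ) : Trip w L c σ c.cost Q := by
  induction c generalizing Q σ with
  | skip => exact ⟨σ, 0, .skip σ, le_rfl, h⟩
  | assign i e => exact ⟨_, _, .assign σ i e h.1, le_rfl, h.2⟩
  | store c a e => exact ⟨_, _, .store σ c a e h.1 h.2.1 h.2.2.1, le_rfl, h.2.2.2⟩
  | emit e => exact ⟨_, _, .emit σ e h.1, le_rfl, h.2⟩
  | seq c₁ c₂ h₁ h₂ => exact (h₁ h).seq fun σ₁ hσ => h₂ hσ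
  | ite a b c₁ c₂ h₁ h₂ =>
    exact Trip.ite h.1 h.2.1 (fun hlt => (h₁ (h.2.2.1 hlt)).mono (Nat.le_add_right _ _) fun _ h => h)
      fun hlt => (h₂ (h.2.2.2 hlt)).mono (Nat.le_add_left _ _) fun _ h => h
  | loop a b c => exact h.elim

infixr:60 " ;; " => Cmd.seq

@[simp] theorem Exp.ev_var (σ : St) (i : Fin 32) : (Exp.var i).ev L σ = σ.v i := rfl
@[simp] theorem Exp.ev_const (σ : St) (a : ℕ) : (Exp.const a).ev L σ = a := rfl
@[simp] theorem Exp.ev_add (σ : St) (a b : Exp) : (a + b).ev L σ = a.ev L σ + b.ev L σ := rfl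
@[simp] theorem Exp.ev_sub (σ : St) (a b : Exp) : (a - b).ev L σ = a.ev L σ - b.ev L σ := rfl
@[simp] theorem Exp.ev_mul (σ : St) (a b : Exp) : (a * b).ev L σ = a.ev L σ * b.ev L σ := rfl
@[simp] theorem Exp.ev_mod (σ : St) (a b : Exp) : (a % b).ev L σ = a.ev L σ % b.ev L σ := rfl
@[simp] theorem Exp.ev_dat (σ : St) (c : ℕ) (a : Exp) : (Exp.dat c a).ev L σ = datCol L c (a.ev L σ) := rfl
@[simp] theorem Exp.ev_mem (σ : St) (c : Fin 4) (a : Exp) : (Exp.mem c a).ev L σ = σ.m c (a.ev L σ) := rfl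

@[simp] theorem Exp.ok_var (σ : St) (i : Fin 32) : (Exp.var i).ok w L σ := trivial
@[simp] theorem Exp.ok_const (σ : St) (a : ℕ) : (Exp.const a).ok w L σ ↔ a < 2 ^ w := Iff.rfl
@[simp] theorem Exp.ok_add (σ : St) (a b : Exp) : (a + b).ok w L σ ↔
    a.ok w L σ ∧ b.ok w L σ ∧ a.ev L σ + b.ev L σ < 2 ^ w := Iff.rfl
@[simp] theorem Exp.ok_sub (σ : St) (a b : Exp) : (a - b).ok w L σ ↔
    a.ok w L σ ∧ b.ok w L σ ∧ a.ev L σ - b.ev L σ < 2 ^ w := Iff.rfl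
@[simp] theorem Exp.ok_mul (σ : St) (a b : Exp) : (a * b).ok w L σ ↔
    a.ok w L σ ∧ b.ok w L σ ∧ a.ev L σ * b.ev L σ < 2 ^ w := Iff.rfl
@[simp] theorem Exp.ok_mod (σ : St) (a b : Exp) : (a % b).ok w L σ ↔
    a.ok w L σ ∧ b.ok w L σ ∧ a.ev L σ % b.ev L σ < 2 ^ w := Iff.rfl
@[simp] theorem Exp.ok_dat (σ : St) (c : ℕ) (a : Exp) : (Exp.dat c a).ok w L σ ↔
    a.ok w L σ ∧ 32 * a.ev L σ + c < 2 ^ w := Iff.rfl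
@[simp] theorem Exp.ok_mem (σ : St) (c : Fin 4) (a : Exp) : (Exp.mem c a).ok w L σ ↔
    a.ok w L σ ∧ 4 * a.ev L σ + c.val < 2 ^ w := Iff.rfl

@[simp] theorem Exp.size_var (i : Fin 32) : (Exp.var i).size = 2 := rfl
@[simp] theorem Exp.size_const (a : ℕ) : (Exp.const a).size = 1 := rfl
@[simp] theorem Exp.size_add (a b : Exp) : (a + b).size = a.size + b.size + 1 := rfl
@[simp] theorem Exp.size_sub (a b : Exp) : (a - b).size = a.size + b.size + 1 := rfl
@[simp] theorem Exp.size_mul (a b : Exp) : (a * b).size = a.size + b.size + 1 := rfl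
@[simp] theorem Exp.size_mod (a b : Exp) : (a % b).size = a.size + b.size + 1 := rfl
@[simp] theorem Exp.size_dat (c : ℕ) (a : Exp) : (Exp.dat c a).size = a.size + 5 := rfl
@[simp] theorem Exp.size_mem (c : Fin 4) (a : Exp) : (Exp.mem c a).size = a.size + 5 := rfl

@[simp] theorem St.set_v (σ : St) (i : Fin 32) (x : ℕ) (j : Fin 32) :
    (σ.set i x).v j = if j = i then x else σ.v j := rfl
@[simp] theorem St.set_m (σ : St) (i : Fin 32) (x : ℕ) : (σ.set i x).m = σ.m := rfl
@[simp] theorem St.set_out (σ : St) (i : Fin 32) (x : ℕ) : (σ.set i x).out = σ.out := rfl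
@[simp] theorem St.put_v (σ : St) (c : Fin 4) (a x : ℕ) : (σ.put c a x).v = σ.v := rfl
@[simp] theorem St.put_m (σ : St) (c c' : Fin 4) (a x a' : ℕ) :
    (σ.put c a x).m c' a' = if c' = c ∧ a' = a then x else σ.m c' a' := rfl
@[simp] theorem St.put_out (σ : St) (c : Fin 4) (a x : ℕ) : (σ.put c a x).out = σ.out := rfl
@[simp] theorem St.app_v (σ : St) (x : ℕ) : (σ.app x).v = σ.v := rfl
@[simp] theorem St.app_m (σ : St) (x : ℕ) : (σ.app x).m = σ.m := rfl
@[simp] theorem St.app_out (σ : St) (x : ℕ) : (σ.app x).out = σ.out ++ [x] := rfl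

/-- The absolute difference: it is zero if and only if the two sides are equal. -/
def Exp.dist (a b : Exp) : Exp := (a - b) + (b - a)

@[simp] theorem Exp.ev_dist (σ : St) (a b : Exp) :
    (a.dist b).ev L σ = (a.ev L σ - b.ev L σ) + (b.ev L σ - a.ev L σ) := rfl
@[simp] theorem Exp.size_dist (a b : Exp) : (a.dist b).size = 2 * a.size + 2 * b.size + 3 := by
  simp [Exp.dist]; omega
@[simp] theorem Exp.ok_dist (σ : St) (a b : Exp) : (a.dist b).ok w L σ ↔
    (a.ok w L σ ∧ b.ok w L σ) ∧ (a.ev L σ - b.ev L σ) + (b.ev L σ - a.ev L σ) < 2 ^ w := by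
  simp only [Exp.dist, Exp.ok_add, Exp.ok_sub, Exp.ev_sub]
  constructor
  · rintro ⟨⟨h1, h2, -⟩, -, h3⟩; exact ⟨⟨h1, h2⟩, h3⟩
  · rintro ⟨⟨h1, h2⟩, h3⟩; exact ⟨⟨h1, h2, by omega⟩, ⟨h2, h1, by omega⟩, h3⟩

end FTFlow

/-! ### The data structure and the query programs -/

namespace FTFlow

open WordRAM

variable {w : ℕ} {L : List ℕ} {n m : ℕ}

/-- The objects that the data structure stores: a path system that forms a max-flow, a backup graph
for every path together with a numbering of its arcs by their tails, and the detours. -/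
structure Scheme (G : MultiDigraph (Fin n) (Fin m)) (s t : Fin n) where
  ne : s ≠ t
  k : ℕ
  pos : 0 < k
  P : PathSystem G s t k
  max : t ∉ reach (atl G) (ahd G) (resArcs P.supp) {s}
  B : ℕ → Finset (Fin m)
  backup : P.IsBackup B
  tag : ℕ → Fin n → ℕ
  dedge : ℕ → Fin n → Option (Fin m)
  lo : ℕ → ℕ → ℕ
  hi : ℕ → ℕ → ℕ
  tg : ℕ → ℕ → ℕ
  dedge_some : ∀ i w e, dedge i w = some e → i < k ∧ 1 ≤ tag i w ∧ tag i w ≤ P.len i ∧ e ∉ P.edges i ∧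
      w = if e ∈ P.supp then G.src e else G.tgt e
  single : ∀ i < k, ∀ x < P.len i, lo i x ≤ x ∧ x < hi i x ∧ hi i x ≤ P.len i ∧ tg i x ≤ P.len i ∧
      P.edge i x ∉ P.updated tag dedge i (lo i x) (hi i x) (tg i x) ∧
      ∃ c : ℤ, IsFlowSet G s t (P.updated tag dedge i (lo i x) (hi i x) (tg i x)) c ∧
        ∃ X : Finset (Fin n), s ∈ X ∧ t ∉ X ∧ ((Finset.univ.filter fun e => e ∉ ({P.edge i x} : Finset (Fin m)) ∧
          G.src e ∈ X ∧ G.tgt e ∉ X).card : ℤ) ≤ c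
  /-- a bound on the number of arcs of a backup graph -/
  M : ℕ
  start : ℕ → ℕ → ℕ
  arc : ℕ → Fin m × Bool
  start_mono : ∀ i, Monotone (start i)
  start_le : ∀ i, start i n ≤ start i 0 + M
  start_le_mul : ∀ i < k, start i n ≤ k * M
  arc_mem : ∀ i < k, ∀ v : Fin n, ∀ h, start i v ≤ h → h < start i (v + 1) → (arc h).1 ∈ B i ∧ atl G (arc h) = v
  exists_arc : ∀ i < k, ∀ a : Fin m × Bool, a.1 ∈ B i → ∃ h, start i (atl G a : Fin n) ≤ h ∧
    h < start i ((atl G a : Fin n) + 1) ∧ arc h = a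

/-- The first-level hash value of `x`. -/
def bucketOf (L : List ℕ) (x : ℕ) : ℕ := datCol L 0 4 * x % datCol L 0 3 % datCol L 0 5

/-- The cell of `x` in the hash table. -/
def cellOf (L : List ℕ) (x : ℕ) : ℕ :=
  datCol L 3 (bucketOf L x) + datCol L 1 (bucketOf L x) * x % datCol L 0 3 % datCol L 2 (bucketOf L x)

/-- The cell of `x` if `x` is stored in the hash table, and an empty cell otherwise. -/
def slotOf (L : List ℕ) (x : ℕ) : ℕ :=
  if datCol L 4 (cellOf L x) = x + 1 then cellOf L x else datCol L 0 6

/-- The memory `L` represents the scheme. -/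
structure Layout {G : MultiDigraph (Fin n) (Fin m)} {s t : Fin n} (D : Scheme G s t) (w : ℕ)
    (L : List ℕ) (R : ℕ) : Prop where
  -- The bound covers addresses of table entries; the next one covers the products in the hash
  -- function.
  word₁ : 32 * (R + 2 * m + 2) ≤ 2 ^ w
  word₂ : 2 * m * m < 2 ^ w
  size₀ : 16 ≤ R
  size₁ : D.k * (n + 1) ≤ R
  size₂ : D.k * D.M ≤ R
  hdr_n : datCol L 0 0 = n
  hdr_s : datCol L 0 1 = s
  hdr_t : datCol L 0 2 = t
  hdr_p : 0 < datCol L 0 3 ∧ datCol L 0 3 ≤ 2 * m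
  hdr_a : datCol L 0 4 < datCol L 0 3
  hdr_N : 0 < datCol L 0 5 ∧ datCol L 0 5 ≤ R
  hdr_dummy : datCol L 0 6 ≤ R
  mult_lt : ∀ j, datCol L 1 j < datCol L 0 3
  offset_le : ∀ j, datCol L 3 j ≤ R
  key_le : ∀ j, datCol L 4 j ≤ m
  path_edge : ∀ i < D.k, ∀ x < D.P.len i, datCol L 5 (slotOf L (D.P.edge i x)) = i + 1 ∧
    datCol L 6 (slotOf L (D.P.edge i x)) = x ∧ datCol L 8 (slotOf L (D.P.edge i x)) = D.lo i x ∧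
    datCol L 9 (slotOf L (D.P.edge i x)) = D.hi i x ∧ datCol L 10 (slotOf L (D.P.edge i x)) = D.tg i x
  path_none : ∀ e : Fin m, e ∉ D.P.supp → datCol L 5 (slotOf L e) = 0
  vertex_lt : ∀ e : Fin m, datCol L 7 (slotOf L e) < n
  vertex_eq : ∀ i w e, D.dedge i w = some e → datCol L 7 (slotOf L e) = w
  detour : ∀ i < D.k, ∀ v : Fin n, datCol L 11 (i * n + v) = ((D.dedge i v).map fun e => (e : ℕ) + 1).getD 0
  detour_tag : ∀ i < D.k, ∀ v : Fin n, D.dedge i v ≠ none → datCol L 12 (i * n + v) = D.tag i v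
  detour_tag_le : ∀ q, datCol L 12 q ≤ n
  edge_eq : ∀ i < D.k, ∀ x < D.P.len i, datCol L 13 (i * n + x) = D.P.edge i x
  len_eq : ∀ i < D.k, datCol L 14 i = D.P.len i
  start_eq : ∀ i < D.k, ∀ v ≤ n, datCol L 15 (i * (n + 1) + v) = D.start i v
  arc_edge : ∀ h < D.k * D.M, datCol L 17 h = (D.arc h).1
  arc_head : ∀ h < D.k * D.M, datCol L 18 h = ahd G (D.arc h)
  arc_tail : ∀ h < D.k * D.M, datCol L 19 h = atl G (D.arc h)
  -- The bit tells whether the edge must have been flipped for the arc to be residual, so an arc is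
  -- residual exactly if the mark of its edge equals this bit.
  arc_flip : ∀ h < D.k * D.M, datCol L 20 h = if (D.arc h).2 = true ↔ (D.arc h).1 ∈ D.P.supp then 1 else 0

/-- Entry `q` of the header. -/
abbrev hdr (q : ℕ) : Exp := .dat 0 (.const q)

/-- The number `a`. -/
abbrev cst (a : ℕ) : Exp := .const a

/-- Set `d` to the slot of the edge in the variable `i`. -/
def lookup (i d : Fin 32) : Cmd :=
  .assign 30 (hdr 4 * .var i % hdr 3 % hdr 5) ;;
  .assign d (.dat 3 (.var 30) + .dat 1 (.var 30) * .var i % hdr 3 % .dat 2 (.var 30)) ;;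
  .ite (cst 0) ((Exp.dat 4 (.var d)).dist (.var i + cst 1)) (.assign d (hdr 6)) .skip

/-- The program for the second kind of query. -/
def edgeFlowCmd : Cmd :=
  .ite (cst 0) (hdr 0)
    (lookup 0 2 ;; lookup 1 3 ;;
      .ite (cst 0) (.dat 5 (.var 2))
        (.ite (cst 0) ((Exp.dat 5 (.var 2)).dist (.dat 5 (.var 3)))
          (.assign 4 ((.dat 5 (.var 2) - cst 1) * hdr 0 + .dat 7 (.var 3)) ;;
            .ite ((Exp.dat 11 (.var 4)).dist (.var 1 + cst 1) +
                (Exp.dat 12 (.var 4)).dist (.dat 10 (.var 2))) (cst 1)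
              -- A detour flips its edges. Subtraction is truncated, so this is `1` exactly if the
              -- edge lies on no path.
              (.emit (cst 1 - .dat 5 (.var 3)))
              (.ite (cst 0) (.dat 5 (.var 3)) (.emit (cst 1)) (.emit (cst 0))))
          (.ite (.dat 6 (.var 3)) (.dat 8 (.var 2)) (.emit (cst 1))
            (.ite (.dat 6 (.var 3)) (.dat 9 (.var 2)) (.emit (cst 0)) (.emit (cst 1)))))
        (.ite (cst 0) (.dat 5 (.var 3)) (.emit (cst 1)) (.emit (cst 0))))
    (.emit (cst 0))

end FTFlow

/-! ### Correctness of the query for a single edge -/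

namespace FTFlow

open WordRAM

variable {w : ℕ} {L : List ℕ} {n m : ℕ} {G : MultiDigraph (Fin n) (Fin m)} {s t : Fin n}
  {D : Scheme G s t} {R : ℕ}

theorem Layout.slot_le (hL : Layout D w L R) (x : ℕ) : slotOf L x ≤ R + 2 * m := by
  have h1 := hL.offset_le (bucketOf L x)
  have h2 : datCol L 1 (bucketOf L x) * x % datCol L 0 3 % datCol L 2 (bucketOf L x) ≤ 2 * m :=
    ((Nat.mod_le _ _).trans (Nat.mod_lt _ hL.hdr_p.1).le).trans hL.hdr_p.2
  have h3 := hL.hdr_dummy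
  unfold slotOf cellOf
  split_ifs <;> omega

/-- The program realizes `slotOf`. Multipliers are below the modulus, which is at most `2 * m`, and
`x < m`, so the products stay below `2 * m * m` and do not overflow. -/
theorem Layout.wp_lookup (hL : Layout D w L R) {σ : St} {Q : St → Prop} {i d : Fin 32} (hi : i ≠ 30)
    (hd : d ≠ 30) (hid : i ≠ d) {x : ℕ} (hx : x < m) (hv : σ.v i = x)
    (hQ : Q ((σ.set 30 (bucketOf L x)).set d (slotOf L x))) : (lookup i d).wp w L Q σ := by
  have w1 := hL.word₁
  have w0 := hL.size₀
  have w2 := hL.word₂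
  obtain ⟨p0, p1⟩ := hL.hdr_p
  have a1 := hL.hdr_a
  obtain ⟨N0, N1⟩ := hL.hdr_N
  have d1 := hL.hdr_dummy
  have o1 := hL.offset_le (bucketOf L x)
  have k1 := hL.key_le (cellOf L x)
  have m1 := hL.mult_lt (bucketOf L x)
  have b1 : bucketOf L x < R := (Nat.mod_lt _ N0).trans_le N1
  have c1 : datCol L 0 4 * x < 2 ^ w := by
    refine lt_of_le_of_lt ?_ w2
    exact Nat.mul_le_mul (by omega) hx.le
  have c2 : datCol L 1 (bucketOf L x) * x < 2 ^ w := by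
    refine lt_of_le_of_lt ?_ w2
    exact Nat.mul_le_mul (by omega) hx.le
  have c3 : datCol L 0 4 * x % datCol L 0 3 < datCol L 0 3 := Nat.mod_lt _ p0
  have c4 : datCol L 1 (bucketOf L x) * x % datCol L 0 3 < datCol L 0 3 := Nat.mod_lt _ p0
  have c5 : datCol L 1 (bucketOf L x) * x % datCol L 0 3 % datCol L 2 (bucketOf L x) ≤
    datCol L 1 (bucketOf L x) * x % datCol L 0 3 := Nat.mod_le _ _
  have e1 : datCol L 0 4 * x % datCol L 0 3 % datCol L 0 5 = bucketOf L x := rfl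
  have e2 : datCol L 3 (bucketOf L x) + datCol L 1 (bucketOf L x) * x % datCol L 0 3 %
    datCol L 2 (bucketOf L x) = cellOf L x := rfl
  have c6 : cellOf L x ≤ R + 2 * m := by rw [← e2]; omega
  simp only [lookup, Cmd.wp, Exp.ok_mod, Exp.ok_mul, Exp.ok_add, Exp.ok_dat, Exp.ok_const, Exp.ok_var,
    Exp.ok_dist, Exp.ev_mod, Exp.ev_mul, Exp.ev_add, Exp.ev_dat, Exp.ev_const, Exp.ev_var, Exp.ev_dist,
    St.set_v, hv, hi, hid, hd, if_true, if_false, e1, e2, true_and]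
  refine ⟨?_, ?_, ?_, ?_, fun h => ⟨?_, ?_⟩, fun h => ?_⟩
  rotate_right 2
  · convert hQ using 1
    have : slotOf L x = datCol L 0 6 := if_neg (by omega)
    rw [this]
    ext j
    · simp only [St.set_v]; split_ifs <;> rfl
    · rfl
    · rfl
  · have : slotOf L x = cellOf L x := if_pos (by omega)
    rwa [this] at hQ
  all_goals (repeat' refine And.intro ?_ ?_) <;> omega

/-- `S` is the flow set to which the scheme switches when `e₀` fails. -/
def Scheme.IsAfterOne (D : Scheme G s t) (e₀ : Fin m) (S : Finset (Fin m)) : Prop :=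
  (∀ i < D.k, ∀ x < D.P.len i, D.P.edge i x = e₀ →
    S = D.P.updated D.tag D.dedge i (D.lo i x) (D.hi i x) (D.tg i x)) ∧ (e₀ ∉ D.P.supp → S = D.P.supp)

theorem Scheme.mem_supp (D : Scheme G s t) {e : Fin m} : e ∈ D.P.supp ↔
    ∃ i < D.k, ∃ x < D.P.len i, D.P.edge i x = e := by
  simp only [PathSystem.mem_supp, PathSystem.mem_edges]

theorem Scheme.exists_isAfterOne (D : Scheme G s t) (e₀ : Fin m) : ∃ S, D.IsAfterOne e₀ S := by
  by_cases h : e₀ ∈ D.P.supp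
  · obtain ⟨i, hi, x, hx, he⟩ := D.mem_supp.1 h
    refine ⟨D.P.updated D.tag D.dedge i (D.lo i x) (D.hi i x) (D.tg i x),
      fun i' hi' x' hx' he' => ?_, fun h' => absurd h h'⟩
    · obtain ⟨rfl, rfl⟩ := D.P.edge_inj i hi i' hi' x hx x' hx' (he.trans he'.symm)
      rfl
  · exact ⟨D.P.supp, fun i hi x hx he => absurd (D.mem_supp.2 ⟨i, hi, x, hx, he⟩) h, fun _ => rfl⟩

theorem PathSystem.mem_updated {V E : Type*} [Fintype V] [DecidableEq V] [Fintype E] [DecidableEq E]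
    {G : MultiDigraph V E} {s t : V} {k : ℕ} {P : PathSystem G s t k} {tag : ℕ → V → ℕ}
    {dedge : ℕ → V → Option E} {i lo hi tg : ℕ} {e : E} : e ∈ P.updated tag dedge i lo hi tg ↔
      ((e ∈ P.supp ∧ e ∉ P.segment i lo hi) ↔ ¬ ∃ w, dedge i w = some e ∧ tag i w = tg) := by
  simp only [PathSystem.updated, Finset.mem_symmDiff, Finset.mem_sdiff, Finset.mem_filter,
    Finset.mem_univ, true_and]
  by_cases h1 : e ∈ P.supp <;> by_cases h2 : e ∈ P.segment i lo hi <;>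
    by_cases h3 : ∃ w, dedge i w = some e ∧ tag i w = tg <;> simp only [h1, h2, h3] <;> simp

theorem Scheme.mem_segment (D : Scheme G s t) {i x lo hi : ℕ} (hi' : i < D.k) (hx : x < D.P.len i)
    (hhi : hi ≤ D.P.len i) : D.P.edge i x ∈ D.P.segment i lo hi ↔ lo ≤ x ∧ x < hi := by
  simp only [PathSystem.segment, Finset.mem_image, Finset.mem_Ico]
  constructor
  · rintro ⟨y, hy, h⟩
    obtain ⟨-, rfl⟩ := D.P.edge_inj i hi' i hi' y (by omega) x hx h
    exact hy
  · exact fun h => ⟨x, h, rfl⟩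

theorem Layout.idx_lt (hL : Layout D w L R) {i v : ℕ} (hi : i < D.k) (hv : v < n) : i * n + v < R := by
  have h1 := hL.size₁
  have : (i + 1) * n ≤ D.k * n := Nat.mul_le_mul_right _ hi
  nlinarith

theorem Layout.k_le (hL : Layout D w L R) : D.k ≤ R :=
  (Nat.le_mul_of_pos_right _ (Nat.succ_pos n)).trans hL.size₁

theorem Layout.n_le (hL : Layout D w L R) : n + 1 ≤ R :=
  (Nat.le_mul_of_pos_left _ D.pos).trans hL.size₁

theorem Scheme.len_lt (D : Scheme G s t) {i : ℕ} (hi : i < D.k) : D.P.len i < n := by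
  simpa using D.P.len_lt hi

theorem Layout.detour_lt (hL : Layout D w L R) {i v : ℕ} (hi : i < D.k) (hv : v < n) :
    datCol L 11 (i * n + v) ≤ m := by
  rw [hL.detour i hi ⟨v, hv⟩]
  cases h : D.dedge i ⟨v, hv⟩ with
  | none => simp
  | some e => exact e.2

theorem Layout.detour_iff (hL : Layout D w L R) {i : ℕ} (hi : i < D.k) (v : Fin n) (e : Fin m) :
    datCol L 11 (i * n + v) = e + 1 ↔ D.dedge i v = some e := by
  rw [hL.detour i hi v]
  cases h : D.dedge i v with
  | none => simp
  | some e => simp [Fin.ext_iff]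

/-- An edge can be stored as a detour edge at one vertex only, found in column 7, so one comparison
of edge and tag decides whether it lies on the detour in use. An edge on the failing path loses its
flow exactly if its position is between `lo` and `hi`. -/
theorem Layout.wp_edgeFlow (hL : Layout D w L R) {e₀ x : Fin m} {S : Finset (Fin m)}
    (hS : D.IsAfterOne e₀ S) (hx : x ≠ e₀) {σ : St} (h0 : σ.v 0 = e₀) (h1 : σ.v 1 = x) (hout : σ.out = []) :
    edgeFlowCmd.wp w L (fun σ' => σ'.out = [if x ∈ S then 1 else 0]) σ := by
  have w1 := hL.word₁
  have w0 := hL.size₀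
  have w2 := hL.word₂
  have hn : 0 < n := s.pos
  have hnR := hL.n_le
  have s0 := hL.slot_le e₀
  have s1 := hL.slot_le x
  have hkR := hL.k_le
  have hm : 0 < m := e₀.pos
  have hpc : ∀ e : Fin m, datCol L 5 (slotOf L e) ≤ R ∧ (0 < datCol L 5 (slotOf L e) ↔ e ∈ D.P.supp) := by
    intro e
    by_cases h : e ∈ D.P.supp
    · obtain ⟨i, hi, x, hx, rfl⟩ := D.mem_supp.1 h
      have := (hL.path_edge i hi x hx).1
      constructor
      · omega
      · simp [this, h]
    · have := hL.path_none e h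
      simp [this, h]
  simp only [edgeFlowCmd, Cmd.wp, Exp.ev_const, Exp.ev_dat, Exp.ok_const, Exp.ok_dat, hL.hdr_n]
  refine ⟨by omega, ⟨by omega, by omega⟩, fun _ => ?_, fun h => absurd hn h⟩
  refine hL.wp_lookup (by decide) (by decide) (by decide) e₀.2 h0 ?_
  refine hL.wp_lookup (by decide) (by decide) (by decide) x.2 (by simpa using h1) ?_
  simp only [Exp.ok_mul, Exp.ok_add, Exp.ok_sub, Exp.ok_dat, Exp.ok_const, Exp.ok_var,
    Exp.ok_dist, Exp.ev_mul, Exp.ev_add, Exp.ev_sub, Exp.ev_dat, Exp.ev_const, Exp.ev_var, Exp.ev_dist,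
    St.set_v, St.app_out, St.set_out, hout, h1, Fin.reduceEq, if_true, if_false, true_and,
    hL.hdr_n, List.nil_append]
  have hX := hpc x
  have hplain : (x ∈ S ↔ x ∈ D.P.supp) → 
      (0 < datCol L 5 (slotOf L x) → [1] = [if x ∈ S then 1 else 0]) ∧
      (¬ 0 < datCol L 5 (slotOf L x) → [0] = [if x ∈ S then 1 else 0]) := by
    intro h
    refine ⟨fun h' => ?_, fun h' => ?_⟩
    · simp [h, hX.2.1 h']
    · simp [h, mt hX.2.2 h']
  by_cases he₀ : e₀ ∈ D.P.supp
  swap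
  · have p0 := hL.path_none e₀ he₀
    have hS' := hS.2 he₀
    rw [p0]
    refine ⟨by omega, by omega, fun h => absurd h (by omega), fun _ => ⟨by omega, by omega, ?_⟩⟩
    exact ⟨fun h' => ⟨by omega, (hplain (by rw [hS'])).1 h'⟩, fun h' => ⟨by omega, (hplain (by rw [hS'])).2 h'⟩⟩
  obtain ⟨i, hi, y, hy, rfl⟩ := D.mem_supp.1 he₀
  obtain ⟨p0, -, q1, q2, q3⟩ := hL.path_edge i hi y hy
  have hS' := hS.1 i hi y hy rfl
  obtain ⟨l1, l2, l3, l4, -⟩ := D.single i hi y hy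
  have l5 := D.len_lt hi
  have hidx : i * n + datCol L 7 (slotOf L x) < R := hL.idx_lt hi (hL.vertex_lt x)
  have hvx := hL.vertex_lt x
  have hxm := x.2
  rw [p0, q1, q2, q3, Nat.add_sub_cancel]
  -- The sum of two distances is below `1` if and only if both equalities hold.
  have hch : (datCol L 11 (i * n + datCol L 7 (slotOf L x)) - (x + 1) +
      (x + 1 - datCol L 11 (i * n + datCol L 7 (slotOf L x))) +
      (datCol L 12 (i * n + datCol L 7 (slotOf L x)) - D.tg i y +
      (D.tg i y - datCol L 12 (i * n + datCol L 7 (slotOf L x)))) < 1) ↔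
      ∃ v, D.dedge i v = some x ∧ D.tag i v = D.tg i y := by
    constructor
    · intro h
      have h3 := (hL.detour_iff hi ⟨_, hvx⟩ x).1 (by simp only; omega)
      have h4 := hL.detour_tag i hi ⟨_, hvx⟩ (by simp [h3])
      exact ⟨_, h3, by rw [← h4]; simp only; omega⟩
    · rintro ⟨v, h3, h4⟩
      rw [hL.vertex_eq i v x h3, (hL.detour_iff hi v x).2 h3, hL.detour_tag i hi v (by simp [h3]), h4]
      omega
  have g1 := hL.detour_lt hi hvx
  have g2 := hL.detour_tag_le (i * n + datCol L 7 (slotOf L x))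
  have hmem : x ∈ S ↔ ((x ∈ D.P.supp ∧ x ∉ D.P.segment i (D.lo i y) (D.hi i y)) ↔
      ¬ ∃ v, D.dedge i v = some x ∧ D.tag i v = D.tg i y) := by rw [hS']; exact PathSystem.mem_updated
  have hout : datCol L 5 (slotOf L x) ≠ i + 1 → x ∉ D.P.segment i (D.lo i y) (D.hi i y) := by
    intro h hx
    obtain ⟨z, hz, rfl⟩ := PathSystem.mem_edges.1 (D.P.segment_subset l3 hx)
    exact h (hL.path_edge i hi z hz).1
  have hin : datCol L 5 (slotOf L x) = i + 1 → (∃ z < D.P.len i, D.P.edge i z = x) ∧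
      ¬ ∃ v, D.dedge i v = some x ∧ D.tag i v = D.tg i y := by
    intro h
    obtain ⟨i', hi', z, hz, rfl⟩ := D.mem_supp.1 (hX.2.1 (by omega))
    obtain rfl : i' = i := by have := (hL.path_edge i' hi' z hz).1; omega
    refine ⟨⟨z, hz, rfl⟩, ?_⟩
    rintro ⟨v, hv, -⟩
    exact (D.dedge_some i' v _ hv).2.2.2.1 (PathSystem.mem_edges.2 ⟨z, hz, rfl⟩)
  have hin' : i * n < R := by omega
  refine ⟨by omega, by omega, fun _ => ⟨by omega, by omega, fun h => ⟨by omega, by omega, by omega,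
    fun h3 => ⟨by omega, ?_⟩, fun h3 => ⟨by omega, by omega, fun h4 => ⟨by omega, ?_⟩, fun h4 => ⟨by omega, ?_⟩⟩⟩, fun h => ?_⟩,
    fun h => absurd h (by omega)⟩
  · have h5 := hout (by omega)
    rw [hch] at h3
    simp only [h5, h3, not_false_eq_true, and_true, not_true_eq_false, iff_false] at hmem
    by_cases h6 : x ∈ D.P.supp
    · have := hX.2.2 h6
      simp only [hmem, h6, not_true_eq_false, if_false, List.cons.injEq, and_true]
      omega
    · have := mt hX.2.1 h6
      simp only [hmem, h6, not_false_eq_true, if_true, List.cons.injEq, and_true]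
      omega
  · have h5 := hout (by omega)
    rw [hch] at h3
    simp only [h5, h3, not_false_eq_true, and_true, iff_true] at hmem
    exact (hplain hmem).1 h4
  · have h5 := hout (by omega)
    rw [hch] at h3
    simp only [h5, h3, not_false_eq_true, and_true, iff_true] at hmem
    exact (hplain hmem).2 h4
  · obtain ⟨⟨z, hz, rfl⟩, hno⟩ := hin (by omega)
    rw [(hL.path_edge i hi z hz).2.1]
    simp only [hno, not_false_eq_true, iff_true, D.mem_segment hi hz l3,
      D.mem_supp.2 ⟨i, hi, z, hz, rfl⟩, true_and] at hmem
    refine ⟨by omega, by omega, fun h1 => ⟨by omega, ?_⟩, fun h1 => ⟨by omega, by omega,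
      fun h2 => ⟨by omega, ?_⟩, fun h2 => ⟨by omega, ?_⟩⟩⟩
    · rw [if_pos (hmem.2 (by omega))]
    · rw [if_neg (fun h => hmem.1 h (by omega))]
    · rw [if_pos (hmem.2 (by omega))]

end FTFlow

/-! ### Graph search -/

namespace FTFlow

variable {n m : ℕ} {G : MultiDigraph (Fin n) (Fin m)} {s t : Fin n} {D : Scheme G s t}

/-- The arcs on which the flow set that differs from the original one in `Φ` may be augmented after the
failure of `F`, using the backup graphs of paths `i` and `j`. -/
def Scheme.usable (D : Scheme G s t) (i j : ℕ) (F Φ : Finset (Fin m)) : Finset (Fin m × Bool) :=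
  (resArcs (symmDiff D.P.supp Φ)).filter fun a => a.1 ∈ D.B i ∪ D.B j ∧ a.1 ∉ F

theorem Scheme.mem_usable {i j : ℕ} {F Φ : Finset (Fin m)} {a : Fin m × Bool} : a ∈ D.usable i j F Φ ↔
    (a.1 ∈ Φ ↔ (a.2 = true ↔ a.1 ∈ D.P.supp)) ∧ a.1 ∈ D.B i ∪ D.B j ∧ a.1 ∉ F := by
  simp only [Scheme.usable, Finset.mem_filter, mem_resArcs, Finset.mem_symmDiff]
  refine and_congr_left fun _ => ?_
  by_cases h1 : a.1 ∈ Φ <;> by_cases h2 : a.1 ∈ D.P.supp <;> simp [h1, h2]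

/-- A state of a search from `s` along the arcs in `W`: the vertices `q 0, …, q (T - 1)` have been found;
`par` is `1` at `s`, it is `h + 2` at a vertex found along arc number `h`, and `0` elsewhere. -/
structure Scheme.IsSearch (D : Scheme G s t) (W : Finset (Fin m × Bool)) (par q : ℕ → ℕ) (T : ℕ) : Prop where
  pos : 0 < T
  lt : ∀ x < T, q x < n
  inj : ∀ x < T, ∀ y < T, q x = q y → x = y
  zero : q 0 = s
  par_zero : par s = 1
  visited : ∀ v < n, par v ≠ 0 ↔ ∃ x < T, q x = v
  parent : ∀ x < T, 0 < x → ∃ h, par (q x) = h + 2 ∧ h < D.k * D.M ∧ D.arc h ∈ W ∧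
    (ahd G (D.arc h) : Fin n) = q x ∧ ∃ y < x, q y = (atl G (D.arc h) : Fin n)

variable {W : Finset (Fin m × Bool)} {par q : ℕ → ℕ} {T : ℕ}

theorem Scheme.IsSearch.le (h : D.IsSearch W par q T) : T ≤ n := by
  have : (Finset.range T).card ≤ (Finset.range n).card := by
    refine Finset.card_le_card_of_injOn q (fun x hx => ?_) fun x hx y hy hxy => ?_
    · simpa using h.lt x (by simpa using hx)
    · exact h.inj x (by simpa using hx) y (by simpa using hy) hxy
  simpa using this

/-- A head with parent entry `0` is not in the queue, so appending it keeps the queue injective, and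
its parent arc starts at an earlier entry. -/
theorem Scheme.IsSearch.push (h : D.IsSearch W par q T) {a y : ℕ} (ha : a < D.k * D.M)
    (haW : D.arc a ∈ W) (hy : y < T) (hya : q y = (atl G (D.arc a) : Fin n))
    (h0 : par (ahd G (D.arc a) : Fin n) = 0) {par' q' : ℕ → ℕ}
    (hpar : ∀ v, par' v = if v = (ahd G (D.arc a) : Fin n) then a + 2 else par v)
    (hq : ∀ x, q' x = if x = T then ((ahd G (D.arc a) : Fin n) : ℕ) else q x) :
    D.IsSearch W par' q' (T + 1) := by
  have hnew : ∀ x < T, q x ≠ (ahd G (D.arc a) : Fin n) := fun x hx hxa =>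
    (h.visited _ (ahd G (D.arc a) : Fin n).2).2 ⟨x, hx, hxa⟩ h0
  have hqo : ∀ x < T, q' x = q x := fun x hx => by rw [hq, if_neg hx.ne]
  have hqT : q' T = (ahd G (D.arc a) : Fin n) := by rw [hq, if_pos rfl]
  have hpo : ∀ x < T, par' (q x) = par (q x) := fun x hx => by rw [hpar, if_neg (hnew x hx)]
  refine ⟨by omega, fun x hx => ?_, fun x hx x' hx' hxx => ?_, ?_, ?_, fun v hv => ?_, fun x hx hx0 => ?_⟩
  · rcases Nat.lt_succ_iff_lt_or_eq.1 hx with hx | rfl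
    · rw [hqo x hx]; exact h.lt x hx
    · rw [hqT]; exact Fin.is_lt _
  · rcases Nat.lt_succ_iff_lt_or_eq.1 hx with hx | hxT <;>
      rcases Nat.lt_succ_iff_lt_or_eq.1 hx' with hx' | hxT'
    · rw [hqo x hx, hqo x' hx'] at hxx
      exact h.inj x hx x' hx' hxx
    · rw [hqo x hx, hxT', hqT] at hxx
      exact absurd hxx (hnew x hx)
    · rw [hqo x' hx', hxT, hqT] at hxx
      exact absurd hxx.symm (hnew x' hx')
    · omega
  · rw [hqo 0 h.pos, h.zero]
  · rw [← h.zero, hpo 0 h.pos, h.zero, h.par_zero]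
  · rw [hpar]
    split_ifs with hva
    · simp only [ne_eq, Nat.add_eq_zero_iff, OfNat.ofNat_ne_zero, and_false, not_false_eq_true, true_iff]
      exact ⟨T, by omega, by rw [hqT, hva]⟩
    · rw [h.visited v hv]
      constructor
      · rintro ⟨x, hx, hxv⟩
        exact ⟨x, by omega, by rw [hqo x hx, hxv]⟩
      · rintro ⟨x, hx, hxv⟩
        rcases Nat.lt_succ_iff_lt_or_eq.1 hx with hx | rfl
        · exact ⟨x, hx, by rw [← hqo x hx, hxv]⟩
        · exact absurd (hxv.symm.trans hqT) hva
  · rcases Nat.lt_succ_iff_lt_or_eq.1 hx with hx | rfl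
    · obtain ⟨b, h1, h2, h3, h4, z, h5, h6⟩ := h.parent x hx hx0
      rw [hqo x hx, hpo x hx]
      exact ⟨b, h1, h2, h3, h4, z, h5, by rw [hqo z (by omega), h6]⟩
    · exact ⟨a, by rw [hpar, if_pos hqT], ha, haW, hqT.symm, y, hy, by rw [hqo y hy, hya]⟩

/-- The start of a search. -/
theorem Scheme.IsSearch.init (hpar : ∀ v < n, par v = if v = s then 1 else 0) (hq : q 0 = s) :
    D.IsSearch W par q 1 := by
  refine ⟨Nat.one_pos, fun x hx => ?_, fun x hx y hy _ => by omega, hq, ?_, fun v hv => ?_,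
    fun x hx hx0 => by omega⟩
  · obtain rfl : x = 0 := by omega
    rw [hq]; exact s.2
  · rw [hpar s s.2, if_pos rfl]
  · rw [hpar v hv]
    constructor
    · intro h
      refine ⟨0, Nat.one_pos, ?_⟩
      by_contra hne
      exact h (if_neg fun h' => hne (by rw [hq, h']))
    · rintro ⟨x, hx, rfl⟩
      obtain rfl : x = 0 := by omega
      rw [if_pos hq]; exact one_ne_zero

/-- A state of the walk from `t` back to `s`: the vertex `v` has been reached, along the arcs in `A`. -/
def IsWalk (G : MultiDigraph (Fin n) (Fin m)) (t : Fin n) (W : Finset (Fin m × Bool)) (q : ℕ → ℕ) (T x : ℕ)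
    (A : Finset (Fin m × Bool)) (v : Fin n) : Prop :=
  x < T ∧ q x = v ∧ A ⊆ W ∧ (∀ a ∈ A, ∃ y, x < y ∧ y < T ∧ q y = (ahd G a : Fin n)) ∧
    ∀ z, ∑ a ∈ A, dif (atl G a) (ahd G a) z = dif v t z

/-- A parent arc starts earlier in the queue than it ends. So the position decreases, the walk
terminates, and no edge is used twice. -/
theorem Scheme.IsSearch.walk_step {i j : ℕ} {F Φ : Finset (Fin m)} (h : D.IsSearch (D.usable i j F Φ) par q T)
    {x : ℕ} {A : Finset (Fin m × Bool)} {v : Fin n} (hw : IsWalk G t (D.usable i j F Φ) q T x A v) {a : ℕ}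
    (ha : par v = a + 2) : a < D.k * D.M ∧ (D.arc a).1 ∉ A.image Prod.fst ∧
      ∃ y < x, IsWalk G t (D.usable i j F Φ) q T y (insert (D.arc a) A) (atl G (D.arc a)) := by
  obtain ⟨h1, h2, h3, h4, h5⟩ := hw
  have hx : 0 < x := by
    rcases Nat.eq_zero_or_pos x with rfl | hx
    · have : par v = 1 := by rw [← h2, h.zero, h.par_zero]
      omega
    · exact hx
  obtain ⟨b, g1, g2, g3, g4, y, g5, g6⟩ := h.parent x h1 hx
  obtain rfl : b = a := by rw [h2] at g1; omega
  have hnot : (D.arc b).1 ∉ A.image Prod.fst := by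
    rw [Finset.mem_image]
    rintro ⟨c, hc, hcb⟩
    -- Only one orientation of an edge is residual, so equal edges mean equal arcs; but the heads of
    -- the arcs in `A` come strictly later than `x` in the queue.
    obtain rfl : c = D.arc b := by
      have c1 := (Finset.mem_filter.1 (h3 hc)).1
      have c2 := (Finset.mem_filter.1 g3).1
      rw [mem_resArcs] at c1 c2
      refine Prod.ext hcb (Bool.eq_iff_iff.2 ?_)
      rw [c1, c2, hcb]
    obtain ⟨z, z1, z2, z3⟩ := h4 _ hc
    have := h.inj x h1 z z2 (by rw [z3, g4])
    omega
  refine ⟨g2, hnot, y, g5, by omega, g6, Finset.insert_subset_iff.2 ⟨g3, h3⟩, fun c hc => ?_, fun z => ?_⟩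
  · rcases Finset.mem_insert.1 hc with rfl | hc
    · exact ⟨x, g5, h1, g4.symm⟩
    · obtain ⟨z, z1, z2⟩ := h4 c hc
      exact ⟨z, by omega, z2⟩
  · rw [Finset.sum_insert fun hc => hnot (Finset.mem_image_of_mem _ hc), h5]
    have : ahd G (D.arc b) = v := Fin.ext (g4.trans h2)
    rw [this, dif_add_dif]

/-- The flow set that differs from the original one in `Φ` avoids `F`, and its value is `c`. -/
structure Scheme.IsFlip (D : Scheme G s t) (i j : ℕ) (F Φ : Finset (Fin m)) (c : ℤ) : Prop where
  subset : Φ ⊆ D.B i ∪ D.B j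
  flow : IsFlowSet G s t (symmDiff D.P.supp Φ) c
  disjoint : Disjoint (symmDiff D.P.supp Φ) F

variable {i j : ℕ} {F Φ : Finset (Fin m)} {c : ℤ}

/-- Usable arcs avoid `F` and stay in the two backup graphs, so both restrictions survive the
augmentation. -/
theorem Scheme.IsFlip.augment (h : D.IsFlip i j F Φ c) {A : Finset (Fin m × Bool)}
    (hA : A ⊆ D.usable i j F Φ) (hd : ∀ z, ∑ a ∈ A, dif (atl G a) (ahd G a) z = dif s t z) :
    D.IsFlip i j F (symmDiff Φ (A.image Prod.fst)) (c + 1) := by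
  have hA' : ∀ e ∈ A.image Prod.fst, e ∈ D.B i ∪ D.B j ∧ e ∉ F := by
    intro e he
    obtain ⟨a, ha, rfl⟩ := Finset.mem_image.1 he
    exact (Finset.mem_filter.1 (hA ha)).2
  refine ⟨fun e he => ?_, fun v => ?_, Finset.disjoint_left.2 fun e he hF => ?_⟩
  · rcases Finset.mem_symmDiff.1 he with h' | h'
    · exact h.subset h'.1
    · exact (hA' e h'.1).1
  · rw [← symmDiff_assoc, znet_symmDiff (hA.trans (Finset.filter_subset _ _)), h.flow v, hd]
    ring
  · rw [← symmDiff_assoc] at he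
    rcases Finset.mem_symmDiff.1 he with h' | h'
    · exact Finset.disjoint_left.1 h.disjoint h'.1 hF
    · exact (hA' e h'.1).2 hF

/-- There is a cut of capacity at most `c` in the graph without `F`. -/
def HasCut (G : MultiDigraph (Fin n) (Fin m)) (s t : Fin n) (F : Finset (Fin m)) (c : ℤ) : Prop :=
  ∃ X : Finset (Fin n), s ∈ X ∧ t ∉ X ∧
    ((Finset.univ.filter fun e => e ∉ F ∧ G.src e ∈ X ∧ G.tgt e ∉ X).card : ℤ) ≤ c

theorem HasCut.mono {c' : ℤ} (h : HasCut G s t F c) (hc : c ≤ c') : HasCut G s t F c' := by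
  obtain ⟨X, h1, h2, h3⟩ := h
  exact ⟨X, h1, h2, h3.trans hc⟩

/-- When the search misses `t`, the visited vertices form a cut saturated within the backup graphs,
and `PathSystem.exists_cut_of_saturated` applies. -/
theorem Scheme.IsFlip.hasCut (h : D.IsFlip i j F Φ c) (hF : F.card ≤ 2) (hi : i < D.k) (hj : j < D.k)
    (hFij : F ∩ D.P.supp ⊆ D.P.edges i ∪ D.P.edges j) (hs : D.IsSearch (D.usable i j F Φ) par q T)
    (ht : par t = 0)
    (hcl : ∀ a ∈ D.usable i j F Φ, par (atl G a : Fin n) ≠ 0 → par (ahd G a : Fin n) ≠ 0) :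
    HasCut G s t F c := by
  refine D.P.exists_cut_of_saturated D.max D.backup hF hi hj hFij h.flow h.disjoint ?_
    (X := Finset.univ.filter fun v : Fin n => par v ≠ 0) ?_ ?_ ?_
  · intro e he _
    have : e ∉ Φ := fun h' => he (h.subset h')
    simp [Finset.mem_symmDiff, this]
  · simp [hs.par_zero]
  · simp [ht]
  · intro e he heF
    simp only [Finset.mem_filter, Finset.mem_univ, true_and]
    constructor
    · intro h1 h2
      by_contra hS
      refine h2 (hcl (e, true) (Finset.mem_filter.2 ⟨?_, he, heF⟩) h1)
      simpa [mem_resArcs] using hS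
    · intro h1 h2 hS
      refine h1 (hcl (e, false) (Finset.mem_filter.2 ⟨?_, he, heF⟩) h2)
      simpa [mem_resArcs] using hS

/-- The paths of the failing edges are dropped. -/
theorem Scheme.isFlip_edges (hi : i < D.k) (hj : j < D.k)
    (hFij : F ∩ D.P.supp ⊆ D.P.edges i ∪ D.P.edges j) :
    ∃ c : ℤ, D.k ≤ c + 2 ∧ D.IsFlip i j F (D.P.edges i ∪ D.P.edges j) c := by
  have hi' := D.P.edges_subset_supp hi
  have hj' := D.P.edges_subset_supp hj
  have hsub : D.P.edges i ∪ D.P.edges j ⊆ D.P.supp := Finset.union_subset hi' hj'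
  have hS : symmDiff D.P.supp (D.P.edges i ∪ D.P.edges j) = D.P.supp \ (D.P.edges i ∪ D.P.edges j) := by
    ext e
    have := @hsub e
    simp only [Finset.mem_symmDiff, Finset.mem_sdiff]
    tauto
  have h1 : D.P.edges i ∪ D.P.edges j ⊆ D.B i ∪ D.B j :=
    Finset.union_subset_union (D.backup i hi).1 (D.backup j hj).1
  have h2 : Disjoint (D.P.supp \ (D.P.edges i ∪ D.P.edges j)) F :=
    Finset.disjoint_left.2 fun e he hF => (Finset.mem_sdiff.1 he).2
      (hFij (Finset.mem_inter.2 ⟨hF, (Finset.mem_sdiff.1 he).1⟩))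
  -- The value drops by the number of distinct paths, so two augmentations always suffice to regain
  -- `k`.
  by_cases hij : i = j
  · subst hij
    refine ⟨D.k - 1, by omega, h1, fun v => ?_, by rwa [hS]⟩
    rw [hS, Finset.union_self, znet_sdiff hi', D.P.isFlowSet v, znet_edges D.P hi]; ring
  · refine ⟨D.k - 2, by omega, h1, fun v => ?_, by rwa [hS]⟩
    rw [hS, znet_sdiff hsub, D.P.isFlowSet v, znet_union, znet_edges D.P hi, znet_edges D.P hj]
    · ring
    · exact Finset.disjoint_left.2 fun e h h' => hij (D.P.edges_disjoint hi hj h h')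

end FTFlow

/-! ### The program that reports the changes -/

namespace FTFlow

open WordRAM

variable {w : ℕ} {L : List ℕ} {n m : ℕ} {G : MultiDigraph (Fin n) (Fin m)} {s t : Fin n}
  {D : Scheme G s t} {R : ℕ}

/-- The rule for loops in which the variable `r` counts up to `N`. -/
theorem Trip.count {r : Fin 32} {b : Exp} {c : Cmd} {N : ℕ} (J : ℕ → St → Prop)
    (hJ : ∀ x σ, J x σ → σ.v r = x ∧ b.ok w L σ ∧ b.ev L σ = N)
    (hbody : ∀ x σ, x < N → J x σ → c.wp w L (J (x + 1)) σ) {x : ℕ} {σ : St} (hx : x ≤ N) (h : J x σ) :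
    Trip w L (.loop (.var r) b c) σ ((N - x) * (b.size + 6 + c.cost) + (b.size + 6)) (J N) := by
  have key := Trip.loop (w := w) (L := L) (a := .var r) (b := b) (c := c)
    (fun φ σ => ∃ x ≤ N, J x σ ∧ φ = (N - x) * (b.size + 6 + c.cost))
    (fun φ σ ⟨x, _, h, _⟩ => ⟨trivial, (hJ x σ h).2.1⟩) (fun φ σ ⟨x, hx, h, hφ⟩ hlt => by
      obtain ⟨h1, -, h2⟩ := hJ x σ h
      rw [Exp.ev_var, h1, h2] at hlt
      have h3 : (N - x) * (b.size + 6 + c.cost) =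
          (N - (x + 1)) * (b.size + 6 + c.cost) + (b.size + 6 + c.cost) := by
        rw [show N - x = N - (x + 1) + 1 by omega, Nat.succ_mul]
      refine ⟨c.cost, by rw [hφ, h3, Exp.size_var]; omega, (hbody x σ hlt h).trip.mono le_rfl fun σ' h' =>
        ⟨_, ?_, x + 1, hlt, h', rfl⟩⟩
      rw [hφ, h3, Exp.size_var]; omega) ⟨x, hx, h, rfl⟩
  refine key.mono (by rw [Exp.size_var]; omega) fun σ' ⟨h1, φ', x', hx', h', _⟩ => ?_
  obtain ⟨h2, -, h3⟩ := hJ x' σ' h'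
  rw [Exp.ev_var, h2, h3] at h1
  obtain rfl : x' = N := by omega
  exact h'

/-- Report the changes after the failure of one edge. -/
def reportOneCmd : Cmd :=
  lookup 1 4 ;;
  .ite (cst 0) (.dat 5 (.var 4))
    (.assign 5 (.dat 5 (.var 4) - cst 1) ;;
      .assign 9 (.dat 8 (.var 4)) ;;
      .loop (.var 9) (.dat 9 (.var 4))
        (.assign 14 (.dat 13 (.var 5 * hdr 0 + .var 9)) ;;
          .ite (cst 0) ((Exp.var 14).dist (.var 1)) (.emit (.var 14)) .skip ;;
          .assign 9 (.var 9 + cst 1)) ;;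
      .assign 9 (cst 0) ;;
      .loop (.var 9) (hdr 0)
        (.assign 10 (.var 5 * hdr 0 + .var 9) ;;
          .ite (cst 0) (.dat 11 (.var 10))
            (.ite ((Exp.dat 12 (.var 10)).dist (.dat 10 (.var 4))) (cst 1)
              (.emit (.dat 11 (.var 10) - cst 1)) .skip) .skip ;;
          .assign 9 (.var 9 + cst 1)))
    .skip

/-- Mark the edges of path number `x_c`. -/
def markCmd (c : Fin 32) : Cmd :=
  .assign 9 (cst 0) ;;
  .loop (.var 9) (.dat 14 (.var c))
    (.store 0 (.dat 13 (.var c * hdr 0 + .var 9)) (cst 1) ;;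
      .assign 9 (.var 9 + cst 1))

/-- Reset the table of parents. -/
def resetCmd : Cmd :=
  .assign 9 (cst 0) ;;
  .loop (.var 9) (hdr 0)
    (.store 1 (.var 9) (cst 0) ;;
      .assign 9 (.var 9 + cst 1))

/-- Follow the arcs of backup graph number `x_c` that leave the vertex `x_11`. -/
def scanCmd (c : Fin 32) : Cmd :=
  .assign 12 (.dat 15 (.var c * (hdr 0 + cst 1) + .var 11)) ;;
  .assign 13 (.dat 15 (.var c * (hdr 0 + cst 1) + (.var 11 + cst 1))) ;;
  .loop (.var 12) (.var 13)
    (.assign 14 (.dat 17 (.var 12)) ;;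
      .assign 15 (.dat 18 (.var 12)) ;;
      -- The sum is `0` exactly if the arc is residual for the current flow and its head is
      -- unvisited.
      .ite ((Exp.mem 0 (.var 14)).dist (.dat 20 (.var 12)) + .mem 1 (.var 15)) (cst 1)
        (.ite (cst 0) ((Exp.var 14).dist (.var 1))
          (.ite (cst 0) ((Exp.var 14).dist (.var 2))
            (.store 1 (.var 15) (.var 12 + cst 2) ;;
              .store 2 (.var 10) (.var 15) ;;
              .assign 10 (.var 10 + cst 1)) .skip) .skip) .skip ;;
      .assign 12 (.var 12 + cst 1))

/-- Search from the source. -/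
def searchCmd : Cmd :=
  .store 1 (hdr 1) (cst 1) ;;
  .store 2 (cst 0) (hdr 1) ;;
  .assign 9 (cst 0) ;;
  .assign 10 (cst 1) ;;
  .loop (.var 9) (.var 10)
    (.assign 11 (.mem 2 (.var 9)) ;;
      scanCmd 5 ;;
      scanCmd 6 ;;
      .assign 9 (.var 9 + cst 1))

/-- Walk from the sink, if it has been found, back to the source, and change the flow on the way. -/
def walkCmd : Cmd :=
  .assign 11 (hdr 2) ;;
  -- Entry `0` means that the sink was not found and entry `1` marks the source; both end the walk.
  .loop (cst 1) (.mem 1 (.var 11))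
    (.assign 12 (.mem 1 (.var 11) - cst 2) ;;
      .assign 14 (.dat 17 (.var 12)) ;;
      .store 0 (.var 14) (cst 1 - .mem 0 (.var 14)) ;;
      .assign 11 (.dat 19 (.var 12)))

/-- Report the marked edges of backup graph number `x_c`. -/
def flushCmd (c : Fin 32) : Cmd :=
  .assign 12 (.dat 15 (.var c * (hdr 0 + cst 1))) ;;
  .assign 13 (.dat 15 (.var c * (hdr 0 + cst 1) + hdr 0)) ;;
  .loop (.var 12) (.var 13)
    (.assign 14 (.dat 17 (.var 12)) ;;
      .ite (cst 0) (.mem 0 (.var 14))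
        -- The mark is erased so that an edge with several arcs in the two backup graphs is reported
        -- only once.
        (.store 0 (.var 14) (cst 0) ;;
          .ite (cst 0) ((Exp.var 14).dist (.var 1))
            (.ite (cst 0) ((Exp.var 14).dist (.var 2)) (.emit (.var 14)) .skip) .skip) .skip ;;
      .assign 12 (.var 12 + cst 1))

/-- One augmentation. -/
def augmentCmd : Cmd := resetCmd ;; searchCmd ;; walkCmd

/-- Report the changes after the failure of two edges. -/
def reportTwoCmd : Cmd :=
  lookup 1 4 ;;
  .assign 5 (.dat 5 (.var 4) - cst 1) ;;
  lookup 2 4 ;;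
  .assign 6 (.dat 5 (.var 4) - cst 1) ;;
  markCmd 5 ;; markCmd 6 ;; augmentCmd ;; augmentCmd ;; flushCmd 5 ;; flushCmd 6

/-- The program for the first kind of query. -/
def reportCmd : Cmd :=
  .ite (cst 0) (hdr 0)
    (.ite (.var 0) (cst 2)
      (.ite (cst 0) (.var 0) reportOneCmd .skip)
      -- The failing edges are sorted, so the answer does not depend on the order of the input.
      -- Variable 3 is cleared to make the state the same as for sorted input.
      (.ite (.var 2) (.var 1)
        (.assign 3 (.var 1) ;; .assign 1 (.var 2) ;; .assign 2 (.var 3) ;; .assign 3 (cst 0)) .skip ;;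
        reportTwoCmd))
    .skip

/-- The marked edges are those in `Φ`. -/
def Flips (σ : St) (Φ : Finset (Fin m)) : Prop := ∀ e : Fin m, σ.m 0 e = if e ∈ Φ then 1 else 0

/-- The states `σ` and `σ'` agree on the first nine variables. -/
def SameVars (σ σ' : St) : Prop := ∀ r : Fin 32, r < 9 → σ'.v r = σ.v r

theorem SameVars.refl (σ : St) : SameVars σ σ := fun _ _ => rfl

theorem SameVars.trans {σ₁ σ₂ σ₃ : St} (h : SameVars σ₁ σ₂) (h' : SameVars σ₂ σ₃) : SameVars σ₁ σ₃ :=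
  fun r hr => (h' r hr).trans (h r hr)

theorem SameVars.set {σ σ' : St} (h : SameVars σ σ') {r : Fin 32} (hr : 9 ≤ r) (x : ℕ) :
    SameVars σ (σ'.set r x) := fun r' hr' => by
  rw [St.set_v, if_neg (by intro h; subst h; omega)]; exact h r' hr'

theorem SameVars.put {σ σ' : St} (h : SameVars σ σ') (c : Fin 4) (a x : ℕ) :
    SameVars σ (σ'.put c a x) := h

theorem SameVars.app {σ σ' : St} (h : SameVars σ σ') (x : ℕ) : SameVars σ (σ'.app x) := h

theorem Flips.set_one {σ : St} {Φ : Finset (Fin m)} (h : Flips σ Φ) (e : Fin m) :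
    Flips (σ.put 0 e 1) (insert e Φ) := fun e' => by
  rw [St.put_m, h e']
  by_cases he : e' = e
  · simp [he]
  · have : (e' : ℕ) ≠ e := fun h => he (Fin.ext h)
    simp [he, this]

theorem Flips.set_zero {σ : St} {Φ : Finset (Fin m)} (h : Flips σ Φ) (e : Fin m) :
    Flips (σ.put 0 e 0) (Φ.erase e) := fun e' => by
  rw [St.put_m, h e']
  by_cases he : e' = e
  · simp [he]
  · have : (e' : ℕ) ≠ e := fun h => he (Fin.ext h)
    simp [he, this]

theorem Flips.le_one {σ : St} {Φ : Finset (Fin m)} (h : Flips σ Φ) (e : Fin m) : σ.m 0 e ≤ 1 := by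
  rw [h e]; split_ifs <;> omega

theorem Layout.trip_mark (hL : Layout D w L R) {c : Fin 32} (hc : c < 9) {i : ℕ} (hi : i < D.k) {σ : St}
    (hv : σ.v c = i) {Φ : Finset (Fin m)} (hΦ : Flips σ Φ) :
    Trip w L (markCmd c) σ (100 * n) fun σ' => SameVars σ σ' ∧ σ'.out = σ.out ∧
      Flips σ' (Φ ∪ D.P.edges i) := by
  have w1 := hL.word₁
  have w0 := hL.size₀
  have hnR := hL.n_le
  have hkR := hL.k_le
  have hlen := D.len_lt hi
  have hc9 : c ≠ 9 := hc.ne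
  have hn : 0 < n := s.pos
  refine ((Cmd.wp.trip (c := .assign 9 (cst 0)) (Q := fun σ' => σ' = σ.set 9 0) ⟨by simp, rfl⟩).seq
    fun σ₁ h₁ => ?_).mono (T := 3 + ((D.P.len i - 0) * 42 + 13)) ?_ fun _ h => h
  swap
  · omega
  subst h₁
  refine (Trip.count (fun x σ' => σ'.v 9 = x ∧ x ≤ D.P.len i ∧ SameVars σ σ' ∧ σ'.out = σ.out ∧
    Flips σ' (Φ ∪ (Finset.range x).image (D.P.edge i))) (N := D.P.len i) ?_ ?_ (Nat.zero_le _) ?_).mono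
    ?_ fun σ' h => ⟨h.2.2.1, h.2.2.2.1, h.2.2.2.2⟩
  · rintro x σ' ⟨h1, h2, h3, h4, h5⟩
    have h6 : σ'.v c = i := (h3 c hc).trans hv
    refine ⟨h1, ?_, ?_⟩
    · simp only [Exp.ok_dat, Exp.ok_var, Exp.ev_var, true_and, h6]; omega
    · rw [Exp.ev_dat, Exp.ev_var, h6, hL.len_eq i hi]
  · rintro x σ' hx ⟨h1, h2, h3, h4, h5⟩
    have h6 : σ'.v c = i := (h3 c hc).trans hv
    have h7 := hL.idx_lt hi (show x < n by omega)
    have h8 := (D.P.edge i x).2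
    simp only [Cmd.wp, Exp.ok_mul, Exp.ok_add, Exp.ok_dat, Exp.ok_const, Exp.ok_var, Exp.ev_mul, Exp.ev_add,
      Exp.ev_dat, Exp.ev_const, Exp.ev_var, true_and, St.put_v, h6, h1, hL.hdr_n, hL.edge_eq i hi x hx]
    refine ⟨by (repeat' refine And.intro ?_ ?_) <;> omega, by omega, by simp only [Fin.val_zero]; omega,
      by omega, ?_⟩
    refine ⟨by simp, by omega, (h3.put _ _ _).set le_rfl _, h4, ?_⟩
    have := h5.set_one (D.P.edge i x)
    rwa [← Finset.union_insert, ← Finset.image_insert, ← Finset.range_add_one] at this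
  · exact ⟨by simp, Nat.zero_le _, (SameVars.refl σ).set le_rfl _, rfl, by
      rw [Finset.range_zero, Finset.image_empty, Finset.union_empty]; exact hΦ⟩
  · simp [Cmd.cost]

/-- The table of parents and the queue are stored in columns 1 and 2 of the working memory. -/
theorem Layout.trip_reset (hL : Layout D w L R) (σ : St) :
    Trip w L resetCmd σ (100 * n) fun σ' => SameVars σ σ' ∧ σ'.out = σ.out ∧ σ'.m 0 = σ.m 0 ∧
      ∀ v < n, σ'.m 1 v = 0 := by
  have w1 := hL.word₁
  have w0 := hL.size₀
  have hnR := hL.n_le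
  have hn : 0 < n := s.pos
  refine ((Cmd.wp.trip (c := .assign 9 (cst 0)) (Q := fun σ' => σ' = σ.set 9 0) ⟨by simp, rfl⟩).seq
    fun σ₁ h₁ => ?_).mono (T := 3 + ((n - 0) * 26 + 12)) ?_ fun _ h => h
  swap
  · omega
  subst h₁
  refine (Trip.count (fun x σ' => σ'.v 9 = x ∧ x ≤ n ∧ SameVars σ σ' ∧ σ'.out = σ.out ∧
    σ'.m 0 = σ.m 0 ∧ ∀ v < x, σ'.m 1 v = 0) (N := n) ?_ ?_ (Nat.zero_le _) ?_).mono
    ?_ fun σ' h => h.2.2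
  · rintro x σ' ⟨h1, h2, h3, h4, h5⟩
    refine ⟨h1, ?_, ?_⟩
    · simp only [Exp.ok_dat, Exp.ok_const, Exp.ev_const]; omega
    · rw [Exp.ev_dat, Exp.ev_const, hL.hdr_n]
  · rintro x σ' hx ⟨h1, h2, h3, h4, h5, h6⟩
    simp only [Cmd.wp, Exp.ok_add, Exp.ok_const, Exp.ok_var, Exp.ev_add,
      Exp.ev_const, Exp.ev_var, true_and, St.put_v, h1]
    refine ⟨by omega, by simp only [Fin.val_one]; omega, by omega, ?_⟩
    refine ⟨by simp, by omega, (h3.put _ _ _).set le_rfl _, h4, ?_, fun v hv => ?_⟩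
    · ext a; simp [h5]
    · simp only [St.set_m, St.put_m, true_and]
      split_ifs with hvx
      · rfl
      · exact h6 v (by omega)
  · exact ⟨by simp, Nat.zero_le _, (SameVars.refl σ).set le_rfl _, rfl, rfl, by omega⟩
  · simp [Cmd.cost]

theorem Layout.arc_mem (hL : Layout D w L R) {i : ℕ} (hi : i < D.k) {v h : ℕ} (hv : v < n)
    (h1 : D.start i v ≤ h) (h2 : h < D.start i (v + 1)) :
    h < D.k * D.M ∧ h < R ∧ (D.arc h).1 ∈ D.B i ∧ ((atl G (D.arc h) : Fin n) : ℕ) = v := by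
  have h3 : D.start i (v + 1) ≤ D.start i n := D.start_mono i hv
  have h4 := D.start_le_mul i hi
  have h5 := hL.size₂
  obtain ⟨h6, h7⟩ := D.arc_mem i hi ⟨v, hv⟩ h h1 h2
  exact ⟨by omega, by omega, h6, by rw [h7]⟩

/-- The invariant of the scan of the arcs that are numbered from `lo` to `hi`. -/
structure Scheme.ScanInv (D : Scheme G s t) (W : Finset (Fin m × Bool)) (σ : St) (T lo hi x : ℕ) (σ' : St) :
    Prop where
  ptr : σ'.v 12 = x
  limit : σ'.v 13 = hi
  le : lo ≤ x
  vars : SameVars σ σ'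
  v9 : σ'.v 9 = σ.v 9
  v11 : σ'.v 11 = σ.v 11
  out : σ'.out = σ.out
  flips : σ'.m 0 = σ.m 0
  search : ∃ T', T ≤ T' ∧ σ'.v 10 = T' ∧ D.IsSearch W (σ'.m 1) (σ'.m 2) T'
  queue : ∀ x < T, σ'.m 2 x = σ.m 2 x
  visited : ∀ v, σ.m 1 v ≠ 0 → σ'.m 1 v ≠ 0
  done : ∀ h, lo ≤ h → h < x → D.arc h ∈ W → σ'.m 1 (ahd G (D.arc h) : Fin n) ≠ 0

/-- The time is proportional to the number of arcs that leave the scanned vertex in this backup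
graph. Afterwards all heads of its usable arcs there have been visited. -/
theorem Layout.trip_scan (hL : Layout D w L R) {c : Fin 32} (hc : c < 9) {i j : ℕ} (hi : i < D.k)
    (hj : j < D.k) {i' : ℕ} (hi' : i' = i ∨ i' = j) {σ : St} (hv : σ.v c = i') {Φ : Finset (Fin m)}
    (hΦ : Flips σ Φ) {e₁ e₂ : Fin m} (he₁ : σ.v 1 = e₁) (he₂ : σ.v 2 = e₂) {H T : ℕ}
    (hH : H < T) (hT : σ.v 10 = T)
    (hs : D.IsSearch (D.usable i j {e₁, e₂} Φ) (σ.m 1) (σ.m 2) T) (h11 : σ.v 11 = σ.m 2 H) :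
    Trip w L (scanCmd c) σ (200 * (D.start i' (σ.m 2 H + 1) - D.start i' (σ.m 2 H)) + 200) fun σ' =>
      SameVars σ σ' ∧ σ'.v 9 = σ.v 9 ∧ σ'.v 11 = σ.v 11 ∧ σ'.out = σ.out ∧ σ'.m 0 = σ.m 0 ∧ ∃ T', T ≤ T' ∧
      σ'.v 10 = T' ∧ D.IsSearch (D.usable i j {e₁, e₂} Φ) (σ'.m 1) (σ'.m 2) T' ∧
      (∀ x < T, σ'.m 2 x = σ.m 2 x) ∧ (∀ v, σ.m 1 v ≠ 0 → σ'.m 1 v ≠ 0) ∧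
      ∀ a ∈ D.usable i j {e₁, e₂} Φ, a.1 ∈ D.B i' → ((atl G a : Fin n) : ℕ) = σ.m 2 H →
        σ'.m 1 (ahd G a : Fin n) ≠ 0 := by
  have w1 := hL.word₁
  have w0 := hL.size₀
  have hnR := hL.n_le
  have hn : 0 < n := s.pos
  have hi'k : i' < D.k := by rcases hi' with rfl | rfl <;> assumption
  have hkR := hL.k_le
  have hu : σ.m 2 H < n := hs.lt H hH
  set u := σ.m 2 H with hudef
  have hidx : i' * (n + 1) + (u + 1) < R := by
    have h1 := hL.size₁
    have : (i' + 1) * (n + 1) ≤ D.k * (n + 1) := Nat.mul_le_mul_right _ hi'k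
    nlinarith
  have hc12 : c ≠ 12 := by intro h; subst h; omega
  have hstart := D.start_mono i' (Nat.le_succ u)
  have hstart' : D.start i' (u + 1) ≤ R :=
    (D.start_mono i' hu).trans ((D.start_le_mul i' hi'k).trans hL.size₂)
  refine ((Cmd.wp.trip (c := .assign 12 _) (Q := fun σ' => σ' = σ.set 12 (D.start i' u)) ?_).seq
    (T₂ := 50 + 200 * (D.start i' (u + 1) - D.start i' u) + 10) fun σ₁ h₁ => ?_).mono ?_ fun _ h => h
  · simp only [Cmd.wp, Exp.ok_mul, Exp.ok_add, Exp.ok_dat, Exp.ok_const, Exp.ok_var, Exp.ev_mul, Exp.ev_add,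
      Exp.ev_dat, Exp.ev_const, Exp.ev_var, true_and, hv, h11, hL.hdr_n]
    refine ⟨by (repeat' refine And.intro ?_ ?_) <;> omega, ?_⟩
    rw [hL.start_eq i' hi'k u hu.le]
  swap
  · simp [Cmd.cost]
    omega
  subst h₁
  refine ((Cmd.wp.trip (c := .assign 13 _) (Q := fun σ' => σ' = (σ.set 12 (D.start i' u)).set 13
    (D.start i' (u + 1))) ?_).seq
    (T₂ := 200 * (D.start i' (u + 1) - D.start i' u) + 8) fun σ₁ h₁ => ?_).mono ?_ fun _ h => h
  · simp only [Cmd.wp, Exp.ok_mul, Exp.ok_add, Exp.ok_dat, Exp.ok_const, Exp.ok_var, Exp.ev_mul, Exp.ev_add,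
      Exp.ev_dat, Exp.ev_const, Exp.ev_var, true_and, St.set_v, Fin.reduceEq, hc12, if_false, hv, h11, hL.hdr_n]
    refine ⟨by (repeat' refine And.intro ?_ ?_) <;> omega, ?_⟩
    rw [hL.start_eq i' hi'k (u + 1) hu]
  swap
  · simp [Cmd.cost]
    omega
  subst h₁
  set W := D.usable i j {e₁, e₂} Φ with hW
  refine (Trip.count (D.ScanInv W σ T (D.start i' u) (D.start i' (u + 1))) (N := D.start i' (u + 1)) ?_ ?_
    hstart ?_).mono ?_ fun σ' h => ?_
  · exact fun x σ' h => ⟨h.ptr, trivial, h.limit⟩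
  · intro x σ' hx h
    obtain ⟨k1, k2, k3, k4⟩ := hL.arc_mem hi'k hu h.le hx
    obtain ⟨T', hTT', h10, hs'⟩ := h.search
    have hT'n := hs'.le
    have hem := (D.arc x).1.2
    have hvn := (ahd G (D.arc x) : Fin n).2
    have hflip : σ'.m 0 (D.arc x).1 = if (D.arc x).1 ∈ Φ then 1 else 0 := by rw [h.flips]; exact hΦ _
    have hle : σ'.m 0 (D.arc x).1 ≤ 1 := by rw [hflip]; split_ifs <;> omega
    have hκ := hL.arc_flip x k1
    have hκle : datCol L 20 x ≤ 1 := by rw [hκ]; split_ifs <;> omega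
    have hx1 : σ'.v 1 = e₁ := (h.vars 1 (by decide)).trans he₁
    have hx2 : σ'.v 2 = e₂ := (h.vars 2 (by decide)).trans he₂
    have he1m := e₁.2
    have he2m := e₂.2
    have hmem : D.arc x ∈ W ↔ σ'.m 0 (D.arc x).1 = datCol L 20 x ∧ (D.arc x).1 ≠ e₁ ∧ (D.arc x).1 ≠ e₂ := by
      have hB : (D.arc x).1 ∈ D.B i ∪ D.B j := by
        rcases hi' with rfl | rfl
        · exact Finset.mem_union_left _ k3
        · exact Finset.mem_union_right _ k3
      rw [hW, Scheme.mem_usable, hflip, hκ]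
      simp only [hB, Finset.mem_insert, Finset.mem_singleton, not_or, true_and]
      refine and_congr_left fun _ => ?_
      by_cases g1 : (D.arc x).1 ∈ Φ <;>
        by_cases g2 : ((D.arc x).2 = true ↔ (D.arc x).1 ∈ D.P.supp) <;> simp [g1, g2]
    -- Parent entries encode arc numbers, so the sum in the test does not overflow.
    have hpar : σ'.m 1 (ahd G (D.arc x) : Fin n) ≤ R + 2 := by
      by_cases hz : σ'.m 1 (ahd G (D.arc x) : Fin n) = 0
      · omega
      obtain ⟨y, hy, hyv⟩ := (hs'.visited _ hvn).1 hz
      rcases Nat.eq_zero_or_pos y with rfl | hy0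
      · rw [← hyv, hs'.zero, hs'.par_zero]; omega
      · obtain ⟨b, b1, b2, -⟩ := hs'.parent y hy hy0
        have := hL.size₂
        rw [← hyv, b1]; omega
    -- All branches that do not extend the queue end in this state.
    have hskip : (D.arc x ∈ W → σ'.m 1 (ahd G (D.arc x) : Fin n) ≠ 0) →
        D.ScanInv W σ T (D.start i' u) (D.start i' (u + 1)) (x + 1)
          (((σ'.set 14 (D.arc x).1).set 15 (ahd G (D.arc x) : Fin n)).set 12 (x + 1)) := fun hv =>
      { ptr := by simp
        limit := by simp [h.limit]
        le := h.le.trans (Nat.le_succ x)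
        vars := ((h.vars.set (by decide) _).set (by decide) _).set (by decide) _
        v9 := by simp [h.v9]
        v11 := by simp [h.v11]
        out := h.out
        flips := h.flips
        search := ⟨T', hTT', by simp [h10], hs'⟩
        queue := h.queue
        visited := h.visited
        done := fun b b1 b2 b3 => by
          rcases Nat.lt_succ_iff_lt_or_eq.1 b2 with b2 | rfl
          · exact h.done b b1 b2 b3
          · exact hv b3 }
    simp only [Cmd.wp, Exp.ok_add, Exp.ok_dat, Exp.ok_const, Exp.ok_var, Exp.ok_dist, Exp.ok_mem,
      Exp.ev_add, Exp.ev_dat, Exp.ev_const, Exp.ev_var, Exp.ev_dist, Exp.ev_mem, true_and,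
      St.set_v, St.set_m, St.put_v, Fin.reduceEq, if_true, if_false, h.ptr, hL.arc_edge x k1, hL.arc_head x k1,
      hx1, hx2, h10]
    have val0 : ((0 : Fin 4) : ℕ) = 0 := rfl
    have val1 : ((1 : Fin 4) : ℕ) = 1 := rfl
    have val2 : ((2 : Fin 4) : ℕ) = 2 := rfl
    rw [val0, val1, val2]
    refine ⟨by omega, by omega, by (repeat' refine And.intro ?_ ?_) <;> omega, by omega,
      fun h1 => ⟨by omega, by omega, fun h2 => ⟨by omega, by omega, fun h3 => ⟨by omega, by omega, by omega,
        by omega, by omega, ?_⟩, fun h3 => ⟨by omega, ?_⟩⟩, fun h2 => ⟨by omega, ?_⟩⟩, fun h1 => ⟨by omega, ?_⟩⟩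
    · have haW : D.arc x ∈ W := hmem.2 ⟨by omega, fun h => by rw [h] at h2; omega, fun h => by rw [h] at h3; omega⟩
      have hnew := hs'.push k1 haW (hH.trans_le hTT') (by rw [h.queue H hH, ← hudef, k4]) (by omega)
        (par' := fun v => if v = (ahd G (D.arc x) : Fin n) then x + 2 else σ'.m 1 v)
        (q' := fun v => if v = T' then ((ahd G (D.arc x) : Fin n) : ℕ) else σ'.m 2 v) (fun _ => rfl) fun _ => rfl
      exact
      { ptr := by simp
        limit := by simp [h.limit]
        le := h.le.trans (Nat.le_succ x)
        vars := (((((h.vars.set (by decide) _).set (by decide) _).put 1 (ahd G (D.arc x) : Fin n) (x + 2)).put 2 T'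
          (ahd G (D.arc x) : Fin n)).set (by decide) _).set (by decide) _
        v9 := by simp [h.v9]
        v11 := by simp [h.v11]
        out := h.out
        flips := by rw [← h.flips]; ext a; simp
        search := ⟨T' + 1, by omega, by simp, by convert hnew using 1 <;> ext a <;> simp⟩
        queue := fun y hy => by
          rw [← h.queue y hy]
          simp [show y ≠ T' by omega]
        visited := fun v hv => by
          have := h.visited v hv
          simp only [St.set_m, St.put_m, true_and]
          split_ifs <;> simp_all
        done := fun b b1 b2 b3 => by
          simp only [St.set_m, St.put_m, true_and]
          rcases Nat.lt_succ_iff_lt_or_eq.1 b2 with b2 | rfl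
          · have := h.done b b1 b2 b3
            split_ifs <;> simp_all
          · simp }
    · exact hskip fun h' => absurd (Fin.ext (by omega)) (hmem.1 h').2.2
    · exact hskip fun h' => absurd (Fin.ext (by omega)) (hmem.1 h').2.1
    · exact hskip fun h' => by have := (hmem.1 h').1; omega
  · exact
    { ptr := by simp
      limit := by simp
      le := le_rfl
      vars := ((SameVars.refl σ).set (by decide) _).set (by decide) _
      v9 := by simp
      v11 := by simp
      out := rfl
      flips := rfl
      search := ⟨T, le_rfl, by simp [hT], hs⟩
      queue := fun _ _ => rfl
      visited := fun _ h => h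
      done := fun b b1 b2 => by omega }
  · simp only [Cmd.cost, Exp.size_var, Exp.size_const, Exp.size_add, Exp.size_dat, Exp.size_mem, Exp.size_dist]
    omega
  · refine ⟨h.vars, h.v9, h.v11, h.out, h.flips, ?_⟩
    obtain ⟨T', h1, h2, h3⟩ := h.search
    refine ⟨T', h1, h2, h3, h.queue, h.visited, fun a ha haB hau => ?_⟩
    obtain ⟨b, b1, b2, rfl⟩ := D.exists_arc i' hi'k a haB
    rw [hau] at b1 b2
    exact h.done b b1 b2 ha

end FTFlow

/-! ### Correctness of search, augmentation and output -/

namespace FTFlow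

open WordRAM

variable {w : ℕ} {L : List ℕ} {n m : ℕ} {G : MultiDigraph (Fin n) (Fin m)} {s t : Fin n}
  {D : Scheme G s t} {R : ℕ}

theorem Trip.assign_seq {i : Fin 32} {e : Exp} {x : ℕ} {c : Cmd} {σ : St} {T : ℕ} {Q : St → Prop}
    (he : e.ok w L σ) (hx : e.ev L σ = x) (h : Trip w L c (σ.set i x) T Q) :
    Trip w L (.assign i e ;; c) σ (e.size + 2 + T) Q := by
  subst hx
  obtain ⟨σ', k, h1, h2, h3⟩ := h
  exact ⟨σ', _, (Big.assign σ i e he).seq h1, by omega, h3⟩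

theorem Trip.store_seq {c : Fin 4} {a e : Exp} {x y : ℕ} {c' : Cmd} {σ : St} {T : ℕ} {Q : St → Prop}
    (ha : a.ok w L σ) (he : e.ok w L σ) (hx : a.ev L σ = x) (hy : e.ev L σ = y) (hlt : 4 * x + c < 2 ^ w)
    (h : Trip w L c' (σ.put c x y) T Q) : Trip w L (.store c a e ;; c') σ (a.size + e.size + 5 + T) Q := by
  subst hx hy
  obtain ⟨σ', k, h1, h2, h3⟩ := h
  exact ⟨σ', _, (Big.store σ c a e ha he hlt).seq h1, by omega, h3⟩

theorem Scheme.sum_degree_le (D : Scheme G s t) (i : ℕ) :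
    ∑ v ∈ Finset.range n, (D.start i (v + 1) - D.start i v) ≤ D.M := by
  rw [Finset.sum_range_tsub (D.start_mono i)]
  have := D.start_le i
  omega

/-- The time that the search spends at the vertex `v`. -/
def Scheme.searchTime (D : Scheme G s t) (i j v : ℕ) : ℕ :=
  200 * (D.start i (v + 1) - D.start i v) + 200 * (D.start j (v + 1) - D.start j v) + 500

/-- The time that remains is the sum of `searchTime` over the vertices not yet taken from the queue.
Every vertex is taken at most once, and the degrees in each backup graph sum up to at most `D.M`. -/
theorem Layout.trip_search (hL : Layout D w L R) {i j : ℕ} (hi : i < D.k) (hj : j < D.k) {σ : St}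
    (h5 : σ.v 5 = i) (h6 : σ.v 6 = j) {Φ : Finset (Fin m)} (hΦ : Flips σ Φ) {e₁ e₂ : Fin m}
    (he₁ : σ.v 1 = e₁) (he₂ : σ.v 2 = e₂) (h0 : ∀ v < n, σ.m 1 v = 0) :
    Trip w L searchCmd σ (400 * D.M + 700 * n) fun σ' =>
      SameVars σ σ' ∧ σ'.out = σ.out ∧ σ'.m 0 = σ.m 0 ∧ ∃ T,
      D.IsSearch (D.usable i j {e₁, e₂} Φ) (σ'.m 1) (σ'.m 2) T ∧
      ∀ a ∈ D.usable i j {e₁, e₂} Φ, σ'.m 1 (atl G a : Fin n) ≠ 0 → σ'.m 1 (ahd G a : Fin n) ≠ 0 := by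
  have w1 := hL.word₁
  have w0 := hL.size₀
  have hnR := hL.n_le
  have hn : 0 < n := s.pos
  have hsn := s.2
  set W := D.usable i j {e₁, e₂} Φ with hW
  have key : ∀ σ₁ : St, σ₁ = ((((σ.put 1 s 1).put 2 0 s).set 9 0).set 10 1) →
      Trip w L (.loop (.var 9) (.var 10) (.assign 11 (.mem 2 (.var 9)) ;; scanCmd 5 ;; scanCmd 6 ;;
        .assign 9 (.var 9 + cst 1))) σ₁ (400 * D.M + 500 * n + 8) fun σ' =>
      SameVars σ σ' ∧ σ'.out = σ.out ∧ σ'.m 0 = σ.m 0 ∧ ∃ T, D.IsSearch W (σ'.m 1) (σ'.m 2) T ∧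
      ∀ a ∈ W, σ'.m 1 (atl G a : Fin n) ≠ 0 → σ'.m 1 (ahd G a : Fin n) ≠ 0 := by
    intro σ₁ h₁
    refine (Trip.loop (fun φ σ' => SameVars σ σ' ∧ σ'.out = σ.out ∧ σ'.m 0 = σ.m 0 ∧ ∃ H T, σ'.v 9 = H ∧
      σ'.v 10 = T ∧ H ≤ T ∧ D.IsSearch W (σ'.m 1) (σ'.m 2) T ∧
      (∀ x < H, ∀ a ∈ W, ((atl G a : Fin n) : ℕ) = σ'.m 2 x → σ'.m 1 (ahd G a : Fin n) ≠ 0) ∧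
      φ = ∑ v ∈ Finset.range n \ (Finset.range H).image (σ'.m 2), D.searchTime i j v)
      ?_ ?_ ?_ (φ := ∑ v ∈ Finset.range n \ (Finset.range 0).image (σ₁.m 2), D.searchTime i j v)).mono ?_ ?_
    · exact fun φ σ' _ => ⟨trivial, trivial⟩
    · rintro φ σ' ⟨g1, g2, g3, H, T, g4, g5, g6, g7, g8, rfl⟩ hlt
      rw [Exp.ev_var, Exp.ev_var, g4, g5] at hlt
      have hu := g7.lt H hlt
      set u := σ'.m 2 H with hudef
      have hTn := g7.le
      -- Taking `u` from the queue releases its share. The queue may have grown meanwhile, so any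
      -- `q` with the same first `T` entries is allowed.
      have hsum : ∀ q : ℕ → ℕ, (∀ x < T, q x = σ'.m 2 x) →
          ∑ v ∈ Finset.range n \ (Finset.range H).image (σ'.m 2), D.searchTime i j v =
          ∑ v ∈ Finset.range n \ (Finset.range (H + 1)).image q, D.searchTime i j v +
            D.searchTime i j u := by
        intro q hq
        have e1 : (Finset.range (H + 1)).image q = insert u ((Finset.range H).image (σ'.m 2)) := by
          rw [Finset.range_add_one, Finset.image_insert, hq H hlt]
          congr 1
          exact Finset.image_congr fun x hx => hq x (by have := Finset.mem_range.1 hx; omega)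
        rw [e1, Finset.sdiff_insert, Finset.sum_erase_add]
        refine Finset.mem_sdiff.2 ⟨Finset.mem_range.2 hu, fun h => ?_⟩
        obtain ⟨x, hx, hxu⟩ := Finset.mem_image.1 h
        have hx := Finset.mem_range.1 hx
        have := g7.inj x (by omega) H hlt hxu
        omega
      refine ⟨9 + ((200 * (D.start i (u + 1) - D.start i u) + 200) +
        ((200 * (D.start j (u + 1) - D.start j u) + 200) + 6)), ?_, ?_⟩
      · rw [hsum _ fun _ _ => rfl, Scheme.searchTime, Exp.size_var, Exp.size_var]; omega
      refine ((Cmd.wp.trip (c := .assign 11 _) (Q := fun σ₂ => σ₂ = σ'.set 11 u) ?_).seq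
        fun σ₂ h₂ => ?_).mono le_rfl fun _ h => h
      · simp only [Cmd.wp, Exp.ok_mem, Exp.ok_var, Exp.ev_mem, Exp.ev_var, true_and, g4]
        rw [show ((2 : Fin 4) : ℕ) = 2 from rfl]
        exact ⟨by omega, rfl⟩
      subst h₂
      have v1 : SameVars σ (σ'.set 11 u) := g1.set (by decide) _
      have f1 : Flips (σ'.set 11 u) Φ := fun e => by rw [St.set_m, g3]; exact hΦ e
      refine ((hL.trip_scan (c := 5) (by decide) hi hj (.inl rfl) ((v1 5 (by decide)).trans h5) f1
        ((v1 1 (by decide)).trans he₁) ((v1 2 (by decide)).trans he₂) hlt (by simpa using g5) g7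
        (by simp [hudef])).seq fun σ₂ h₂ => ?_)
      obtain ⟨a1, a2, a3, a4, a5, T₂, a6, a7, a8, a9, a10, a11⟩ := h₂
      have v2 := v1.trans a1
      have f2 : Flips σ₂ Φ := fun e => by rw [a5]; exact f1 e
      have u2 : σ₂.m 2 H = u := a9 H hlt
      refine (((hL.trip_scan (c := 6) (by decide) hi hj (.inr rfl) ((v2 6 (by decide)).trans h6) f2
        ((v2 1 (by decide)).trans he₁) ((v2 2 (by decide)).trans he₂) (hlt.trans_le a6) a7 a8
        (by rw [a3, u2]; simp)).mono (by rw [u2]) fun _ h => h).seq fun σ₃ h₃ => ?_)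
      obtain ⟨b1, b2, b3, b4, b5, T₃, b6, b7, b8, b9, b10, b11⟩ := h₃
      have v9 : σ₃.v 9 = H := by rw [b2, a2]; simp [g4]
      have qeq : ∀ x < T, σ₃.m 2 x = σ'.m 2 x := fun x hx => by
        rw [b9 x (by omega), a9 x hx]; rfl
      have hT₃ := b8.le
      refine (Cmd.wp.trip ?_)
      simp only [Cmd.wp, Exp.ok_add, Exp.ok_const, Exp.ok_var, Exp.ev_add, Exp.ev_const, Exp.ev_var, true_and, v9]
      refine ⟨by omega, _, ?_, (v2.trans b1).set (by decide) _, ?_, ?_, H + 1, T₃, by simp, by simp [b7],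
        by omega, b8, ?_, rfl⟩
      · rw [hsum _ qeq, Scheme.searchTime, Exp.size_var, Exp.size_var, St.set_m]; omega
      · rw [St.set_out, b4, a4]; exact g2
      · rw [St.set_m, b5, a5]; exact g3
      · intro x hx a ha hax
        rw [St.set_m] at hax ⊢
        rcases Nat.lt_succ_iff_lt_or_eq.1 hx with hx | rfl
        · rw [qeq x (by omega)] at hax
          exact b10 _ (a10 _ (g8 x hx a ha hax))
        · rw [qeq x hlt] at hax
          rcases Finset.mem_union.1 (Scheme.mem_usable.1 ha).2.1 with hB | hB
          · exact b10 _ (a11 a ha hB hax)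
          · exact b11 a ha hB (by rw [hax, u2])
    · subst h₁
      refine ⟨(((SameVars.refl σ).put 1 s 1).put 2 0 s).set (by decide) _ |>.set (by decide) _, rfl,
        by ext a; simp, 0, 1, by simp, by simp, by omega, Scheme.IsSearch.init (fun v hv => ?_) ?_,
        by omega, rfl⟩
      · simp [h0 v hv]
      · simp
    · have e1 := Finset.sum_le_sum_of_subset (f := D.searchTime i j)
        (Finset.sdiff_subset (s := Finset.range n) (t := (Finset.range 0).image (σ₁.m 2)))
      have e2 : ∑ v ∈ Finset.range n, D.searchTime i j v ≤ 400 * D.M + 500 * n := by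
        simp only [Scheme.searchTime, Finset.sum_add_distrib, ← Finset.mul_sum, Finset.sum_const,
          Finset.card_range, smul_eq_mul]
        have := D.sum_degree_le i
        have := D.sum_degree_le j
        omega
      rw [Exp.size_var, Exp.size_var]; omega
    · rintro σ' ⟨hnot, φ, g1, g2, g3, H, T, g4, g5, g6, g7, g8, -⟩
      rw [Exp.ev_var, Exp.ev_var, g4, g5] at hnot
      obtain rfl : H = T := by omega
      refine ⟨g1, g2, g3, H, g7, fun a ha hta => ?_⟩
      obtain ⟨x, hx, hxa⟩ := (g7.visited _ (Fin.is_lt _)).1 hta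
      exact g8 x hx a ha hxa.symm
  have hok : ∀ (q : ℕ) (σ' : St), q < 8 → (hdr q).ok w L σ' := by
    intro q σ' hq
    simp only [Exp.ok_dat, Exp.ok_const, Exp.ev_const]; omega
  have hco : ∀ (q : ℕ) (σ' : St), q < 8 → (cst q).ok w L σ' := by
    intro q σ' hq
    simp only [Exp.ok_const]; omega
  refine (Trip.store_seq (hok 1 _ (by omega)) (hco 1 _ (by omega)) hL.hdr_s rfl ?_
    (Trip.store_seq (hco 0 _ (by omega)) (hok 1 _ (by omega)) rfl hL.hdr_s ?_
      (Trip.assign_seq (hco 0 _ (by omega)) rfl (Trip.assign_seq (hco 1 _ (by omega)) rfl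
        (key _ rfl))))).mono ?_ fun _ h => h
  · rw [show ((1 : Fin 4) : ℕ) = 1 from rfl]; omega
  · rw [show ((2 : Fin 4) : ℕ) = 2 from rfl, Exp.ev_const]; omega
  · simp only [Exp.size_dat, Exp.size_const]; omega

theorem Flips.toggle {σ : St} {Φ I : Finset (Fin m)} (h : Flips σ (symmDiff Φ I)) {e : Fin m} (he : e ∉ I) :
    Flips (σ.put 0 e (1 - σ.m 0 e)) (symmDiff Φ (insert e I)) := fun e' => by
  rw [St.put_m, h e', h e]
  by_cases hee : e' = e
  · subst hee
    by_cases hb : e' ∈ Φ <;> simp [Finset.mem_symmDiff, hb, he]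
  · have : (e' : ℕ) ≠ e := fun h => hee (Fin.ext h)
    simp [Finset.mem_symmDiff, hee, this]

/-- The available time is measured by the position in the queue of the current vertex, which
decreases in every step. -/
theorem Layout.trip_walk (hL : Layout D w L R) {i j : ℕ} {F Φ : Finset (Fin m)} {σ : St}
    (hΦ : Flips σ Φ) {T : ℕ} (hs : D.IsSearch (D.usable i j F Φ) (σ.m 1) (σ.m 2) T) :
    Trip w L walkCmd σ (200 * n) fun σ' =>
      SameVars σ σ' ∧ σ'.out = σ.out ∧ (σ.m 1 t = 0 ∧ Flips σ' Φ ∨ ∃ A ⊆ D.usable i j F Φ,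
        (∀ z, ∑ a ∈ A, dif (atl G a) (ahd G a) z = dif s t z) ∧
        Flips σ' (symmDiff Φ (A.image Prod.fst))) := by
  have w1 := hL.word₁
  have w0 := hL.size₀
  have hnR := hL.n_le
  have hn : 0 < n := s.pos
  have htn := t.2
  have hTn := hs.le
  set W := D.usable i j F Φ with hW
  have hRM := hL.size₂
  refine (Trip.assign_seq (e := hdr 2) (x := t) ?_ hL.hdr_t (T := 100 * T + 13) ?_).mono ?_ fun _ h => h
  · simp only [Exp.ok_dat, Exp.ok_const, Exp.ev_const]; omega
  swap
  · simp only [Exp.size_dat, Exp.size_const]; omega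
  refine (Trip.loop (fun φ σ' => SameVars σ σ' ∧ σ'.out = σ.out ∧ σ'.m 1 = σ.m 1 ∧ (∃ v : Fin n, σ'.v 11 = v) ∧
    (σ.m 1 t = 0 ∧ σ'.v 11 = t ∧ Flips σ' Φ ∨ ∃ x A v, IsWalk G t W (σ.m 2) T x A v ∧ σ'.v 11 = (v : Fin n) ∧
      Flips σ' (symmDiff Φ (A.image Prod.fst)) ∧ 100 * x ≤ φ)) ?_ ?_ (φ := 100 * T) ?_).mono ?_ ?_
  · rintro φ σ' ⟨-, -, -, ⟨v, hv⟩, -⟩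
    have := v.2
    simp only [Exp.ok_const, Exp.ok_mem, Exp.ok_var, Exp.ev_var, hv, true_and]
    rw [show ((1 : Fin 4) : ℕ) = 1 from rfl]
    exact ⟨by omega, by omega⟩
  · rintro φ σ' ⟨g1, g2, g3, -, g4⟩ hlt
    rw [Exp.ev_const, Exp.ev_mem, Exp.ev_var, g3] at hlt
    rcases g4 with ⟨h0, h1, -⟩ | ⟨x, A, v, h1, h2, h3, hφ⟩
    · rw [h1, h0] at hlt; omega
    rw [h2] at hlt
    -- An entry above `1` is an arc number plus two.
    obtain ⟨a, ha⟩ : ∃ a, σ.m 1 v = a + 2 := ⟨_, (Nat.sub_add_cancel hlt).symm⟩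
    obtain ⟨k1, k2, y, k3, k4⟩ := hs.walk_step h1 ha
    have hem := (D.arc a).1.2
    have hvn := v.2
    have han := (atl G (D.arc a) : Fin n).2
    have hf := h3.le_one (D.arc a).1
    refine ⟨_, ?_, (Cmd.wp.trip (Q := fun σ₂ => SameVars σ σ₂ ∧ σ₂.out = σ.out ∧ σ₂.m 1 = σ.m 1 ∧
      σ₂.v 11 = (atl G (D.arc a) : Fin n) ∧
      Flips σ₂ (symmDiff Φ ((insert (D.arc a) A).image Prod.fst))) ?_).mono le_rfl ?_⟩
    · simp only [Cmd.cost, Exp.size_var, Exp.size_const, Exp.size_sub, Exp.size_dat, Exp.size_mem]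
      omega
    · simp only [Cmd.wp, Exp.ok_sub, Exp.ok_dat, Exp.ok_const, Exp.ok_var, Exp.ok_mem,
        Exp.ev_sub, Exp.ev_dat, Exp.ev_const, Exp.ev_var, Exp.ev_mem, true_and,
        St.set_v, St.set_m, St.put_v, Fin.reduceEq, if_true, if_false, h2, g3, ha, Nat.add_sub_cancel,
        hL.arc_edge a k1, hL.arc_tail a k1]
      rw [show ((1 : Fin 4) : ℕ) = 1 from rfl, show ((0 : Fin 4) : ℕ) = 0 from rfl]
      refine ⟨by omega, by omega, by omega, by omega, by omega,
        (((g1.set (by decide) _).set (by decide) _).put _ _ _).set (by decide) _, g2, ?_, ?_⟩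
      · ext b; simp [g3]
      · rw [Finset.image_insert]
        exact h3.toggle k2
    · rintro σ₂ ⟨a1, a2, a3, a4, a5⟩
      refine ⟨100 * y, ?_, a1, a2, a3, ⟨_, a4⟩, .inr ⟨y, _, _, k4, a4, a5, le_rfl⟩⟩
      simp only [Cmd.cost, Exp.size_var, Exp.size_const, Exp.size_sub, Exp.size_dat, Exp.size_mem]
      omega
  · refine ⟨(SameVars.refl σ).set (by decide) _, rfl, rfl, ⟨t, by simp⟩, ?_⟩
    by_cases h0 : σ.m 1 t = 0
    · exact .inl ⟨h0, by simp, hΦ⟩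
    · obtain ⟨x, hx, hxt⟩ := (hs.visited t htn).1 h0
      refine .inr ⟨x, ∅, t, ⟨hx, hxt, Finset.empty_subset _, by simp, fun z => by simp [dif_self]⟩, by simp, ?_,
        by omega⟩
      rw [Finset.image_empty, ← Finset.bot_eq_empty, symmDiff_bot]
      exact hΦ
  · simp only [Exp.size_var, Exp.size_const, Exp.size_mem]; omega
  · rintro σ' ⟨hnot, φ, g1, g2, g3, -, g4⟩
    refine ⟨g1, g2, ?_⟩
    rcases g4 with ⟨h0, -, h1⟩ | ⟨x, A, v, h1, h2, h3, -⟩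
    · exact .inl ⟨h0, h1⟩
    · rw [Exp.ev_const, Exp.ev_mem, Exp.ev_var, g3, h2] at hnot
      refine .inr ⟨A, h1.2.2.1, ?_, h3⟩
      -- The walk ended at an entry of at most `1`, whereas every found vertex other than the source
      -- has an entry of at least `2`.
      obtain rfl : v = s := by
        rcases Nat.eq_zero_or_pos x with rfl | hx
        · exact Fin.ext (h1.2.1.symm.trans hs.zero)
        · obtain ⟨b, b1, -⟩ := hs.parent x h1.1 hx
          rw [h1.2.1] at b1
          omega
      exact h1.2.2.2.2

/-- A bound on the running time of an augmentation. -/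
def augmentTime (n M : ℕ) : ℕ := 400 * M + 1000 * n

/-- Either the sink is found and the value grows by one, or the search itself proves the current
flow optimal. -/
theorem Layout.trip_augment (hL : Layout D w L R) {i j : ℕ} (hi : i < D.k) (hj : j < D.k) {σ : St}
    (h5 : σ.v 5 = i) (h6 : σ.v 6 = j) {Φ : Finset (Fin m)} (hΦ : Flips σ Φ) {e₁ e₂ : Fin m}
    (he₁ : σ.v 1 = e₁) (he₂ : σ.v 2 = e₂) (hFij : {e₁, e₂} ∩ D.P.supp ⊆ D.P.edges i ∪ D.P.edges j)
    {c : ℤ} (hc : D.IsFlip i j {e₁, e₂} Φ c) :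
    Trip w L augmentCmd σ (augmentTime n D.M) fun σ' => SameVars σ σ' ∧ σ'.out = σ.out ∧ ∃ Φ' c',
      Flips σ' Φ' ∧ D.IsFlip i j {e₁, e₂} Φ' c' ∧ c ≤ c' ∧ (HasCut G s t {e₁, e₂} c' ∨ c' = c + 1) := by
  refine ((hL.trip_reset σ).seq (T₂ := 400 * D.M + 900 * n) fun σ₁ ⟨a1, a2, a3, a4⟩ => ?_).mono
    (by unfold augmentTime; omega) fun _ h => h
  have f1 : Flips σ₁ Φ := fun e => by rw [a3]; exact hΦ e
  refine ((hL.trip_search hi hj ((a1 5 (by decide)).trans h5) ((a1 6 (by decide)).trans h6)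
    f1 ((a1 1 (by decide)).trans he₁) ((a1 2 (by decide)).trans he₂) a4).seq
    fun σ₂ ⟨b1, b2, b3, T, b4, b5⟩ => ?_).mono (T := _ + 200 * n) (by omega) fun _ h => h
  have f2 : Flips σ₂ Φ := fun e => by rw [b3]; exact f1 e
  refine (hL.trip_walk f2 b4).mono le_rfl fun σ₃ ⟨d1, d2, d3⟩ => ⟨(a1.trans b1).trans d1,
    by rw [d2, b2, a2], ?_⟩
  rcases d3 with ⟨d3, d4⟩ | ⟨A, d3, d4, d5⟩
  · exact ⟨Φ, c, d4, hc, le_rfl, .inl (hc.hasCut Finset.card_le_two hi hj hFij b4 d3 b5)⟩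
  · exact ⟨_, c + 1, d5, hc.augment d3 d4, by omega, .inr rfl⟩

/-- `Ψ` contains the edges of `Φ` that are still marked. The formulation in terms of the remainder
lets the passes over the two backup graphs be chained. -/
theorem Layout.trip_flush (hL : Layout D w L R) {c : Fin 32} (hc : c < 9) {i : ℕ} (hi : i < D.k) {σ : St}
    (hv : σ.v c = i) {Φ Ψ : Finset (Fin m)} (hΨ : Ψ ⊆ Φ) (hΦ : Flips σ Ψ) {e₁ e₂ : Fin m}
    (he₁ : σ.v 1 = e₁) (he₂ : σ.v 2 = e₂) (hnd : σ.out.Nodup)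
    (hout : ∀ a, a ∈ σ.out ↔ ∃ e ∈ Φ \ Ψ, e ∉ ({e₁, e₂} : Finset (Fin m)) ∧ (e : ℕ) = a) :
    Trip w L (flushCmd c) σ (100 * D.M + 200 * n) fun σ' => SameVars σ σ' ∧ ∃ Ψ' ⊆ Ψ, Flips σ' Ψ' ∧
      Disjoint Ψ' (D.B i) ∧ σ'.out.Nodup ∧
      ∀ a, a ∈ σ'.out ↔ ∃ e ∈ Φ \ Ψ', e ∉ ({e₁, e₂} : Finset (Fin m)) ∧ (e : ℕ) = a := by
  have w1 := hL.word₁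
  have w0 := hL.size₀
  have hnR := hL.n_le
  have hn : 0 < n := s.pos
  have hkR := hL.k_le
  have hRM := hL.size₂
  have hidx : i * (n + 1) + n < R := by
    have h1 := hL.size₁
    have : (i + 1) * (n + 1) ≤ D.k * (n + 1) := Nat.mul_le_mul_right _ hi
    nlinarith
  have hc12 : c ≠ 12 := by intro h; subst h; omega
  have hstart : D.start i 0 ≤ D.start i n := D.start_mono i (Nat.zero_le n)
  have hend := D.start_le_mul i hi
  have hdeg := D.start_le i
  refine (Trip.assign_seq (x := D.start i 0) ?_ ?_ (Trip.assign_seq (x := D.start i n) ?_ ?_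
    (T := 100 * D.M + 20) ?_)).mono ?_ fun _ h => h
  · simp only [Exp.ok_mul, Exp.ok_add, Exp.ok_dat, Exp.ok_const, Exp.ok_var, Exp.ev_mul, Exp.ev_add,
      Exp.ev_dat, Exp.ev_const, Exp.ev_var, true_and, hv, hL.hdr_n]
    (repeat' refine And.intro ?_ ?_) <;> omega
  · simp only [Exp.ev_mul, Exp.ev_add, Exp.ev_dat, Exp.ev_const, Exp.ev_var, hv, hL.hdr_n]
    exact hL.start_eq i hi 0 (Nat.zero_le n)
  · simp only [Exp.ok_mul, Exp.ok_add, Exp.ok_dat, Exp.ok_const, Exp.ok_var, Exp.ev_mul, Exp.ev_add,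
      Exp.ev_dat, Exp.ev_const, Exp.ev_var, true_and, St.set_v, hc12, if_false, hv, hL.hdr_n]
    (repeat' refine And.intro ?_ ?_) <;> omega
  · simp only [Exp.ev_mul, Exp.ev_add, Exp.ev_dat, Exp.ev_const, Exp.ev_var, St.set_v, hc12, if_false,
      hv, hL.hdr_n]
    exact hL.start_eq i hi n le_rfl
  swap
  · simp only [Exp.size_var, Exp.size_const, Exp.size_add, Exp.size_mul, Exp.size_dat]; omega
  refine (Trip.count (fun x σ' => σ'.v 12 = x ∧ σ'.v 13 = D.start i n ∧ D.start i 0 ≤ x ∧ SameVars σ σ' ∧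
    ∃ Ψ' ⊆ Ψ, Flips σ' Ψ' ∧ (∀ h, D.start i 0 ≤ h → h < x → (D.arc h).1 ∉ Ψ') ∧ σ'.out.Nodup ∧
      ∀ a, a ∈ σ'.out ↔ ∃ e ∈ Φ \ Ψ', e ∉ ({e₁, e₂} : Finset (Fin m)) ∧ (e : ℕ) = a)
    (N := D.start i n) ?_ ?_ hstart ?_).mono ?_ ?_
  · rintro x σ' ⟨h1, h2, -⟩
    exact ⟨h1, trivial, h2⟩
  · rintro x σ' hx ⟨h1, h2, h3, h4, Ψ', h5, h6, h7, h8, h9⟩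
    have k1 : x < D.k * D.M := by omega
    have hem := (D.arc x).1.2
    have hf := h6.le_one (D.arc x).1
    have hx1 : σ'.v 1 = e₁ := (h4 1 (by decide)).trans he₁
    have hx2 : σ'.v 2 = e₂ := (h4 2 (by decide)).trans he₂
    have he1m := e₁.2
    have he2m := e₂.2
    have hdone : ∀ Ψ₂ ⊆ Ψ', (D.arc x).1 ∉ Ψ₂ → ∀ h, D.start i 0 ≤ h → h < x + 1 → (D.arc h).1 ∉ Ψ₂ := by
      intro Ψ₂ hsub hnot h g1 g2
      rcases Nat.lt_succ_iff_lt_or_eq.1 g2 with g2 | rfl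
      · exact fun hm => h7 h g1 g2 (hsub hm)
      · exact hnot
    have hmem : σ'.m 0 (D.arc x).1 ≠ 0 → (D.arc x).1 ∈ Ψ' := by
      intro hne
      by_contra hm
      exact hne ((h6 _).trans (if_neg hm))
    have hins : (D.arc x).1 ∈ Ψ' → Φ \ Ψ'.erase (D.arc x).1 = insert (D.arc x).1 (Φ \ Ψ') := by
      intro hm
      ext e'
      simp only [Finset.mem_sdiff, Finset.mem_erase, Finset.mem_insert]
      have := hΨ (h5 hm)
      by_cases he : e' = (D.arc x).1
      · subst he; simp [this]
      · simp [he]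
    have hfail : (D.arc x).1 ∈ Ψ' → (D.arc x).1 ∈ ({e₁, e₂} : Finset (Fin m)) →
        ∀ {σ₂ : St}, σ₂ = ((σ'.set 14 (D.arc x).1).put 0 (D.arc x).1 0).set 12 (x + 1) →
        (σ₂.v 12 = x + 1 ∧ σ₂.v 13 = D.start i n ∧ D.start i 0 ≤ x + 1 ∧ SameVars σ σ₂ ∧
        ∃ Ψ' ⊆ Ψ, Flips σ₂ Ψ' ∧ (∀ h, D.start i 0 ≤ h → h < x + 1 → (D.arc h).1 ∉ Ψ') ∧ σ₂.out.Nodup ∧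
          ∀ a, a ∈ σ₂.out ↔ ∃ e ∈ Φ \ Ψ', e ∉ ({e₁, e₂} : Finset (Fin m)) ∧ (e : ℕ) = a) := by
      rintro hm hF σ₂ rfl
      refine ⟨by simp, by simp [h2], by omega, ((h4.set (by decide) _).put 0 (D.arc x).1 0).set (by decide) _,
        _, (Finset.erase_subset _ _).trans h5, h6.set_zero (D.arc x).1,
        hdone _ (Finset.erase_subset _ _) (Finset.notMem_erase _ _), h8, fun a => ?_⟩
      refine (h9 a).trans ?_
      rw [hins hm]
      constructor
      · rintro ⟨e', g4, g5⟩
        exact ⟨e', Finset.mem_insert_of_mem g4, g5⟩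
      · rintro ⟨e', g4, g5⟩
        rcases Finset.mem_insert.1 g4 with rfl | g4
        · exact absurd hF g5.1
        · exact ⟨e', g4, g5⟩
    simp only [Cmd.wp, Exp.ok_add, Exp.ok_dat, Exp.ok_const, Exp.ok_var, Exp.ok_dist, Exp.ok_mem,
      Exp.ev_add, Exp.ev_dat, Exp.ev_const, Exp.ev_var, Exp.ev_dist, Exp.ev_mem, true_and,
      St.set_v, St.set_m, St.put_v, St.app_v, Fin.reduceEq, if_true, if_false, h1, hL.arc_edge x k1, hx1, hx2]
    rw [show ((0 : Fin 4) : ℕ) = 0 from rfl]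
    refine ⟨by omega, by omega, by omega, fun g1 => ⟨by omega, by omega, by omega, by omega,
      fun g2 => ⟨by omega, by omega, fun g3 => ⟨by omega, ?_⟩, fun g3 => ⟨by omega, ?_⟩⟩,
      fun g2 => ⟨by omega, ?_⟩⟩, fun g1 => ⟨by omega, ?_⟩⟩
    · have he := hmem (by omega)
      refine ⟨h2, by omega, ((((h4.set (by decide) _).put 0 (D.arc x).1 0).app
        (D.arc x).1).set (by decide) _), _, (Finset.erase_subset _ _).trans h5, h6.set_zero (D.arc x).1,
        hdone _ (Finset.erase_subset _ _) (Finset.notMem_erase _ _), ?_, fun a => ?_⟩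
      -- The edge was still marked, so it has not been reported before.
      · refine List.Nodup.append h8 (List.nodup_singleton _) ?_
        rw [List.disjoint_singleton]
        intro hin
        obtain ⟨e', g4, -, g5⟩ := (h9 _).1 hin
        exact (Finset.mem_sdiff.1 g4).2 (Fin.ext g5 ▸ he)
      · simp only [St.set_out, St.app_out, St.put_out, List.mem_append, List.mem_singleton, h9]
        rw [hins he]
        constructor
        · rintro (⟨e', g4, g5⟩ | rfl)
          · exact ⟨e', Finset.mem_insert_of_mem g4, g5⟩
          · refine ⟨_, Finset.mem_insert_self _ _, ?_, rfl⟩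
            simp only [Finset.mem_insert, Finset.mem_singleton, not_or]
            exact ⟨fun h => by rw [h] at g2; omega, fun h => by rw [h] at g3; omega⟩
        · rintro ⟨e', g4, g5⟩
          rcases Finset.mem_insert.1 g4 with rfl | g4
          · exact .inr g5.2.symm
          · exact .inl ⟨e', g4, g5⟩
    · exact (hfail (hmem (by omega)) (by
        simp only [Finset.mem_insert, Finset.mem_singleton]; exact .inr (Fin.ext (by omega))) rfl).2
    · exact (hfail (hmem (by omega)) (by
        simp only [Finset.mem_insert, Finset.mem_singleton]; exact .inl (Fin.ext (by omega))) rfl).2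
    · refine ⟨h2, by omega, (h4.set (by decide) _).set (by decide) _, Ψ', h5, h6,
        hdone _ subset_rfl fun hm => ?_, h8, h9⟩
      have := h6 (D.arc x).1
      rw [if_pos hm] at this
      omega
  · refine ⟨by simp, by simp, le_rfl, ((SameVars.refl σ).set (by decide) _).set (by decide) _, Ψ, subset_rfl,
      hΦ, by omega, hnd, hout⟩
  · simp only [Cmd.cost, Exp.size_var, Exp.size_const, Exp.size_add, Exp.size_dat, Exp.size_mem, Exp.size_dist]
    omega
  · rintro σ' ⟨h1, h2, h3, h4, Ψ', h5, h6, h7, h8, h9⟩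
    refine ⟨h4, Ψ', h5, h6, Finset.disjoint_left.2 fun e he heB => ?_, h8, h9⟩
    obtain ⟨b, b1, b2, b3⟩ := D.exists_arc i hi (e, true) heB
    refine h7 b ((D.start_mono i (Nat.zero_le _)).trans b1) (b2.trans_le (D.start_mono i (Fin.is_lt _))) ?_
    rw [b3]; exact he

end FTFlow

/-! ### Correctness of the report -/

namespace FTFlow

open WordRAM

variable {w : ℕ} {L : List ℕ} {n m : ℕ} {G : MultiDigraph (Fin n) (Fin m)} {s t : Fin n}
  {D : Scheme G s t} {R : ℕ}

/-- For an edge on no path the entry is `0`, and truncated subtraction assigns path `0` to it. That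
path is then dropped needlessly, which the augmentations make up for. -/
theorem Layout.path_index (hL : Layout D w L R) (e : Fin m) : datCol L 5 (slotOf L e) ≤ D.k ∧
    datCol L 5 (slotOf L e) - 1 < D.k ∧ (e ∈ D.P.supp → e ∈ D.P.edges (datCol L 5 (slotOf L e) - 1)) := by
  have hk := D.pos
  by_cases he : e ∈ D.P.supp
  · obtain ⟨i, hi, x, hx, rfl⟩ := D.mem_supp.1 he
    rw [(hL.path_edge i hi x hx).1, Nat.add_sub_cancel]
    exact ⟨hi, hi, fun _ => PathSystem.mem_edges.2 ⟨x, hx, rfl⟩⟩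
  · rw [hL.path_none e he]
    exact ⟨by omega, by omega, fun h => absurd h he⟩

theorem nodup_append_one {l : List ℕ} {a : ℕ} (h : l.Nodup) (ha : a ∉ l) : (l ++ [a]).Nodup := by
  rw [List.nodup_append_comm]
  exact List.nodup_cons.2 ⟨ha, h⟩

theorem cost_lookup (i d : Fin 32) : (lookup i d).cost = 98 := by
  simp [lookup, Cmd.cost]

/-- A bound on the running time of a report. -/
def reportTime (n M : ℕ) : ℕ := 1000 * M + 4000 * n

/-- After dropping the paths, the value is at least `k - 2`. Two augmentations either bring it back
to `k` or get stuck, and both outcomes certify optimality. -/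
theorem Layout.trip_reportTwo (hL : Layout D w L R) {e₁ e₂ : Fin m} {σ : St} (h1 : σ.v 1 = e₁)
    (h2 : σ.v 2 = e₂) (hout : σ.out = []) (hm : ∀ a, σ.m 0 a = 0) :
    Trip w L reportTwoCmd σ (reportTime n D.M) fun σ' => ∃ (Φ : Finset (Fin m)) (c : ℤ),
      IsFlowSet G s t (symmDiff D.P.supp Φ) c ∧ Disjoint (symmDiff D.P.supp Φ) {e₁, e₂} ∧
      HasCut G s t {e₁, e₂} c ∧ σ'.out.Nodup ∧
      ∀ a, a ∈ σ'.out ↔ ∃ e ∈ Φ, e ∉ ({e₁, e₂} : Finset (Fin m)) ∧ (e : ℕ) = a := by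
  have w1 := hL.word₁
  have w0 := hL.size₀
  have hnR := hL.n_le
  have hn : 0 < n := s.pos
  have hkR := hL.k_le
  have s1 := hL.slot_le e₁
  have s2 := hL.slot_le e₂
  obtain ⟨p1, p2, p3⟩ := hL.path_index e₁
  obtain ⟨q1, q2, q3⟩ := hL.path_index e₂
  set i := datCol L 5 (slotOf L e₁) - 1 with hi
  set j := datCol L 5 (slotOf L e₂) - 1 with hj
  have hFij : {e₁, e₂} ∩ D.P.supp ⊆ D.P.edges i ∪ D.P.edges j := by
    intro e he
    obtain ⟨he1, he2⟩ := Finset.mem_inter.1 he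
    rcases Finset.mem_insert.1 he1 with rfl | he1
    · exact Finset.mem_union_left _ (p3 he2)
    · obtain rfl := Finset.mem_singleton.1 he1
      exact Finset.mem_union_right _ (q3 he2)
  have main : ∀ σ₁ : St, σ₁.v 1 = e₁ → σ₁.v 2 = e₂ → σ₁.v 5 = i → σ₁.v 6 = j → σ₁.out = [] →
      (∀ a, σ₁.m 0 a = 0) → Trip w L (markCmd 5 ;; markCmd 6 ;; augmentCmd ;; augmentCmd ;;
        flushCmd 5 ;; flushCmd 6) σ₁ (1000 * D.M + 3000 * n) fun σ' => ∃ (Φ : Finset (Fin m)) (c : ℤ),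
      IsFlowSet G s t (symmDiff D.P.supp Φ) c ∧ Disjoint (symmDiff D.P.supp Φ) {e₁, e₂} ∧
      HasCut G s t {e₁, e₂} c ∧ σ'.out.Nodup ∧
      ∀ a, a ∈ σ'.out ↔ ∃ e ∈ Φ, e ∉ ({e₁, e₂} : Finset (Fin m)) ∧ (e : ℕ) = a := by
    intro σ₁ a1 a2 a5 a6 aout am
    obtain ⟨c₀, hc₀, hflip₀⟩ := D.isFlip_edges p2 q2 hFij
    have f1 : Flips σ₁ (∅ : Finset (Fin m)) := fun e => by simp [am]
    refine ((hL.trip_mark (c := 5) (by decide) p2 a5 f1).seq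
      (T₂ := 1000 * D.M + 2900 * n) fun σ₂ ⟨b1, b2, b3⟩ => ?_).mono (by omega) fun _ h => h
    rw [Finset.empty_union] at b3
    refine ((hL.trip_mark (c := 6) (by decide) q2 ((b1 6 (by decide)).trans a6) b3).seq
      (T₂ := 1000 * D.M + 2800 * n) fun σ₃ ⟨d1, d2, d3⟩ => ?_).mono (by omega) fun _ h => h
    have v3 := b1.trans d1
    refine ((hL.trip_augment p2 q2 ((v3 5 (by decide)).trans a5) ((v3 6 (by decide)).trans a6) d3
      ((v3 1 (by decide)).trans a1) ((v3 2 (by decide)).trans a2) hFij hflip₀).seq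
      (T₂ := 600 * D.M + 1800 * n) fun σ₄ ⟨g1, g2, Φ₁, c₁, g3, g4, g5, g6⟩ => ?_).mono
        (by unfold augmentTime; omega) fun _ h => h
    have v4 := v3.trans g1
    refine ((hL.trip_augment p2 q2 ((v4 5 (by decide)).trans a5) ((v4 6 (by decide)).trans a6) g3
      ((v4 1 (by decide)).trans a1) ((v4 2 (by decide)).trans a2) hFij g4).seq
      (T₂ := 200 * D.M + 800 * n) fun σ₅ ⟨k1, k2, Φ, c, k3, k4, k5, k6⟩ => ?_).mono
        (by unfold augmentTime; omega) fun _ h => h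
    have v5 := v4.trans k1
    have hout5 : σ₅.out = [] := by rw [k2, g2, d2, b2, aout]
    -- If the second attempt succeeds after a first one that got stuck, the first certificate still
    -- serves; after two successes a minimum cut of `G` does.
    have hcut : HasCut G s t {e₁, e₂} c := by
      rcases k6 with k6 | k6
      · exact k6
      rcases g6 with g6 | g6
      · exact g6.mono k5
      · exact HasCut.mono (D.P.exists_min_cut D.max {e₁, e₂}) (by omega)
    refine ((hL.trip_flush (c := 5) (by decide) p2 ((v5 5 (by decide)).trans a5) (Finset.Subset.refl Φ) k3
      ((v5 1 (by decide)).trans a1) ((v5 2 (by decide)).trans a2) (by rw [hout5]; exact List.nodup_nil)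
      (by simp [hout5])).seq (T₂ := 100 * D.M + 200 * n)
      fun σ₆ ⟨l1, Ψ, l2, l3, l4, l5, l6⟩ => ?_).mono (by omega) fun _ h => h
    have v6 := v5.trans l1
    refine (hL.trip_flush (c := 6) (by decide) q2 ((v6 6 (by decide)).trans a6) l2 l3
      ((v6 1 (by decide)).trans a1) ((v6 2 (by decide)).trans a2) l5 l6).mono (by omega)
      fun σ₇ ⟨m1, Ψ', m2, m3, m4, m5, m6⟩ => ⟨Φ, c, k4.flow, k4.disjoint, hcut, m5, fun a => ?_⟩
    -- All changes lie in the two backup graphs, so the two passes erase every mark.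
    have hΨ' : Ψ' = ∅ := by
      refine Finset.eq_empty_of_forall_notMem fun e he => ?_
      rcases Finset.mem_union.1 (k4.subset (l2 (m2 he))) with hB | hB
      · exact Finset.disjoint_left.1 l4 (m2 he) hB
      · exact Finset.disjoint_left.1 m4 he hB
    rw [m6 a, hΨ', Finset.sdiff_empty]
  have hval : ∀ (e : Fin m) (σ₁ : St), σ₁.v 4 = slotOf L e → (Exp.dat 5 (.var 4) - cst 1).ok w L σ₁ ∧
      (Exp.dat 5 (.var 4) - cst 1).ev L σ₁ = datCol L 5 (slotOf L e) - 1 := by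
    intro e σ₁ h
    have := hL.slot_le e
    have := (hL.path_index e).1
    simp only [Exp.ok_sub, Exp.ok_dat, Exp.ok_const, Exp.ok_var, Exp.ev_sub, Exp.ev_dat, Exp.ev_const,
      Exp.ev_var, true_and, h, and_true]
    omega
  refine ((hL.wp_lookup (i := 1) (d := 4) (Q := fun σ₁ => σ₁ = (σ.set 30 (bucketOf L e₁)).set 4 (slotOf L e₁))
    (by decide) (by decide) (by decide) e₁.2 h1 rfl).trip.seq (T₂ := 200 + (1000 * D.M + 3000 * n))
      fun σ₁ e => ?_).mono ?_ fun _ h => h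
  swap
  · rw [cost_lookup]; unfold reportTime; omega
  subst e
  refine (Trip.assign_seq (x := i) (T := 150 + (1000 * D.M + 3000 * n)) (hval e₁ _ (by simp)).1
    (hval e₁ _ (by simp)).2 ?_).mono ?_ fun _ h => h
  swap
  · simp only [Exp.size_sub, Exp.size_dat, Exp.size_var, Exp.size_const]; omega
  refine ((hL.wp_lookup (i := 2) (d := 4) (Q := fun σ₁ => σ₁ = ((((σ.set 30 (bucketOf L e₁)).set 4
    (slotOf L e₁)).set 5 i).set 30 (bucketOf L e₂)).set 4 (slotOf L e₂))
    (by decide) (by decide) (by decide) e₂.2 (by simp [h2]) rfl).trip.seq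
      (T₂ := 50 + (1000 * D.M + 3000 * n)) fun σ₁ e => ?_).mono ?_ fun _ h => h
  swap
  · rw [cost_lookup]; omega
  subst e
  refine (Trip.assign_seq (x := j) (hval e₂ _ (by simp)).1 (hval e₂ _ (by simp)).2
    (main _ ?_ ?_ ?_ ?_ ?_ ?_)).mono ?_ fun _ h => h
  · simp [h1]
  · simp [h2]
  · simp
  · simp
  · simp [hout]
  · simp [hm]
  · simp only [Exp.size_sub, Exp.size_dat, Exp.size_var, Exp.size_const]; omega

/-- The changes are the bypassed segment and the detour edges with the right tag. The segment is
read off the path, and the detour from the table of `n` vertices. -/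
theorem Layout.trip_reportOne (hL : Layout D w L R) {e₀ : Fin m} {S : Finset (Fin m)}
    (hS : D.IsAfterOne e₀ S) {σ : St} (h1 : σ.v 1 = e₀) (hout : σ.out = []) :
    Trip w L reportOneCmd σ (reportTime n D.M) fun σ' => σ'.out.Nodup ∧
      ∀ a, a ∈ σ'.out ↔ ∃ e, e ≠ e₀ ∧ ¬ (e ∈ S ↔ e ∈ D.P.supp) ∧ (e : ℕ) = a := by
  have w1 := hL.word₁
  have w0 := hL.size₀
  have hnR := hL.n_le
  have hn : 0 < n := s.pos
  have hkR := hL.k_le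
  have s1 := hL.slot_le e₀
  have he₀m := e₀.2
  refine ((hL.wp_lookup (i := 1) (d := 4) (Q := fun σ₁ => σ₁ = (σ.set 30 (bucketOf L e₀)).set 4 (slotOf L e₀))
    (by decide) (by decide) (by decide) e₀.2 h1 rfl).trip.seq (T₂ := 1 + 6 + 1 + 4 + 2000 * n)
      fun σ₁ e => ?_).mono ?_ fun _ h => h
  swap
  · rw [cost_lookup]; unfold reportTime; omega
  subst e
  refine Trip.ite ?_ ?_ ?_ ?_
  · simp only [Exp.ok_const]; omega
  · simp only [Exp.ok_dat, Exp.ok_var, Exp.ev_var, true_and, St.set_v, if_true]; omega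
  swap
  · simp only [Exp.ev_const, Exp.ev_dat, Exp.ev_var, St.set_v, if_true]
    intro h0
    have he : e₀ ∉ D.P.supp := fun he => by
      obtain ⟨i, hi, x, hx, rfl⟩ := D.mem_supp.1 he
      have := (hL.path_edge i hi x hx).1
      omega
    refine ⟨_, 0, .skip _, Nat.zero_le _, ?_, ?_⟩
    · rw [St.set_out, St.set_out, hout]; exact List.nodup_nil
    · rw [St.set_out, St.set_out, hout, hS.2 he]
      simp
  simp only [Exp.ev_const, Exp.ev_dat, Exp.ev_var, St.set_v, if_true]
  intro h0
  have he : e₀ ∈ D.P.supp := by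
    by_contra he
    rw [hL.path_none e₀ he] at h0
    omega
  obtain ⟨i, hi, y, hy, rfl⟩ := D.mem_supp.1 he
  obtain ⟨p0, -, q1, q2, q3⟩ := hL.path_edge i hi y hy
  have hS' := hS.1 i hi y hy rfl
  obtain ⟨l1, l2, l3, l4, -⟩ := D.single i hi y hy
  have l5 := D.len_lt hi
  have hin0 : i * n < R := by simpa using hL.idx_lt hi hn
  set sl := slotOf L (D.P.edge i y) with hsl
  refine (Trip.assign_seq (x := i) ?_ ?_ (Trip.assign_seq (x := D.lo i y) (T := 1900 * n) ?_ ?_ ?_)).mono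
    ?_ fun _ h => h
  · simp only [Exp.ok_sub, Exp.ok_dat, Exp.ok_const, Exp.ok_var, Exp.ev_dat, Exp.ev_const,
      Exp.ev_var, true_and, St.set_v, if_true, p0]
    omega
  · simp only [Exp.ev_sub, Exp.ev_dat, Exp.ev_const, Exp.ev_var, St.set_v, if_true, p0]
    omega
  · simp only [Exp.ok_dat, Exp.ok_var, Exp.ev_var, true_and, St.set_v, Fin.reduceEq, if_true, if_false]
    omega
  · simp only [Exp.ev_dat, Exp.ev_var, St.set_v, Fin.reduceEq, if_true, if_false, q1]
  swap
  · simp only [Exp.size_sub, Exp.size_dat, Exp.size_var, Exp.size_const]; omega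
  set σ₁ := (((σ.set 30 (bucketOf L (D.P.edge i y))).set 4 sl).set 5 i).set 9 (D.lo i y) with hσ₁
  refine ((Trip.count (fun x σ' => σ'.v 9 = x ∧ D.lo i y ≤ x ∧ σ'.v 1 = D.P.edge i y ∧ σ'.v 4 = sl ∧ σ'.v 5 = i ∧
    σ'.out.Nodup ∧ ∀ a, a ∈ σ'.out ↔ ∃ e ∈ D.P.segment i (D.lo i y) x, e ≠ D.P.edge i y ∧ (e : ℕ) = a)
    (N := D.hi i y) ?_ ?_ (by omega : D.lo i y ≤ D.hi i y) ?_).seq (T₂ := 1000 * n)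
    fun σ₂ ⟨_, _, g2, g3, g4, g5, g6⟩ => ?_).mono ?_ fun _ h => h
  · rintro x σ' ⟨g0, g1, g2, g3, g4, g5, g6⟩
    refine ⟨g0, ?_, by rw [Exp.ev_dat, Exp.ev_var, g3, q2]⟩
    simp only [Exp.ok_dat, Exp.ok_var, Exp.ev_var, true_and, g3]
    omega
  · rintro x σ' hx ⟨g0, g1, g2, g3, g4, g5, g6⟩
    have hxm := (D.P.edge i x).2
    have hix := hL.idx_lt hi (show x < n by omega)
    simp only [Cmd.wp, Exp.ok_add, Exp.ok_mul, Exp.ok_dat, Exp.ok_const, Exp.ok_var, Exp.ok_dist,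
      Exp.ev_add, Exp.ev_mul, Exp.ev_dat, Exp.ev_const, Exp.ev_var, Exp.ev_dist, true_and,
      St.set_v, St.app_v, Fin.reduceEq, if_true, if_false, g0, g2, g3, g4, hL.hdr_n,
      hL.edge_eq i hi x (by omega)]
    have hseg : D.P.segment i (D.lo i y) (x + 1) = insert (D.P.edge i x) (D.P.segment i (D.lo i y) x) := by
      rw [PathSystem.segment, PathSystem.segment, ← Finset.image_insert]
      congr 1
      ext z; simp; omega
    refine ⟨by omega, by omega, by omega, fun hne => ⟨by omega, ?_⟩, fun hne => ⟨by omega, ?_⟩⟩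
    · simp only [St.set_out, St.app_out]
      refine ⟨by omega, nodup_append_one g5 fun h => ?_, fun a => ?_⟩
      · obtain ⟨e, he1, -, he2⟩ := (g6 _).1 h
        rw [Fin.ext he2, D.mem_segment hi (by omega) (by omega)] at he1
        omega
      · rw [List.mem_append, g6, List.mem_singleton, hseg, Finset.exists_mem_insert, or_comm]
        refine or_congr ⟨fun h => ⟨fun h' => ?_, h.symm⟩, fun h => h.2.symm⟩ Iff.rfl
        rw [h'] at hne
        omega
    · simp only [St.set_out]
      refine ⟨by omega, g5, fun a => ?_⟩
      rw [g6, hseg, Finset.exists_mem_insert, or_iff_right]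
      exact fun h => h.1 (Fin.ext (by omega))
  · refine ⟨by simp [hσ₁], le_rfl, by simp [hσ₁, h1], by simp [hσ₁], by simp [hσ₁], by simp [hσ₁, hout], ?_⟩
    simp [hσ₁, hout, PathSystem.segment]
  · refine Trip.assign_seq (x := 0) (T := 100 + n * 90) (by simp only [Exp.ok_const]; omega) rfl ((Trip.count (N := n)
      (fun x σ' => σ'.v 9 = x ∧ σ'.v 4 = sl ∧ σ'.v 5 = i ∧ σ'.out.Nodup ∧ ∀ a, a ∈ σ'.out ↔
        (∃ e ∈ D.P.segment i (D.lo i y) (D.hi i y), e ≠ D.P.edge i y ∧ (e : ℕ) = a) ∨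
        ∃ v : Fin n, v < x ∧ ∃ e, (D.dedge i v = some e ∧ D.tag i v = D.tg i y) ∧ (e : ℕ) = a)
      ?_ ?_ (Nat.zero_le n) ?_).mono ?_ ?_) |>.mono ?_ fun _ h => h
    · rintro x σ' ⟨g0, -⟩
      refine ⟨g0, ?_, by rw [Exp.ev_dat, Exp.ev_const, hL.hdr_n]⟩
      simp only [Exp.ok_dat, Exp.ok_const, Exp.ev_const]
      omega
    · rintro x σ' hx ⟨g0, g3, g4, g5, g6⟩
      have hix := hL.idx_lt hi hx
      have hdl := hL.detour_lt hi hx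
      have hdt := hL.detour_tag_le (i * n + x)
      simp only [Cmd.wp, Exp.ok_add, Exp.ok_sub, Exp.ok_mul, Exp.ok_dat, Exp.ok_const, Exp.ok_var, Exp.ok_dist,
        Exp.ev_add, Exp.ev_sub, Exp.ev_mul, Exp.ev_dat, Exp.ev_const, Exp.ev_var, Exp.ev_dist, true_and,
        St.set_v, St.app_v, Fin.reduceEq, if_true, if_false, g0, g3, g4, hL.hdr_n, q3]
      have hskip : ¬ (∃ e, D.dedge i ⟨x, hx⟩ = some e ∧ D.tag i ⟨x, hx⟩ = D.tg i y) → D.lo i y ≤ D.lo i y ∧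
          σ'.out.Nodup ∧ ∀ a, a ∈ σ'.out ↔
          (∃ e ∈ D.P.segment i (D.lo i y) (D.hi i y), e ≠ D.P.edge i y ∧ (e : ℕ) = a) ∨
          ∃ v : Fin n, v < x + 1 ∧ ∃ e, (D.dedge i v = some e ∧ D.tag i v = D.tg i y) ∧ (e : ℕ) = a := by
        refine fun hno => ⟨le_rfl, g5, fun a => ?_⟩
        rw [g6]
        refine or_congr Iff.rfl ⟨fun ⟨v, hv, h⟩ => ⟨v, by omega, h⟩, fun ⟨v, hv, e, h, h'⟩ => ⟨v, ?_, e, h, h'⟩⟩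
        rcases Nat.lt_succ_iff_lt_or_eq.1 hv with hv | hv
        · exact hv
        · exact absurd ⟨e, by simpa [← hv] using h⟩ hno
      refine ⟨by omega, by omega, by omega, fun hlt => ⟨by omega, by omega, fun hd => ⟨by omega, by omega, ?_⟩,
        fun hd => ⟨by omega, ?_⟩⟩, fun hlt => ⟨by omega, ?_⟩⟩
      · cases hde : D.dedge i ⟨x, hx⟩ with
        | none =>
          have hdet := hL.detour i hi ⟨x, hx⟩
          simp [hde] at hdet
          omega
        | some e =>
          have hdet := (hL.detour_iff hi ⟨x, hx⟩ e).2 hde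
          have htag := hL.detour_tag i hi ⟨x, hx⟩ (by simp [hde])
          simp only at hdet htag
          have ht : D.tag i ⟨x, hx⟩ = D.tg i y := by omega
          obtain ⟨-, -, -, d1, d2⟩ := D.dedge_some i _ e hde
          simp only [St.set_out, St.app_out, hdet, Nat.add_sub_cancel]
          refine ⟨nodup_append_one g5 fun h => ?_, fun a => ?_⟩
          · rcases (g6 _).1 h with ⟨e', he1, -, he2⟩ | ⟨v, hv, e', ⟨he1, -⟩, he2⟩
            · rw [Fin.ext he2] at he1
              exact d1 (D.P.segment_subset l3 he1)
            -- A detour edge determines the vertex that stores it, so it is not met twice.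
            · rw [Fin.ext he2] at he1
              rw [(D.dedge_some i _ e he1).2.2.2.2, ← d2] at hv
              exact lt_irrefl _ hv
          · rw [List.mem_append, g6, List.mem_singleton, or_assoc]
            refine or_congr Iff.rfl ⟨?_, fun ⟨v, hv, e', h, h'⟩ => ?_⟩
            · rintro (⟨v, hv, h⟩ | rfl)
              · exact ⟨v, by omega, h⟩
              · exact ⟨⟨x, hx⟩, Nat.lt_succ_self _, e, ⟨hde, ht⟩, rfl⟩
            · rcases Nat.lt_succ_iff_lt_or_eq.1 hv with hv | hv
              · exact Or.inl ⟨v, hv, e', h, h'⟩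
              · obtain rfl : v = ⟨x, hx⟩ := Fin.ext hv
                rw [hde, Option.some_inj] at h
                exact Or.inr (by rw [← h', h.1])
      · refine (hskip fun ⟨e, h, h'⟩ => ?_).2
        have htag := hL.detour_tag i hi ⟨x, hx⟩ (by simp [h])
        simp only [h'] at htag
        omega
      · refine (hskip fun ⟨e, h, h'⟩ => ?_).2
        have hdet := (hL.detour_iff hi ⟨x, hx⟩ e).2 h
        simp only at hdet
        omega
    · refine ⟨by simp, by simp [g3], by simp [g4], by simpa using g5, fun a => ?_⟩
      rw [St.set_out, g6]
      simp
    · simp [Cmd.cost]; omega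
    · rintro σ' ⟨-, -, -, g5, g6⟩
      refine ⟨g5, fun a => ?_⟩
      rw [g6]
      have key : ∀ e, (e ≠ D.P.edge i y ∧ ¬ (e ∈ S ↔ e ∈ D.P.supp)) ↔
          (e ∈ D.P.segment i (D.lo i y) (D.hi i y) ∧ e ≠ D.P.edge i y) ∨
          ∃ v : Fin n, D.dedge i v = some e ∧ D.tag i v = D.tg i y := by
        intro e
        rw [hS', PathSystem.mem_updated]
        have hsub := D.P.segment_subset (lo := D.lo i y) l3
        by_cases hd : ∃ v : Fin n, D.dedge i v = some e ∧ D.tag i v = D.tg i y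
        · obtain ⟨v, hv, -⟩ := id hd
          have hne := (D.dedge_some i v e hv).2.2.2.1
          have h1 : e ∉ D.P.segment i (D.lo i y) (D.hi i y) := fun h => hne (hsub h)
          have h2 : e ≠ D.P.edge i y := fun h => hne (h ▸ PathSystem.mem_edges.2 ⟨y, hy, rfl⟩)
          by_cases h3 : e ∈ D.P.supp <;> simp [hd, h1, h2, h3]
        · by_cases h3 : e ∈ D.P.segment i (D.lo i y) (D.hi i y)
          · have h4 := D.P.edges_subset_supp hi (hsub h3)
            simp [hd, h3, h4]
          · simp [hd, h3]
      constructor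
      · rintro (⟨e, h1, h2, h3⟩ | ⟨v, -, e, h1, h2⟩)
        · exact ⟨e, and_assoc.1 ⟨(key e).2 (Or.inl ⟨h1, h2⟩), h3⟩⟩
        · exact ⟨e, and_assoc.1 ⟨(key e).2 (Or.inr ⟨v, h1⟩), h2⟩⟩
      · rintro ⟨e, h1, h2, h3⟩
        rcases (key e).1 ⟨h1, h2⟩ with ⟨h4, h5⟩ | ⟨v, h4⟩
        · exact Or.inl ⟨e, h4, h5, h3⟩
        · exact Or.inr ⟨v, v.2, e, h4, h3⟩
    · simp; omega
  · have : D.hi i y - D.lo i y ≤ n := by omega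
    refine (Nat.add_le_add_right (Nat.add_le_add_right (Nat.mul_le_mul_right _ this) _) _).trans ?_
    simp [Cmd.cost]; omega

theorem init_v {a : ℕ} {l : List ℕ} {r : Fin 32} (ha : a < 2 ^ w) (h : l.getD r 0 = a) : (St.init w l).v r = a := by
  simp only [St.init, h, Nat.mod_eq_of_lt ha]

theorem Layout.trip_report_none (hL : Layout D w L R) :
    Trip w L reportCmd (St.init w [0]) (reportTime n D.M + 100) fun σ' => σ'.out = [] := by
  have w1 := hL.word₁
  have w0 := hL.size₀
  have hnR := hL.n_le
  have hn := s.pos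
  have v0 : (St.init w [0]).v 0 = 0 := init_v (by omega) rfl
  refine (Trip.ite (T := 50) ?_ ?_ (fun _ => (Trip.ite (T := 30) ?_ ?_ (fun _ => (Trip.ite (T := 0) ?_ ?_ ?_ ?_).mono ?_ fun _ h => h) ?_).mono
    ?_ fun _ h => h) ?_).mono ?_ fun _ h => h
  all_goals simp [v0, hL.hdr_n, hn]
  all_goals try omega
  exact ⟨_, 0, .skip _, le_rfl, rfl⟩

theorem Layout.trip_report_one (hL : Layout D w L R) {e₀ : Fin m} {S : Finset (Fin m)}
    (hS : D.IsAfterOne e₀ S) :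
    Trip w L reportCmd (St.init w [1, e₀]) (reportTime n D.M + 100) fun σ' => σ'.out.Nodup ∧
      ∀ a, a ∈ σ'.out ↔ ∃ e, e ≠ e₀ ∧ ¬ (e ∈ S ↔ e ∈ D.P.supp) ∧ (e : ℕ) = a := by
  have w1 := hL.word₁
  have w0 := hL.size₀
  have hnR := hL.n_le
  have hn := s.pos
  have v0 : (St.init w [1, e₀]).v 0 = 1 := init_v (by omega) rfl
  have v1 : (St.init w [1, e₀]).v 1 = e₀ := init_v (by omega) rfl
  have h := hL.trip_reportOne hS v1 rfl
  refine (Trip.ite ?_ ?_ (fun _ => (Trip.ite ?_ ?_ (fun _ => (Trip.ite ?_ ?_ (fun _ => h) ?_)) ?_))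
    ?_).mono ?_ fun _ h => h
  all_goals simp [v0, hL.hdr_n, hn]
  all_goals try omega

/-- Both orders of the input lead to the same run on the sorted pair, so both have the same output.
-/
theorem Layout.trip_report_two (hL : Layout D w L R) {a b T : ℕ} (hab : a < b) (hb : b < m) {Q : St → Prop}
    (h : Trip w L reportTwoCmd (St.init w [2, a, b]) T Q) :
    Trip w L reportCmd (St.init w [2, a, b]) (T + 100) Q ∧ Trip w L reportCmd (St.init w [2, b, a]) (T + 100) Q := by
  have w1 := hL.word₁
  have w0 := hL.size₀
  have hnR := hL.n_le
  have hn := s.pos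
  constructor
  · have v0 : (St.init w [2, a, b]).v 0 = 2 := init_v (by omega) rfl
    have v1 : (St.init w [2, a, b]).v 1 = a := init_v (by omega) rfl
    have v2 : (St.init w [2, a, b]).v 2 = b := init_v (by omega) rfl
    refine (Trip.ite (T := T + 50) ?_ ?_ (fun _ => (Trip.ite (T := 30 + T) ?_ ?_ ?_ fun _ =>
      Trip.seq (T₁ := 30) (R := fun σ => σ = St.init w [2, a, b]) ((Trip.ite (T := 0) ?_ ?_ ?_ fun _ => ?_).mono ?_ fun _ h => h)
        fun σ hσ => hσ ▸ h).mono ?_ fun _ h => h) ?_).mono ?_ fun _ h => h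
    all_goals try simp [v0, v1, v2, hL.hdr_n, hn]
    all_goals try omega
    exact ⟨_, 0, .skip _, le_rfl, rfl⟩
  · have v0 : (St.init w [2, b, a]).v 0 = 2 := init_v (by omega) rfl
    have v1 : (St.init w [2, b, a]).v 1 = b := init_v (by omega) rfl
    have v2 : (St.init w [2, b, a]).v 2 = a := init_v (by omega) rfl
    have hswap : (Cmd.assign 3 (.var 1) ;; Cmd.assign 1 (.var 2) ;; Cmd.assign 2 (.var 3) ;;
        Cmd.assign 3 (cst 0)).wp w L (fun σ => σ = St.init w [2, a, b]) (St.init w [2, b, a]) := by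
      simp [Cmd.wp, v1, v2]
      refine St.ext ?_ rfl rfl
      funext r
      simp only [St.set_v]
      fin_cases r <;> simp [St.init]
      all_goals rw [Nat.mod_eq_of_lt]; omega
    refine (Trip.ite (T := T + 70) ?_ ?_ (fun _ => (Trip.ite (T := 50 + T) ?_ ?_ ?_ fun _ =>
      Trip.seq (T₁ := 50) (R := fun σ => σ = St.init w [2, a, b]) ((Trip.ite (T := 20) ?_ ?_
        (fun _ => hswap.trip.mono (by simp [Cmd.cost]) fun _ h => h) ?_).mono ?_ fun _ h => h)
        fun σ hσ => hσ ▸ h).mono ?_ fun _ h => h) ?_).mono ?_ fun _ h => h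
    all_goals simp [v0, v1, v2, hL.hdr_n, hn]
    all_goals try omega

end FTFlow

/-! ### Existence of the scheme -/

namespace FTFlow

/-- The elements are listed in the order of `f`, one fibre after the other; the fibre over `v`
occupies the numbers between two consecutive counts. This is the adjacency array of a backup graph.
-/
theorem exists_numbering {α : Type*} [Inhabited α] (A : Finset α) (f : α → ℕ) : ∃ g : ℕ → α, ∀ v,
    (∀ h, (A.filter fun a => f a < v).card ≤ h → h < (A.filter fun a => f a < v + 1).card → g h ∈ A ∧ f (g h) = v) ∧
    ∀ a ∈ A, f a = v → ∃ h, (A.filter fun a => f a < v).card ≤ h ∧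
      h < (A.filter fun a => f a < v + 1).card ∧ g h = a := by
  classical
  set start : ℕ → ℕ := fun v => (A.filter fun a => f a < v).card with hstart
  set l : ℕ → List α := fun v => (A.filter fun a => f a = v).toList with hl
  have hmono : Monotone start := fun u v h =>
    Finset.card_le_card (Finset.monotone_filter_right A fun a _ ha => lt_of_lt_of_le ha h)
  have hsucc : ∀ v, start (v + 1) = start v + (l v).length := by
    intro v
    rw [hl, Finset.length_toList, hstart, ← Finset.card_union_of_disjoint]
    · refine congrArg Finset.card (Finset.ext fun a => ?_)
      simp only [Finset.mem_filter, Finset.mem_union, ← and_or_left]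
      exact and_congr_right fun _ => Nat.lt_succ_iff_lt_or_eq
    · exact Finset.disjoint_filter.2 fun a _ h1 h2 => by omega
  have huniq : ∀ h u v, start u ≤ h → h < start (u + 1) → start v ≤ h → h < start (v + 1) → u = v := by
    intro h u v h1 h2 h3 h4
    rcases lt_trichotomy u v with huv | huv | huv
    · exact absurd (hmono (Nat.succ_le_of_lt huv)) (by rw [Nat.succ_eq_add_one]; omega)
    · exact huv
    · exact absurd (hmono (Nat.succ_le_of_lt huv)) (by rw [Nat.succ_eq_add_one]; omega)
  have hg : ∀ h, ∃ a, ∀ v, start v ≤ h → h < start (v + 1) → (l v)[h - start v]? = some a := by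
    intro h
    by_cases hv : ∃ v, start v ≤ h ∧ h < start (v + 1)
    · obtain ⟨v, h1, h2⟩ := hv
      have h3 : h - start v < (l v).length := by have := hsucc v; omega
      refine ⟨(l v)[h - start v], fun u h4 h5 => ?_⟩
      obtain rfl := huniq h u v h4 h5 h1 h2
      exact List.getElem?_eq_getElem h3
    · exact ⟨default, fun v h1 h2 => absurd ⟨v, h1, h2⟩ hv⟩
  choose g hg using hg
  refine ⟨g, fun v => ⟨fun h h1 h2 => ?_, fun a ha hv => ?_⟩⟩
  · have := List.mem_of_getElem? (hg h v h1 h2)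
    rw [hl, Finset.mem_toList, Finset.mem_filter] at this
    exact this
  · have hmem : a ∈ l v := by rw [hl, Finset.mem_toList]; exact Finset.mem_filter.2 ⟨ha, hv⟩
    obtain ⟨x, hx, rfl⟩ := List.getElem_of_mem hmem
    have h1 := hsucc v
    refine ⟨start v + x, Nat.le_add_right _ _, show _ < start (v + 1) by omega, ?_⟩
    have := hg (start v + x) v (Nat.le_add_right _ _) (by omega)
    rw [Nat.add_sub_cancel_left, List.getElem?_eq_getElem hx] at this
    exact (Option.some_inj.1 this).symm

variable {n m : ℕ}

/-- The arcs of backup graph `i` are numbered within the block from `i * M` to `(i + 1) * M`. The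
factor two in `M` accounts for the two orientations of an edge. -/
theorem exists_scheme {N : ℕ} (hN : ∀ (V E : Type) [Fintype V] [DecidableEq V] [Fintype E]
      [DecidableEq E] (G : MultiDigraph V E) (s t : V) (k : ℕ) (P : PathSystem G s t k),
      ∃ B, P.IsBackup B ∧ ∀ i < k, (B i).card ≤ N * Fintype.card V)
    (G : MultiDigraph (Fin n) (Fin m)) {s t : Fin n} (hst : s ≠ t) {k : ℕ} (hk : 0 < k)
    (P : PathSystem G s t k) (hmax : t ∉ reach (atl G) (ahd G) (resArcs P.supp) {s}) :
    ∃ D : Scheme G s t, D.k = k ∧ D.M = 2 * N * n := by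
  classical
  have : Nonempty (Fin m) := ⟨P.edge 0 0⟩
  obtain ⟨tag, dedge, lo, hi, tg, h1, h2⟩ := P.exists_singleFailure hmax
  obtain ⟨B₀, hB₀, hcard₀⟩ := hN (Fin n) (Fin m) G s t k P
  -- The backup graphs of nonexistent paths are made empty, because `start_le` is required for all
  -- indices.
  set B : ℕ → Finset (Fin m) := fun i => if i < k then B₀ i else ∅ with hB
  have hBi : ∀ i < k, B i = B₀ i := fun i hi => if_pos hi
  have hcard : ∀ i, (B i).card ≤ N * n := by
    intro i
    by_cases hi : i < k
    · rw [hBi i hi]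
      simpa using hcard₀ i hi
    · simp [hB, hi]
  have : Inhabited (Fin m × Bool) := ⟨(P.edge 0 0, true)⟩
  set A : ℕ → Finset (Fin m × Bool) := fun i => B i ×ˢ Finset.univ with hA
  set M := 2 * N * n with hM
  set cnt : ℕ → ℕ → ℕ := fun i v => ((A i).filter fun a => ((atl G a : Fin n) : ℕ) < v).card with hcnt
  have hcntM : ∀ i v, cnt i v ≤ M := by
    intro i v
    refine (Finset.card_filter_le _ _).trans ?_
    rw [hA, Finset.card_product, Finset.card_univ, Fintype.card_bool, hM]
    have := hcard i
    linarith
  choose g hg using fun i => exists_numbering (A i) fun a => ((atl G a : Fin n) : ℕ)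
  have hdiv : ∀ i h, i * M ≤ h → h < i * M + M → g (h / M) (h % M) = g i (h - i * M) := by
    intro i h h1 h2
    have hM0 : 0 < M := by omega
    have h3 : h = (h - i * M) + M * i := by rw [mul_comm M]; omega
    have h4 : h / M = i := Nat.div_eq_of_lt_le h1 (by rw [Nat.succ_mul]; exact h2)
    have h5 : h % M = h - i * M := by
      conv_lhs => rw [h3]
      rw [Nat.add_mul_mod_self_left, Nat.mod_eq_of_lt (by omega)]
    rw [h4, h5]
  refine ⟨{ ne := hst, k := k, pos := hk, P := P, max := hmax, B := B
            backup := fun i hi => by rw [hBi i hi]; exact hB₀ i hi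
            tag := tag, dedge := dedge, lo := lo, hi := hi, tg := tg, dedge_some := h1, single := h2
            M := M, start := fun i v => i * M + cnt i v, arc := fun h => g (h / M) (h % M)
            start_mono := fun i u v h => Nat.add_le_add_left (Finset.card_le_card
              (Finset.monotone_filter_right _ fun a _ ha => lt_of_lt_of_le ha h)) _
            start_le := fun i => by have := hcntM i n; omega
            start_le_mul := fun i hi => ?_
            arc_mem := fun i hi v h ha hb => ?_
            exists_arc := fun i hi a ha => ?_ }, rfl, rfl⟩
  · have := hcntM i n
    have h3 := Nat.mul_le_mul_right M (show i + 1 ≤ k from hi)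
    rw [Nat.succ_mul] at h3
    omega
  · have := hcntM i (v + 1)
    rw [hdiv i h (by omega) (by omega)]
    have h3 := (hg i v).1 (h - i * M) (Nat.le_sub_of_add_le (by rw [add_comm]; exact ha))
      (Nat.sub_lt_left_of_lt_add (by omega) hb)
    exact ⟨(Finset.mem_product.1 h3.1).1, Fin.ext h3.2⟩
  · obtain ⟨h, ha', hb', h3⟩ := (hg i (atl G a : Fin n)).2 a (Finset.mem_product.2 ⟨ha, Finset.mem_univ _⟩) rfl
    have := hcntM i ((atl G a : Fin n) + 1)
    refine ⟨i * M + h, Nat.add_le_add_left ha' _, Nat.add_lt_add_left hb' _, ?_⟩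
    rw [hdiv i _ (Nat.le_add_right _ _) (Nat.add_lt_add_left (lt_of_lt_of_le hb' this) _),
      Nat.add_sub_cancel_left, h3]

end FTFlow

/-! ### Existence of the memory layout -/

namespace FTFlow

/-- Cutting all entries off at `b` makes them fit into words, whatever the unused cells of `col`
contain; entries that matter are shown to be smaller. -/
theorem exists_memory (col : ℕ → ℕ → ℕ) (R b : ℕ) : ∃ L : List ℕ, L.length = 32 * R ∧ (∀ x ∈ L, x ≤ b) ∧
    ∀ c < 32, ∀ q, datCol L c q = if q < R then min (col c q) b else 0 := by
  refine ⟨(List.range (32 * R)).map fun z => min (col (z % 32) (z / 32)) b, by simp, fun x hx => ?_,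
    fun c hc q => ?_⟩
  · obtain ⟨z, -, rfl⟩ := List.mem_map.1 hx
    exact min_le_right _ _
  · rw [datCol, List.getD_eq_getElem?_getD, List.getElem?_map]
    split_ifs with h
    · rw [List.getElem?_range (by omega)]
      simp only [Option.map_some, Option.getD_some]
      congr 2 <;> omega
    · rw [List.getElem?_eq_none (by rw [List.length_range]; omega)]
      rfl

variable {n m : ℕ} {G : MultiDigraph (Fin n) (Fin m)} {s t : Fin n}

theorem Scheme.card_supp_le (D : Scheme G s t) : D.P.supp.card ≤ D.k * n := by
  classical
  rw [PathSystem.supp]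
  refine (Finset.card_biUnion_le_card_mul _ _ n fun i hi => ?_).trans (by rw [Finset.card_range])
  rw [PathSystem.edges]
  refine Finset.card_image_le.trans ?_
  rw [Finset.card_range]
  exact (D.len_lt (Finset.mem_range.1 hi)).le

/-- The edges that begin a detour. -/
noncomputable def Scheme.detours (D : Scheme G s t) : Finset (Fin m) := by
  classical
  exact Finset.univ.filter fun e => ∃ i w, D.dedge i w = some e

theorem Scheme.card_detours_le (D : Scheme G s t) : D.detours.card ≤ D.k * n := by
  classical
  have h1 : D.detours ⊆ (Finset.range D.k).biUnion fun i => Finset.univ.biUnion fun w => (D.dedge i w).toFinset := by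
    intro e he
    obtain ⟨i, w, h⟩ := (Finset.mem_filter.1 he).2
    simp only [Finset.mem_biUnion, Finset.mem_range, Finset.mem_univ, true_and, Option.mem_toFinset]
    exact ⟨i, (D.dedge_some i w e h).1, w, h⟩
  refine (Finset.card_le_card h1).trans ((Finset.card_biUnion_le_card_mul _ _ n fun i _ => ?_).trans
    (by rw [Finset.card_range]))
  refine (Finset.card_biUnion_le_card_mul _ _ 1 fun w _ => ?_).trans (by simp)
  cases D.dedge i w <;> simp

/-- Needed for the word size: it bounds the length of the data structure by a polynomial in `n + m`.
-/
theorem Scheme.k_le_card (D : Scheme G s t) : D.k ≤ m := by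
  have h1 := D.P.isFlowSet.sum_cut (X := {s}) (by simp) (by simpa using D.ne.symm)
  have h2 := Finset.card_le_univ (D.P.supp.filter fun e => G.src e ∈ ({s} : Finset (Fin n)) ∧ G.tgt e ∉ ({s} : Finset (Fin n)))
  rw [Fintype.card_fin] at h2
  omega

/-- The contents of the data structure: `p`, `a`, `N`, `a'`, `r`, `o` describe the hash function,
`occ` its inverse, and `pi`, `px` the positions of the edges on the paths. -/
noncomputable def Scheme.table (D : Scheme G s t) (p a N : ℕ) (a' r o : ℕ → ℕ) (occ : ℕ → Option (Fin m))
    (pi px : Fin m → ℕ) : ℕ → ℕ → ℕ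
  | 0, q => [n, s, t, p, a, N, 6 * N].getD q 0
  | 1, q => a' q
  | 2, q => if q < N then r q else 0
  | 3, q => if q < N then o q else 0
  | 4, q => (occ q).elim 0 fun e => (e : ℕ) + 1
  -- Path numbers are shifted by one, so that `0` stands for an edge on no path.
  | 5, q => (occ q).elim 0 fun e => if e ∈ D.P.supp then pi e + 1 else 0
  | 6, q => (occ q).elim 0 px
  -- The only vertex at which the edge can be stored as a detour edge.
  | 7, q => (occ q).elim 0 fun e => ((if e ∈ D.P.supp then G.src e else G.tgt e : Fin n) : ℕ)
  | 8, q => (occ q).elim 0 fun e => D.lo (pi e) (px e)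
  | 9, q => (occ q).elim 0 fun e => D.hi (pi e) (px e)
  | 10, q => (occ q).elim 0 fun e => D.tg (pi e) (px e)
  | 11, q => if h : q % n < n then ((D.dedge (q / n) ⟨q % n, h⟩).map fun e => (e : ℕ) + 1).getD 0 else 0
  | 12, q => if h : q % n < n then min (D.tag (q / n) ⟨q % n, h⟩) n else 0
  | 13, q => D.P.edge (q / n) (q % n)
  | 14, q => D.P.len q
  | 15, q => D.start (q / (n + 1)) (q % (n + 1))
  | 17, q => (D.arc q).1
  | 18, q => (ahd G (D.arc q) : Fin n)
  | 19, q => (atl G (D.arc q) : Fin n)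
  | 20, q => if (D.arc q).2 = true ↔ (D.arc q).1 ∈ D.P.supp then 1 else 0
  | _, _ => 0

/-- Only edges on paths or detours are hashed, at most `2 * (D.k * n)` of them, so the hash table
needs at most `12 * (D.k * n)` cells and one empty cell. The backup arcs need `D.k * D.M` rows. -/
theorem Scheme.exists_layout (D : Scheme G s t) {N : ℕ} (hM : D.M = 2 * N * n) {w : ℕ}
    (hw₁ : 32 * ((2 * N + 16) * (D.k * n) + 2 * m + 2) ≤ 2 ^ w) (hw₂ : 2 * m * m < 2 ^ w) :
    ∃ L : List ℕ, L.length = 32 * ((2 * N + 16) * (D.k * n)) ∧ (∀ x ∈ L, x < 2 ^ w) ∧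
      Layout D w L ((2 * N + 16) * (D.k * n)) := by
  classical
  have hn := s.pos
  have hk := D.pos
  have hkm := D.k_le_card
  set R := (2 * N + 16) * (D.k * n) with hR
  have hkn : D.k ≤ D.k * n := Nat.le_mul_of_pos_right _ hn
  have hkn' : n ≤ D.k * n := Nat.le_mul_of_pos_left _ hk
  have hRN : R = D.k * D.M + 16 * (D.k * n) := by rw [hR, hM]; ring
  -- the hash table
  set K : Finset (Fin m) := D.P.supp ∪ D.detours with hK
  have hKcard : K.card ≤ 2 * (D.k * n) := (Finset.card_union_le _ _).trans (by
    have := D.card_supp_le; have := D.card_detours_le; omega)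
  have hlen : ∀ i < D.k, 0 < D.P.len i := by
    intro i hi
    by_contra h
    have h1 := D.P.vert_len i hi
    rw [Nat.eq_zero_of_not_pos h, D.P.vert_zero i hi] at h1
    exact D.ne h1
  have hKne : K.Nonempty := ⟨D.P.edge 0 0, Finset.mem_union_left _ (D.mem_supp.2 ⟨0, hk, 0, hlen 0 hk, rfl⟩)⟩
  obtain ⟨p, a, a', r, o, hp, hp0, ha, ha', ho, hcell, hinj⟩ :=
    exists_perfectHash (K.image Fin.val) (m := m) (fun x hx => by
      obtain ⟨e, -, rfl⟩ := Finset.mem_image.1 hx; exact e.2) (hKne.image _)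
  rw [Finset.card_image_of_injective _ Fin.val_injective] at ho hcell hinj
  set cell : ℕ → ℕ := hashCell p K.card a a' r o with hcelldef
  have hK0 : 0 < K.card := Finset.card_pos.2 hKne
  have hocc : ∀ q, ∃ u : Option (Fin m), ∀ e : Fin m, u = some e ↔ e ∈ K ∧ cell e = q := by
    intro q
    by_cases h : ∃ e : Fin m, e ∈ K ∧ cell e = q
    · obtain ⟨e, h1, h2⟩ := h
      refine ⟨some e, fun e' => ⟨fun h => ?_, fun ⟨h3, h4⟩ => ?_⟩⟩
      · rw [← Option.some_inj.1 h]; exact ⟨h1, h2⟩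
      · rw [Fin.ext (hinj (Finset.mem_coe.2 (Finset.mem_image_of_mem _ h1))
          (Finset.mem_coe.2 (Finset.mem_image_of_mem _ h3)) (h2.trans h4.symm))]
    · exact ⟨none, fun e => ⟨fun h => by simp at h, fun h' => absurd ⟨e, h'⟩ h⟩⟩
  choose occ hocc using hocc
  -- positions on the paths
  have hpos : ∀ e : Fin m, ∃ i x, e ∈ D.P.supp → i < D.k ∧ x < D.P.len i ∧ D.P.edge i x = e := by
    intro e
    by_cases h : e ∈ D.P.supp
    · obtain ⟨i, hi, x, hx, h⟩ := D.mem_supp.1 h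
      exact ⟨i, x, fun _ => ⟨hi, hx, h⟩⟩
    · exact ⟨0, 0, fun h' => absurd h' h⟩
  choose pi px hpos using hpos
  have hpi : ∀ i < D.k, ∀ x < D.P.len i, pi (D.P.edge i x) = i ∧ px (D.P.edge i x) = x := by
    intro i hi x hx
    obtain ⟨h1, h2, h3⟩ := hpos _ (D.mem_supp.2 ⟨i, hi, x, hx, rfl⟩)
    exact D.P.edge_inj _ h1 i hi _ h2 x hx h3
  obtain ⟨L, hLlen, hLle, hdat⟩ := exists_memory (D.table p a K.card a' r o occ pi px) R (R + 2 * m + 1)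
  have h0 : ∀ c < 32, ∀ q, D.table p a K.card a' r o occ pi px c q ≤ R + 2 * m + 1 → q < R →
      datCol L c q = D.table p a K.card a' r o occ pi px c q := by
    intro c hc q h hq
    rw [hdat c hc q, if_pos hq, min_eq_left h]
  have hle : ∀ c < 32, ∀ q, datCol L c q ≤ D.table p a K.card a' r o occ pi px c q := by
    intro c hc q
    rw [hdat c hc q]
    split_ifs
    · exact min_le_left _ _
    · exact Nat.zero_le _
  have hs := s.2
  have ht := t.2
  have hd0 : datCol L 0 0 = n := by rw [h0 0 (by omega)] <;> (try simp [Scheme.table]) <;> omega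
  have hd1 : datCol L 0 1 = s := by rw [h0 0 (by omega)] <;> (try simp [Scheme.table]) <;> omega
  have hd2 : datCol L 0 2 = t := by rw [h0 0 (by omega)] <;> (try simp [Scheme.table]) <;> omega
  have hd3 : datCol L 0 3 = p := by rw [h0 0 (by omega)] <;> (try simp [Scheme.table]) <;> omega
  have hd4 : datCol L 0 4 = a := by rw [h0 0 (by omega)] <;> (try simp [Scheme.table]) <;> omega
  have hd5 : datCol L 0 5 = K.card := by rw [h0 0 (by omega)] <;> (try simp [Scheme.table]) <;> omega
  have hd6 : datCol L 0 6 = 6 * K.card := by rw [h0 0 (by omega)] <;> (try simp [Scheme.table]) <;> omega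
  -- lookups
  have hcellL : ∀ x, cellOf L x = cell x := by
    intro x
    have hb : bucketOf L x = a * x % p % K.card := by rw [bucketOf, hd3, hd4, hd5]
    have hb' : a * x % p % K.card < K.card := Nat.mod_lt _ hK0
    have := ho _ hb'
    have := ha' (a * x % p % K.card)
    rw [cellOf, hb, hd3, h0 1 (by omega), h0 2 (by omega), h0 3 (by omega), hcelldef, hashCell]
    all_goals try simp [Scheme.table, hb', hashFn]
    all_goals omega
  have hslot : ∀ e : Fin m, occ (slotOf L e) = (if e ∈ K then some e else none) ∧ slotOf L e < R := by
    intro e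
    -- The cells in use are all below this one.
    have hdummy : occ (6 * K.card) = none := by
      rw [Option.eq_none_iff_forall_ne_some]
      intro e' he'
      obtain ⟨h1, h2⟩ := (hocc _ _).1 he'
      exact absurd (hcell _ (Finset.mem_image_of_mem _ h1)) (by omega)
    have hkey : ∀ q, datCol L 4 q ≤ (occ q).elim 0 (fun e => (e : ℕ) + 1) := fun q => hle 4 (by omega) q
    rw [slotOf, hcellL]
    by_cases he : e ∈ K
    · have h1 : occ (cell e) = some e := (hocc _ _).2 ⟨he, rfl⟩
      have h2 := hcell _ (Finset.mem_image_of_mem _ he)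
      have := e.2
      rw [if_pos, h1, if_pos he]
      · exact ⟨rfl, by omega⟩
      · rw [h0 4 (by omega)]
        all_goals try simp [Scheme.table, h1]
        all_goals omega
    -- The key in a cell is that of a hashed edge, so an edge outside of `K` never matches and is
    -- sent to the empty cell.
    · rw [if_neg, hd6, hdummy, if_neg he]
      · exact ⟨rfl, by omega⟩
      · intro h
        have h3 := hdat 4 (by omega) (cell e)
        split_ifs at h3 with h4
        · cases h5 : occ (cell e) with
          | none => have := hkey (cell e); simp [h5] at this; omega
          | some e' =>
            have := e'.2
            simp only [Scheme.table, h5, Option.elim] at h3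
            have h6 : e' = e := Fin.ext (by omega)
            exact he (h6 ▸ ((hocc _ _).1 h5).1)
        · omega
  have hK' : ∀ e ∈ K, occ (slotOf L e) = some e := fun e he => by rw [(hslot e).1, if_pos he]
  have hidx : ∀ i < D.k, ∀ x < n, i * n + x < R ∧ (i * n + x) / n = i ∧ (i * n + x) % n = x := by
    intro i hi x hx
    refine ⟨?_, ?_, ?_⟩
    · have := Nat.mul_le_mul_right n (show i + 1 ≤ D.k from hi)
      rw [Nat.succ_mul] at this
      omega
    · rw [mul_comm, Nat.mul_add_div hn, Nat.div_eq_of_lt hx, add_zero]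
    · rw [mul_comm, Nat.mul_add_mod, Nat.mod_eq_of_lt hx]
  have hidx' : ∀ i < D.k, ∀ x ≤ n, i * (n + 1) + x < R ∧ (i * (n + 1) + x) / (n + 1) = i ∧
      (i * (n + 1) + x) % (n + 1) = x := by
    intro i hi x hx
    refine ⟨?_, ?_, ?_⟩
    · have := Nat.mul_le_mul_right (n + 1) (show i + 1 ≤ D.k from hi)
      rw [Nat.succ_mul, Nat.mul_succ D.k] at this
      omega
    · rw [mul_comm, Nat.mul_add_div (Nat.succ_pos n), Nat.div_eq_of_lt (Nat.lt_succ_of_le hx), add_zero]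
    · rw [mul_comm, Nat.mul_add_mod, Nat.mod_eq_of_lt (Nat.lt_succ_of_le hx)]
  have hval : ∀ c < 32, ∀ q v, q < R → D.table p a K.card a' r o occ pi px c q = v → v ≤ R + 2 * m + 1 →
      datCol L c q = v := by
    rintro c hc q v hq rfl hv
    exact h0 c hc q hv hq
  refine ⟨L, hLlen, fun x hx => lt_of_le_of_lt (hLle x hx) (by omega), ?_⟩
  constructor
  · exact hw₁
  · exact hw₂
  · omega
  · rw [Nat.mul_succ]; omega
  · omega
  · exact hd0
  · exact hd1
  · exact hd2
  · rw [hd3]; exact ⟨hp0, hp⟩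
  · rw [hd3, hd4]; exact ha
  · rw [hd5]; omega
  · rw [hd6]; omega
  · intro j
    rw [hd3]
    exact (hle 1 (by omega) j).trans_lt (ha' j)
  · intro j
    refine (hle 3 (by omega) j).trans ?_
    simp only [Scheme.table]
    split_ifs with h
    · have := ho j h; omega
    · omega
  · intro j
    refine (hle 4 (by omega) j).trans ?_
    simp only [Scheme.table]
    cases occ j with
    | none => exact Nat.zero_le _
    | some e => exact e.2
  · intro i hi x hx
    have hsupp := D.mem_supp.2 ⟨i, hi, x, hx, rfl⟩
    have hocc' := hK' _ (Finset.mem_union_left _ hsupp)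
    have hq := (hslot (D.P.edge i x)).2
    obtain ⟨h1, h2⟩ := hpi i hi x hx
    have h3 := D.len_lt hi
    obtain ⟨h4, h5, h6, h7, -⟩ := D.single i hi x hx
    refine ⟨hval 5 (by omega) _ _ hq ?_ (by omega), hval 6 (by omega) _ _ hq ?_ (by omega),
      hval 8 (by omega) _ _ hq ?_ (by omega), hval 9 (by omega) _ _ hq ?_ (by omega),
      hval 10 (by omega) _ _ hq ?_ (by omega)⟩
    all_goals simp [Scheme.table, hocc', hsupp, h1, h2]
  · intro e he
    refine hval 5 (by omega) _ _ (hslot e).2 ?_ (by omega)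
    simp only [Scheme.table, (hslot e).1]
    split_ifs <;> simp [he]
  · intro e
    refine (hle 7 (by omega) _).trans_lt ?_
    simp only [Scheme.table]
    cases occ (slotOf L e) with
    | none => exact hn
    | some e' => exact Fin.is_lt _
  · intro i v e h
    have he : e ∈ K := Finset.mem_union_right _ (Finset.mem_filter.2 ⟨Finset.mem_univ _, i, v, h⟩)
    have := v.2
    refine hval 7 (by omega) _ _ (hslot e).2 ?_ (by omega)
    simp only [Scheme.table, hK' e he, Option.elim]
    rw [← (D.dedge_some i v e h).2.2.2.2]
  · intro i hi v
    obtain ⟨h1, h2, h3⟩ := hidx i hi v v.2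
    refine hval 11 (by omega) _ _ h1 ?_ ?_
    · simp [Scheme.table, h2, h3]
    · cases h : D.dedge i v with
      | none => simp
      | some e => have := e.2; simp; omega
  · intro i hi v hv
    obtain ⟨h1, h2, h3⟩ := hidx i hi v v.2
    have h4 : D.tag i v ≤ n := by
      obtain ⟨e, he⟩ := Option.ne_none_iff_exists'.1 hv
      have := (D.dedge_some i v e he).2.2.1
      have := D.len_lt hi
      omega
    refine hval 12 (by omega) _ _ h1 ?_ (by omega)
    simp [Scheme.table, h2, h3, h4]
  · intro q
    refine (hle 12 (by omega) q).trans ?_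
    simp only [Scheme.table]
    split_ifs
    · exact min_le_right _ _
    · exact Nat.zero_le _
  · intro i hi x hx
    obtain ⟨h1, h2, h3⟩ := hidx i hi x (hx.trans (D.len_lt hi))
    have := (D.P.edge i x).2
    refine hval 13 (by omega) _ _ h1 ?_ (by omega)
    simp only [Scheme.table, h2, h3]
  · intro i hi
    have := D.len_lt hi
    exact hval 14 (by omega) _ _ (by omega) rfl (by omega)
  · intro i hi v hv
    obtain ⟨h1, h2, h3⟩ := hidx' i hi v hv
    have := D.start_le_mul i hi
    have := D.start_mono i hv
    refine hval 15 (by omega) _ _ h1 ?_ (by omega)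
    simp only [Scheme.table, h2, h3]
  · intro h hh
    have := (D.arc h).1.2
    exact hval 17 (by omega) _ _ (by omega) rfl (by omega)
  · intro h hh
    have := (ahd G (D.arc h) : Fin n).2
    exact hval 18 (by omega) _ _ (by omega) rfl (by omega)
  · intro h hh
    have := (atl G (D.arc h) : Fin n).2
    exact hval 19 (by omega) _ _ (by omega) rfl (by omega)
  · intro h hh
    refine hval 20 (by omega) _ _ (by omega) ?_ ?_
    · simp only [Scheme.table]
    · split_ifs <;> omega

end FTFlow

/-! ### Answers to the queries -/

namespace FTFlow

open WordRAM

variable {w : ℕ} {L : List ℕ} {n m : ℕ} {G : MultiDigraph (Fin n) (Fin m)} {s t : Fin n}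
  {R : ℕ}

theorem Trip.haltsWithin {c : Cmd} {input : List ℕ} {T : ℕ} {Q : St → Prop} (hw : 6 ≤ w)
    (hL : ∀ x ∈ L, x < 2 ^ w) (h : Trip w L c (St.init w input) T Q) :
    ∃ σ, Q σ ∧ HaltsWithin (c.comp 0) w L input T σ.out := by
  obtain ⟨σ, k, h1, h2, h3⟩ := h
  exact ⟨σ, h3, h1.haltsWithin hw hL h2⟩

/-- The indicator functions of the sets `S` and `S'` differ exactly where the sets do. -/
theorem indicator_ne_iff {α : Type*} [DecidableEq α] {S S' : Finset α} {e : α} :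
    ((if e ∈ S then 1 else 0 : ℝ) ≠ if e ∈ S' then 1 else 0) ↔ ¬ (e ∈ S ↔ e ∈ S') := by
  by_cases h : e ∈ S <;> by_cases h' : e ∈ S' <;> simp [h, h']

/-- The flow `f'` of `G - F` and the programs that compute it, in time `T` and `T'`, from the
data structure `L` that represents the flow `f` of `G`. -/
def IsUpdate (G : MultiDigraph (Fin n) (Fin m)) (s t : Fin n) (w : ℕ) (L : List ℕ) (T T' : ℕ)
    (f : Fin m → ℝ) (F : Finset (Fin m)) (f' : {e : Fin m // e ∉ F} → ℝ) : Prop :=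
  (G.deleteEdges F).IsMaxFlow s t f' ∧ (∀ e, f' e = 0 ∨ f' e = 1) ∧
    (∀ l : List (Fin m), l.Nodup → l.toFinset = F → ∃ out : List ℕ,
      HaltsWithin (reportCmd.comp 0) w L (l.length :: l.map Fin.val) T out ∧ out.Nodup ∧
      ∀ i : ℕ, i ∈ out ↔ ∃ e : {e : Fin m // e ∉ F}, (e.1 : ℕ) = i ∧ f' e ≠ f e.1) ∧
    (∀ e₀ : Fin m, F = {e₀} → ∀ x : {e : Fin m // e ∉ F}, ∃ b : ℕ, f' x = b ∧
      HaltsWithin (edgeFlowCmd.comp 0) w L [(e₀ : ℕ), (x.1 : ℕ)] T' [b])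

theorem HasCut.isMaxFlow {S F : Finset (Fin m)} {c : ℤ} (h : HasCut G s t F c) (hst : s ≠ t)
    (hS : IsFlowSet G s t S c) (hSF : Disjoint S F) :
    (G.deleteEdges F).IsMaxFlow s t (fun e => if e.1 ∈ S then 1 else 0) := by
  obtain ⟨X, h1, h2, h3⟩ := h
  exact isMaxFlow_deleteEdges hst hS hSF X h1 h2 h3

theorem Scheme.IsAfterOne.isMaxFlow {D : Scheme G s t} {e₀ : Fin m} {S : Finset (Fin m)} (h : D.IsAfterOne e₀ S) :
    (G.deleteEdges {e₀}).IsMaxFlow s t (fun e => if e.1 ∈ S then 1 else 0) := by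
  by_cases he : e₀ ∈ D.P.supp
  · obtain ⟨i, hi, x, hx, rfl⟩ := D.mem_supp.1 he
    rw [h.1 i hi x hx rfl]
    obtain ⟨-, -, -, -, h5, c, h6, h7⟩ := D.single i hi x hx
    exact HasCut.isMaxFlow h7 D.ne h6 (Finset.disjoint_singleton_right.2 h5)
  · rw [h.2 he]
    exact HasCut.isMaxFlow (D.P.exists_min_cut D.max _) D.ne D.P.isFlowSet (Finset.disjoint_singleton_right.2 he)

variable {D : Scheme G s t}

/-- The updated flow is the old one, the stored single-failure flow or the flow that the program
computes, for zero, one or two failing edges. -/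
theorem Layout.exists_update (hL : Layout D w L R) (hw : 6 ≤ w) (hlt : ∀ x ∈ L, x < 2 ^ w)
    {F : Finset (Fin m)} (hF : F.card ≤ 2) : ∃ f', IsUpdate G s t w L (reportTime n D.M + 100) edgeFlowCmd.cost
      (fun e => if e ∈ D.P.supp then 1 else 0) F f' := by
  have w1 := hL.word₁
  have h01 : ∀ S : Finset (Fin m), ∀ e : {e : Fin m // e ∉ F}, (if e.1 ∈ S then 1 else 0 : ℝ) = 0 ∨
      (if e.1 ∈ S then 1 else 0 : ℝ) = 1 := fun S e => by split_ifs <;> simp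
  obtain h | h | h : F.card = 0 ∨ F.card = 1 ∨ F.card = 2 := by omega
  · obtain rfl := Finset.card_eq_zero.1 h
    refine ⟨fun e => if e.1 ∈ D.P.supp then 1 else 0, HasCut.isMaxFlow (D.P.exists_min_cut D.max _) D.ne
      D.P.isFlowSet (Finset.disjoint_empty_right _), h01 _, fun l _ hl => ?_, fun e₀ h => ?_⟩
    · obtain rfl := (List.toFinset_eq_empty_iff l).1 hl
      obtain ⟨σ, h1, h2⟩ := hL.trip_report_none.haltsWithin hw hlt
      rw [h1] at h2
      exact ⟨[], h2, List.nodup_nil, by simp⟩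
    · exact absurd h.symm (Finset.singleton_ne_empty e₀)
  · obtain ⟨e₀, rfl⟩ := Finset.card_eq_one.1 h
    obtain ⟨S, hS⟩ := D.exists_isAfterOne e₀
    refine ⟨fun e => if e.1 ∈ S then 1 else 0, hS.isMaxFlow, h01 _, fun l hl hl' => ?_, fun e₁ h x => ?_⟩
    · have hlen := List.toFinset_card_of_nodup hl
      rw [hl', Finset.card_singleton] at hlen
      obtain ⟨e, rfl⟩ := List.length_eq_one_iff.1 hlen.symm
      obtain rfl : e = e₀ := by simpa using hl'
      obtain ⟨σ, ⟨h1, h2⟩, h3⟩ := (hL.trip_report_one hS).haltsWithin hw hlt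
      refine ⟨σ.out, h3, h1, fun i => ?_⟩
      rw [h2]
      constructor
      · rintro ⟨e', h4, h5, h6⟩
        exact ⟨⟨e', by simpa using h4⟩, h6, indicator_ne_iff.2 h5⟩
      · rintro ⟨e', h4, h5⟩
        exact ⟨e'.1, by simpa using e'.2, indicator_ne_iff.1 h5, h4⟩
    · obtain rfl := Finset.singleton_injective h
      have hx : x.1 ≠ e₀ := by simpa using x.2
      have he₀ := e₀.2
      have hx' := x.1.2
      obtain ⟨σ, h1, h2⟩ := (hL.wp_edgeFlow hS hx (σ := St.init w [(e₀ : ℕ), (x.1 : ℕ)])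
        (init_v (by omega) rfl) (init_v (by omega) rfl) rfl).trip.haltsWithin hw hlt
      rw [h1] at h2
      exact ⟨if x.1 ∈ S then 1 else 0, by simp, h2⟩
  · obtain ⟨e₁, e₂, hlt', rfl⟩ : ∃ e₁ e₂ : Fin m, e₁ < e₂ ∧ F = {e₁, e₂} := by
      obtain ⟨a, b, hab, rfl⟩ := Finset.card_eq_two.1 h
      rcases lt_or_gt_of_ne hab with h | h
      · exact ⟨a, b, h, rfl⟩
      · exact ⟨b, a, h, Finset.pair_comm _ _⟩
    have he₁ := e₁.2
    have he₂ := e₂.2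
    obtain ⟨σ, T, hbig, hT, Φ, c, h1, h2, h3, h4, h5⟩ := hL.trip_reportTwo (σ := St.init w [2, (e₁ : ℕ), (e₂ : ℕ)])
      (init_v (by omega) rfl) (init_v (by omega) rfl) rfl fun _ => rfl
    -- The postcondition fixes the final state, so both orders of the input are answered with one
    -- and the same flow.
    obtain ⟨k1, k2⟩ := hL.trip_report_two hlt' he₂ (Q := fun σ' => σ' = σ) ⟨σ, T, hbig, hT, rfl⟩
    refine ⟨fun e => if e.1 ∈ symmDiff D.P.supp Φ then 1 else 0, h3.isMaxFlow D.ne h1 h2, h01 _,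
      fun l hl hl' => ?_, fun e₀ h' => by rw [h', Finset.card_singleton] at h; omega⟩
    refine ⟨σ.out, ?_, h4, fun i => ?_⟩
    · have hlen := List.toFinset_card_of_nodup hl
      rw [hl', h] at hlen
      obtain ⟨a, b, rfl⟩ := List.length_eq_two.1 hlen.symm
      obtain ⟨σ₁, rfl, g1⟩ := k1.haltsWithin hw hlt
      obtain ⟨σ₂, rfl, g2⟩ := k2.haltsWithin hw hlt
      have hab : a ≠ b := by simpa using hl
      have ha : a = e₁ ∨ a = e₂ := by
        have : a ∈ ({e₁, e₂} : Finset (Fin m)) := hl' ▸ by simp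
        simpa using this
      have hb : b = e₁ ∨ b = e₂ := by
        have : b ∈ ({e₁, e₂} : Finset (Fin m)) := hl' ▸ by simp
        simpa using this
      rcases ha with rfl | rfl <;> rcases hb with rfl | rfl
      · exact absurd rfl hab
      · exact g1
      · exact g2
      · exact absurd rfl hab
    · rw [h5]
      have key : ∀ e : Fin m, ((if e ∈ symmDiff D.P.supp Φ then 1 else 0 : ℝ) ≠ if e ∈ D.P.supp then 1 else 0) ↔
          e ∈ Φ := by
        intro e
        rw [indicator_ne_iff, Finset.mem_symmDiff]
        tauto
      constructor
      · rintro ⟨e, h6, h7, h8⟩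
        exact ⟨⟨e, h7⟩, h8, (key e).2 h6⟩
      · rintro ⟨e, h6, h7⟩
        exact ⟨e.1, (key e.1).1 h7, e.2, h6⟩

/-- If there is no path from the source to the sink, then no data structure is necessary. -/
theorem exists_update_of_cut (hw : 6 ≤ w) (hst : s ≠ t) (h : HasCut G s t ∅ 0) {F : Finset (Fin m)}
    {T T' : ℕ} (hT : 100 ≤ T) (hT' : 100 ≤ T') :
    ∃ f', IsUpdate G s t w [] T T' (fun e => if e ∈ (∅ : Finset (Fin m)) then 1 else 0) F f' := by
  have hcut : HasCut G s t F 0 := by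
    obtain ⟨X, h1, h2, h3⟩ := h
    refine ⟨X, h1, h2, le_trans ?_ h3⟩
    exact_mod_cast Finset.card_le_card fun e he => by
      simp only [Finset.mem_filter, Finset.mem_univ, true_and, Finset.notMem_empty, not_false_eq_true] at he ⊢
      exact he.2
  refine ⟨fun e => if e.1 ∈ (∅ : Finset (Fin m)) then 1 else 0, hcut.isMaxFlow hst (fun v => by simp [znet])
    (Finset.disjoint_empty_left _), fun e => by simp, fun l _ _ => ?_, fun e₀ _ x => ?_⟩
  · have h1 : Trip w [] reportCmd (St.init w (l.length :: l.map Fin.val)) T fun σ => σ.out = [] := by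
      -- An empty data structure reads as `n = 0`, which both programs test first.
      refine (Trip.ite (T := 0) ?_ ?_ ?_ ?_).mono ?_ fun _ h => h
      all_goals simp [datCol]
      all_goals try omega
      exact ⟨_, 0, .skip _, le_rfl, rfl⟩
    obtain ⟨σ, h2, h3⟩ := h1.haltsWithin hw (by simp)
    rw [h2] at h3
    exact ⟨[], h3, List.nodup_nil, by simp⟩
  · have h1 : Trip w [] edgeFlowCmd (St.init w [(e₀ : ℕ), (x.1 : ℕ)]) T' fun σ => σ.out = [0] := by
      refine (Trip.ite (T := 10) ?_ ?_ ?_ ?_).mono ?_ fun _ h => h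
      all_goals simp [datCol]
      all_goals try omega
      exact ⟨_, _, .emit _ _ (by simp), by simp, rfl⟩
    obtain ⟨σ, h2, h3⟩ := h1.haltsWithin hw (by simp)
    rw [h2] at h3
    exact ⟨0, by simp, h3⟩

end FTFlow

/-! ### Choice of the constants and conclusion -/

namespace FTFlow

/-- Two of the `q + 2` blocks of binary digits hold the square, and the others hold the factor `q`.
-/
theorem two_pow_wordSize_ge (q n m : ℕ) : q * ((n + m + 1) * (n + m + 1)) ≤ 2 ^ wordSize (q + 2) n m := by
  set b := Nat.log 2 (n + m) + 1 with hb
  have h1 : n + m + 1 ≤ 2 ^ b := Nat.lt_pow_succ_log_self (by norm_num) _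
  have h2 : q ≤ 2 ^ (q * b) := (Nat.lt_two_pow_self (n := q)).le.trans
    (Nat.pow_le_pow_right (by norm_num) (Nat.le_mul_of_pos_right _ (Nat.succ_pos _)))
  have h3 : 2 ^ wordSize (q + 2) n m = 2 ^ (q * b) * (2 ^ b * 2 ^ b) := by
    rw [wordSize, ← hb, ← pow_add, ← pow_add]
    congr 1
    ring
  rw [h3]
  gcongr

theorem HaltsWithin.mono {P : WordRAM.Program} {w : ℕ} {L input out : List ℕ} {T T' : ℕ}
    (h : WordRAM.HaltsWithin P w L input T out) (hT : T ≤ T') : WordRAM.HaltsWithin P w L input T' out := by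
  obtain ⟨k, hk, h⟩ := h
  exact ⟨k, hk.trans hT, h⟩

/-- The constant in the bounds on space and time. -/
def costBound (N : ℕ) : ℕ := 2100 * N + 5000 + edgeFlowCmd.cost

theorem le_costBound (N : ℕ) : 2100 * N + 5000 ≤ costBound N ∧ edgeFlowCmd.cost ≤ costBound N :=
  ⟨Nat.le_add_right _ _, Nat.le_add_left _ _⟩

end FTFlow

open FTFlow in
theorem theorem2 :
    ∃ (c C : ℕ) (report edgeFlow : WordRAM.Program), 1 ≤ c ∧
      ∀ (n m : ℕ) (G : MultiDigraph (Fin n) (Fin m)) (s t : Fin n), s ≠ t →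
        ∃ (f : Fin m → ℝ) (D : List ℕ),
          -- `f` is a max-flow with values 0 and 1
          G.IsMaxFlow s t f ∧ (∀ e, f e = 0 ∨ f e = 1) ∧
          -- `D` consists of `O(λ n)` words, where `λ` is the value of `f`
          (D.length : ℝ) ≤ C * G.flowValue s f * n ∧
          (∀ d ∈ D, d < 2 ^ wordSize c n m) ∧
          -- for every set `F` of at most two failing edges there is an updated max-flow `f'`
          ∀ F : Finset (Fin m), F.card ≤ 2 →
            ∃ f' : {e : Fin m // e ∉ F} → ℝ,
              (G.deleteEdges F).IsMaxFlow s t f' ∧ (∀ e, f' e = 0 ∨ f' e = 1) ∧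
              -- in `O(n)` steps, for `F` listed in any order: all edges whose flow has changed
              (∀ L : List (Fin m), L.Nodup → L.toFinset = F →
                ∃ out : List ℕ,
                  WordRAM.HaltsWithin report (wordSize c n m) D
                    (L.length :: L.map Fin.val) (C * n) out ∧
                  out.Nodup ∧
                  ∀ i : ℕ, i ∈ out ↔
                    ∃ e : {e : Fin m // e ∉ F}, (e.1 : ℕ) = i ∧ f' e ≠ f e.1) ∧
              -- in `O(1)` steps, for a single failing edge: the flow on a given edge
              (∀ e₀ : Fin m, F = {e₀} → ∀ x : {e : Fin m // e ∉ F},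
                ∃ b : ℕ, f' x = b ∧
                  WordRAM.HaltsWithin edgeFlow (wordSize c n m) D
                    [(e₀ : ℕ), (x.1 : ℕ)] C [b]) := by
  obtain ⟨N, hN⟩ := exists_isBackup
  obtain ⟨hC, hC'⟩ := le_costBound N
  generalize costBound N = C at hC hC'
  -- Of the factor `2 * N + 20`, the part `2 * N + 16` is for the rows of the table and `4` for the
  -- edge numbers in `word₁`; `32` is the number of columns.
  refine ⟨32 * (2 * N + 20) + 2, C, reportCmd.comp 0, edgeFlowCmd.comp 0, by omega, fun n m G s t hst => ?_⟩
  have hn := s.pos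
  have hpow := two_pow_wordSize_ge (32 * (2 * N + 20)) n m
  have hw : 6 ≤ wordSize (32 * (2 * N + 20) + 2) n m := by
    have : _ ≤ wordSize (32 * (2 * N + 20) + 2) n m := Nat.le_mul_of_pos_right _ (Nat.succ_pos _)
    omega
  have h01 : ∀ (S : Finset (Fin m)) (e : Fin m), (if e ∈ S then 1 else 0 : ℝ) = 0 ∨
      (if e ∈ S then 1 else 0 : ℝ) = 1 := fun S e => by split_ifs <;> simp
  -- For value zero the data structure must be empty, since its length is bounded by a multiple of
  -- `λ`; this case is separate.
  obtain hcut | ⟨k, hk, P, hmax⟩ : HasCut G s t ∅ 0 ∨ ∃ k, 0 < k ∧ ∃ P : PathSystem G s t k,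
      t ∉ reach (atl G) (ahd G) (resArcs P.supp) {s} := by
    rcases isEmpty_or_nonempty (Fin m) with hm | hm
    · exact Or.inl ⟨{s}, by simp, by simpa using hst.symm, by simp⟩
    · obtain ⟨k, P, hmax⟩ := exists_max_pathSystem G hst
      rcases Nat.eq_zero_or_pos k with rfl | hk
      · exact Or.inl (P.exists_min_cut hmax ∅)
      · exact Or.inr ⟨k, hk, P, hmax⟩
  · obtain ⟨X, h1, h2, h3⟩ := id hcut
    obtain ⟨h4, h5⟩ := isMaxFlow_indicator (G := G) (k := 0) hst (S := (∅ : Finset (Fin m)))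
      (fun v => by simp [znet]) X h1 h2 (by simpa using h3)
    refine ⟨_, [], h4, h01 _, ?_, by simp, fun F _ => exists_update_of_cut hw hst hcut ?_ ?_⟩
    · rw [h5]; simp
    · exact le_trans (by omega) (Nat.le_mul_of_pos_right C hn)
    · omega
  · obtain ⟨D, hDk, hDM⟩ := exists_scheme hN G hst hk P hmax
    have hkm := D.k_le_card
    have hkn : D.k * n ≤ m * n := Nat.mul_le_mul_right _ hkm
    have hx₁ : m * n ≤ (n + m + 1) * (n + m + 1) := Nat.mul_le_mul (by omega) (by omega)
    have hx₂ : m * m ≤ (n + m + 1) * (n + m + 1) := Nat.mul_le_mul (by omega) (by omega)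
    have hx₃ : n + m + 1 ≤ (n + m + 1) * (n + m + 1) := Nat.le_mul_of_pos_left _ (Nat.succ_pos _)
    set x := (n + m + 1) * (n + m + 1)
    have hx₄ : (2 * N + 16) * (D.k * n) ≤ (2 * N + 16) * x := Nat.mul_le_mul_left _ (hkn.trans hx₁)
    have hx₅ : 32 * (2 * N + 20) * x = 32 * ((2 * N + 16) * x + 4 * x) := by ring
    obtain ⟨L, h1, h2, h3⟩ := D.exists_layout hDM (w := wordSize (32 * (2 * N + 20) + 2) n m)
      (by omega) (by rw [mul_assoc]; omega)
    obtain ⟨X, g1, g2, g3⟩ := D.P.exists_min_cut D.max ∅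
    obtain ⟨h4, h5⟩ := isMaxFlow_indicator hst D.P.isFlowSet X g1 g2 (by simpa using g3)
    refine ⟨_, L, h4, h01 _, ?_, h2, fun F hF => ?_⟩
    · rw [h5, h1, mul_assoc]
      have h6 : 32 * (2 * N + 16) ≤ C := by linarith
      have : 32 * ((2 * N + 16) * (D.k * n)) ≤ C * (D.k * n) := by
        rw [← mul_assoc]
        exact Nat.mul_le_mul_right _ h6
      exact_mod_cast this
    · obtain ⟨f', k1, k2, k3, k4⟩ := h3.exists_update hw h2 hF
      refine ⟨f', k1, k2, fun l hl hl' => ?_, fun e₀ he x => ?_⟩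
      · obtain ⟨out, k5, k6⟩ := k3 l hl hl'
        refine ⟨out, HaltsWithin.mono k5 ?_, k6⟩
        have h6 := Nat.mul_le_mul_right n hC
        have h7 : (2100 * N + 5000) * n = 2100 * (N * n) + 5000 * n := by ring
        have h8 : 2 * N * n = 2 * (N * n) := by ring
        rw [reportTime, hDM, h8]
        omega
      · obtain ⟨b, k5, k6⟩ := k4 e₀ he x
        refine ⟨b, k5, ?_⟩
        exact HaltsWithin.mono k6 hC'
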